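/- All graphs are finite and simple. Two plane graphs are equivalent if they have the same underlying graph, the same cyclic order of the incident edges at each vertex, and the same outer face. A *crossing-free* drawing of a plane graph is a straight-line drawing that is a limit of planar straight-line drawings equivalent to the plane graph. A plane graph is *area-universal* if for every assignment of nonnegative reals to its inner faces there is such a crossing-free drawing in which every inner face has its assigned area. Let $\ell,k\ge 1$. In the plane octahedron with outer face $ABC$ and central face $uvw$, let the pairs of opposite (non-adjacent) vertices be $\{A,w\},\{B,u\},\{C,v\}$. Applying a *diamond of order $m\ge 0$* to an edge $e$ incident to two triangular faces with third vertices $p$ and $q$ means subdividing $e$ with $m$ new vertices and joining each new vertex to $p$ and $q$. The *double stacking graph* $DS(\ell,k)$ is obtained from the octahedron by a diamond of order $\ell-1$ on $Au$ (third vertices $C,v$) and a diamond of order $k-1$ on $vw$ (third vertices $B,u$). **Theorem 4.** For all integers $\ell,k\ge 1$ and every plane graph $P$ (i.e. every plane embedding, with any choice of outer face) whose underlying planar graph is that of $DS(\ell,k)$: $P$ is area-universal if and only if $\ell\cdot k$ is even. -/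

import Mathlib

/-! ## Plane graphs -/

/-- Given the permutation `rot` sending each dart (oriented edge) to the next dart in
counterclockwise order around its tail, the permutation sending a dart `d` to the next dart on the
boundary walk of the face to the left of `d`: at the head of `d`, take the dart that follows the
reversal of `d` in clockwise order. -/
def faceStep {V : Type*} {G : SimpleGraph V} (rot : Equiv.Perm G.Dart) : Equiv.Perm G.Dart :=
  (Function.Involutive.toPerm SimpleGraph.Dart.symm SimpleGraph.Dart.symm_involutive).trans rot⁻¹

/-- The faces given by the cyclic orders `rot`: the orbits of `faceStep rot`, i.e. the boundary
walks that keep the face on their left. -/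
abbrev FaceOrbit {V : Type*} {G : SimpleGraph V} (rot : Equiv.Perm G.Dart) : Type _ :=
  Quotient (Equiv.Perm.SameCycle.setoid (faceStep rot))

/-- A plane graph with underlying connected simple graph `G`, up to equivalence: the cyclic
(counterclockwise) order `rot` of the darts at each vertex, and the outer face.
That the cyclic orders describe an embedding in the sphere (hence, with an outer face chosen, in the
plane) is Euler's formula: the embedded surface has genus `0`. -/
structure PlaneGraph {V : Type*} [Finite V] (G : SimpleGraph V) where
  /-- the next dart around the tail, counterclockwise -/
  rot : Equiv.Perm G.Dart
  rot_fst : ∀ d, (rot d).fst = d.fst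
  rot_sameCycle : ∀ d e : G.Dart, d.fst = e.fst → rot.SameCycle d e
  connected : G.Connected
  /-- `|V| - |E| + |F| = 2` -/
  euler : Nat.card V + Nat.card (FaceOrbit rot) = Nat.card G.edgeSet + 2
  /-- the outer face -/
  outerFace : FaceOrbit rot

namespace PlaneGraph

variable {V : Type*} [Finite V] {G : SimpleGraph V}

/-- The faces of a plane graph. -/
abbrev Face (P : PlaneGraph G) : Type _ := FaceOrbit P.rot

/-- The face to the left of a dart. -/
def leftFace (P : PlaneGraph G) (d : G.Dart) : P.Face :=
  Quotient.mk (Equiv.Perm.SameCycle.setoid (faceStep P.rot)) d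

/-- The inner faces. -/
abbrev InnerFace (P : PlaneGraph G) : Type _ := {f : P.Face // f ≠ P.outerFace}

end PlaneGraph

/-! ## Straight-line drawings; the plane is `ℂ` -/

section Drawings

variable {V : Type*}

/-- The point set of the straight-line drawing of `G` with vertex placement `D`. -/
def drawingSet (G : SimpleGraph V) (D : V → ℂ) : Set ℂ :=
  Set.range D ∪ ⋃ d : G.Dart, segment ℝ (D d.fst) (D d.snd)

/-- The straight-line drawing of `G` with vertex placement `D` is planar: distinct vertices have
distinct positions, vertices lie only on edges they are an end of, and distinct edges meet only in
common ends. -/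
structure IsPlanarDrawing (G : SimpleGraph V) (D : V → ℂ) : Prop where
  injective : Function.Injective D
  vertex_edge : ∀ (x : V) (d : G.Dart), D x ∈ segment ℝ (D d.fst) (D d.snd) →
    x = d.fst ∨ x = d.snd
  edge_edge : ∀ d e : G.Dart, d.edge ≠ e.edge →
    segment ℝ (D d.fst) (D d.snd) ∩ segment ℝ (D e.fst) (D e.snd) ⊆
      D '' {x | x ∈ d.edge ∧ x ∈ e.edge}

/-- The vector from the tail to the head of a dart. -/
def dartVec {G : SimpleGraph V} (D : V → ℂ) (d : G.Dart) : ℂ := D d.snd - D d.fst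

/-- The counterclockwise angle in `[0, 2π)` from `z` to `w`. -/
noncomputable def ccwAngle (z w : ℂ) : ℝ :=
  toIcoMod Real.two_pi_pos 0 (Complex.arg (w / z))

end Drawings

namespace PlaneGraph

variable {V : Type*} [Finite V] {G : SimpleGraph V}

/-- `D` is a planar straight-line drawing equivalent to the plane graph `P`: it is planar, the
cyclic order of the edges at each vertex is that of `P` (`rot d` is the first dart met when turning
counterclockwise from `d`), and the outer face is that of `P` (the region immediately to the left
of each of its darts is the unbounded one). -/
structure IsEquivalentPlanarDrawing (P : PlaneGraph G) (D : V → ℂ) : Prop where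
  planar : IsPlanarDrawing G D
  rot_next : ∀ d e : G.Dart, e.fst = d.fst → e ≠ d →
    ccwAngle (dartVec D d) (dartVec D (P.rot d)) ≤ ccwAngle (dartVec D d) (dartVec D e)
  outer_unbounded : ∀ d : G.Dart, P.leftFace d = P.outerFace →
    ∀ᶠ ε : ℝ in nhdsWithin 0 (Set.Ioi 0),
      ¬ Bornology.IsBounded (connectedComponentIn (drawingSet G D)ᶜ
        (midpoint ℝ (D d.fst) (D d.snd) + (ε : ℂ) * (Complex.I * dartVec D d)))

/-- `D` is a crossing-free (possibly degenerate) straight-line drawing equivalent to `P`: a limit of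
planar straight-line drawings equivalent to `P`. -/
def IsCrossingFreeDrawing (P : PlaneGraph G) (D : V → ℂ) : Prop :=
  ∃ s : ℕ → V → ℂ, (∀ n, P.IsEquivalentPlanarDrawing (s n)) ∧
    Filter.Tendsto s Filter.atTop (nhds D)

/-- The area of a face in a drawing, by the shoelace formula for its boundary walk. The walk keeps
the face on its left, so that in a drawing equivalent to `P` this is the area of an inner face. -/
noncomputable def faceArea (P : PlaneGraph G) (D : V → ℂ) (f : P.Face) : ℝ :=
  (∑ᶠ d : {d : G.Dart // P.leftFace d = f},
    ((D d.1.fst).re * (D d.1.snd).im - (D d.1.snd).re * (D d.1.fst).im)) / 2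

/-- `P` is area-universal: every assignment of nonnegative areas to the inner faces is realized by
a crossing-free straight-line drawing equivalent to `P`. -/
def AreaUniversal (P : PlaneGraph G) : Prop :=
  ∀ a : P.InnerFace → NNReal, ∃ D : V → ℂ, P.IsCrossingFreeDrawing D ∧
    ∀ f : P.InnerFace, P.faceArea D f.1 = (a f : ℝ)

end PlaneGraph

/-! ## Double stacking graphs -/

/-- The adjacency relation of `diamond`; the new vertices are `0, …, m - 1`. -/
def diamondAdj {V : Type*} (G : SimpleGraph V) (a b p q : V) (m : ℕ) :
    V ⊕ Fin m → V ⊕ Fin m → Prop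
  | .inl x, .inl y => G.Adj x y ∧ (m = 0 ∨ s(x, y) ≠ s(a, b))
  | .inl x, .inr i => x = p ∨ x = q ∨ (x = a ∧ i.val = 0) ∨ (x = b ∧ i.val + 1 = m)
  | .inr i, .inl x => x = p ∨ x = q ∨ (x = a ∧ i.val = 0) ∨ (x = b ∧ i.val + 1 = m)
  | .inr i, .inr j => i.val + 1 = j.val ∨ j.val + 1 = i.val

/-- The diamond operation of order `m` on the edge `ab` of `G`, where the two triangular faces at
`ab` have third vertices `p` and `q`: subdivide `ab` with `m` new vertices (from `a` to `b`) and
join each new vertex to `p` and `q`. -/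
def diamond {V : Type*} (G : SimpleGraph V) (a b p q : V) (m : ℕ) :
    SimpleGraph (V ⊕ Fin m) where
  Adj := diamondAdj G a b p q m
  symm := ⟨by
    rintro (x | i) (y | j) h
    · exact ⟨h.1.symm, by rw [Sym2.eq_swap]; exact h.2⟩
    · exact h
    · exact h
    · exact Or.symm h⟩
  loopless := ⟨by
    rintro (x | i) h
    · exact G.irrefl h.1
    · have h' : i.val + 1 = i.val ∨ i.val + 1 = i.val := h
      omega⟩

/-- The vertices of the octahedron, drawn with outer triangle `ABC` and central triangle `uvw`. -/
inductive OctVertex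
  | A | B | C | u | v | w
  deriving DecidableEq

instance : Fintype OctVertex where
  elems := {.A, .B, .C, .u, .v, .w}
  complete x := by cases x <;> decide

/-- The opposite vertex in the octahedron. -/
def OctVertex.opp : OctVertex → OctVertex
  | .A => .w | .B => .u | .C => .v | .u => .B | .v => .C | .w => .A

/-- The octahedron graph: distinct vertices are adjacent unless they are opposite. -/
def octahedron : SimpleGraph OctVertex where
  Adj x y := x ≠ y ∧ y ≠ x.opp
  symm := ⟨by decide⟩
  loopless := ⟨fun _ h => h.1 rfl⟩

/-- The (underlying planar graph of the) double stacking graph `DS(ℓ, k)`, for `ℓ, k ≥ 1`: the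
octahedron with a diamond operation of order `ℓ - 1` on `Au` (at the faces `AuC` and `Auv`) and one
of order `k - 1` on `vw` (at the faces `vwB` and `vwu`). -/
def doubleStacking (l k : ℕ) : SimpleGraph ((OctVertex ⊕ Fin (l - 1)) ⊕ Fin (k - 1)) :=
  diamond (diamond octahedron .A .u .C .v (l - 1))
    (.inl .v) (.inl .w) (.inl .B) (.inl .u) (k - 1)

/-!
The graph `DS(l, k)` consists of two paths `p 0, …, p m` and `q 0, …, q n` with `m = l + 1` and
`n = k + 1`, whose ends are joined to all vertices of the other path (`IsDoublePath`). It has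
`3 |V| - 6` edges, so by Euler's formula every plane embedding is a triangulation
(`PlaneGraph.isTriangulation_of_card`), and since all its triangles are facial, the embedding is
unique up to reflection (`IsTriangulation.orientation`). Reversing the path `p` reflects the
embedding, so the faces may be taken to be the triangles of four *fans* (`FaceLabelling`): those
over the edges of `p` with apex `q 0` or `q n`, and those over the edges of `q` with apex `p 0` or
`p m`.

**Fans.** Let `[a, b, c]` denote the doubled signed area of a triangle (`dblArea`). The *heights*
`[q 0, q n, p i]` change from `p i` to `p (i + 1)` by
`[q 0, p i, p (i + 1)] - [q n, p i, p (i + 1)]`, so the face areas determine them up to the first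
one, `x = [q 0, q n, p 0]`. By the Plücker relation the areas of the fan at `q 0` then determine
`z = [q 0, p 0, p m]` as a rational function `F(x)` of degree `l`, and the heights of the path `q`
over the line through `p 0` and `p m` start with `z`. In the same way `x = E(z)` with `E` of degree
`k`. Conversely, a solution of both equations yields a placement with the given areas
(`exists_fan_path`).

**Even `l * k`.** For generic areas clearing denominators in `x = E(F(x))` gives a real polynomial
of odd degree `l * k + 1`, which has a root, and genericity ensures that the root is not a pole
(`exists_fan_solution`). Hence every area assignment is approximated by vertex placements with
positive inner areas (`exists_approx_double_fan`). Such a placement is automatically a planar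
drawing equivalent to the plane graph (`IsPositive.isEquivalentPlanarDrawing`): the numbers of
signed crossings of the face boundaries with a horizontal ray add up to zero over all faces, and
only the outer face contributes `-1`, so that the inner triangles do not overlap
(`IsPositive.unique_of_generic`). Area-preserving affine maps keep the drawings in a bounded region,
and a limit of a subsequence realizes the assignment exactly (`IsTriangulation.areaUniversal`).

**Odd `l * k`.** Then both paths have even length, and the faces can be coloured black and white
such that the outer face is white, each fan is alternating, and the two triangles at an edge of one
of the paths have different colours. A drawing with area `1` for the white and `0` for the black
inner faces does not exist: one increasing and one almost increasing sequence of heights would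
determine each other's signs in a contradictory way (`not_exists_alternating_double_fan`).
-/

open Filter Topology

/-! ### Real polynomials of odd degree -/

open Polynomial in
theorem exists_root_of_odd_natDegree_of_pos {f : ℝ[X]} (hf : Odd f.natDegree)
    (hl : 0 < f.leadingCoeff) : ∃ x, f.eval x = 0 := by
  have h0 : f.natDegree ≠ 0 := fun h => by simp [h] at hf
  have hdeg : 0 < f.degree := natDegree_pos_iff_degree_pos.1 (Nat.pos_of_ne_zero h0)
  have h1 := f.tendsto_atTop_of_leadingCoeff_nonneg hdeg hl.le
  have hc : (f.comp (-X)).natDegree = f.natDegree := by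
    simp [natDegree_comp]
  have hcl : (f.comp (-X)).leadingCoeff = - f.leadingCoeff := by
    rw [leadingCoeff_comp (by simp)]
    simp [hf.neg_one_pow]
  have h2 := (f.comp (-X)).tendsto_atBot_of_leadingCoeff_nonpos
    (natDegree_pos_iff_degree_pos.1 (by rw [hc]; exact Nat.pos_of_ne_zero h0))
    (by rw [hcl]; linarith)
  obtain ⟨a, ha⟩ := (h1.eventually_ge_atTop 0).exists
  obtain ⟨b, hb⟩ := (h2.eventually_le_atBot 0).exists
  rw [eval_comp] at hb
  exact mem_range_of_exists_le_of_exists_ge f.continuous ⟨_, hb⟩ ⟨a, ha⟩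

open Polynomial in
theorem exists_root_of_odd_natDegree {f : ℝ[X]} (hf : Odd f.natDegree) :
    ∃ x, f.eval x = 0 := by
  have h0 : f ≠ 0 := by rintro rfl; simp at hf
  rcases lt_or_gt_of_ne (leadingCoeff_ne_zero.2 h0) with h | h
  · obtain ⟨x, hx⟩ := exists_root_of_odd_natDegree_of_pos (f := -f) (by simpa using hf)
      (by simpa using h)
    exact ⟨x, by simpa using hx⟩
  · exact exists_root_of_odd_natDegree_of_pos hf h

/-! ### The rational function of a fan -/

/-- The denominator `h₁ ⋯ h_r` of the rational function of a fan with heights `h₀, …, h_{r+1}`. -/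
def fanDen {R : Type*} [CommRing R] (h : ℕ → R) : ℕ → R
  | 0 => 1
  | r + 1 => h (r + 1) * fanDen h r

/-- The numerator of the rational function of a fan with heights `h₀, …, h_{r+1}` and areas
`c₀, …, c_r`: it is `fanDen h r` times `h₀ h_{r+1} ∑ c_i / (h_i h_{i+1})`, written so that `h₀` and
`h_{r+1}` may vanish. -/
def fanNum {R : Type*} [CommRing R] (h c : ℕ → R) : ℕ → R
  | 0 => c 0
  | r + 1 => h (r + 2) * fanNum h c r + c (r + 1) * h 0 * fanDen h r

section Fan

variable {R S : Type*} [CommRing R] [CommRing S]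

theorem map_fanDen (φ : R →+* S) (h : ℕ → R) (r : ℕ) :
    φ (fanDen h r) = fanDen (fun i => φ (h i)) r := by
  induction r with
  | zero => simp [fanDen]
  | succ r ih => simp [fanDen, ih]

theorem map_fanNum (φ : R →+* S) (h c : ℕ → R) (r : ℕ) :
    φ (fanNum h c r) = fanNum (fun i => φ (h i)) (fun i => φ (c i)) r := by
  induction r with
  | zero => simp [fanNum]
  | succ r ih => simp [fanNum, ih, map_fanDen]

theorem fanDen_smul (a : R) (h : ℕ → R) (r : ℕ) :
    fanDen (fun i => a * h i) r = a ^ r * fanDen h r := by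
  induction r with
  | zero => simp [fanDen]
  | succ r ih => simp only [fanDen, ih]; ring

theorem fanNum_smul (a : R) (h c : ℕ → R) (r : ℕ) :
    fanNum (fun i => a * h i) c r = a ^ r * fanNum h c r := by
  induction r with
  | zero => simp [fanNum]
  | succ r ih => simp only [fanNum, ih, fanDen_smul]; ring

theorem fanDen_one (r : ℕ) : fanDen (fun _ => (1 : R)) r = 1 := by
  induction r with
  | zero => simp [fanDen]
  | succ r ih => simp [fanDen, ih]

theorem fanNum_one (c : ℕ → R) (r : ℕ) :
    fanNum (fun _ => (1 : R)) c r = ∑ i ∈ Finset.range (r + 1), c i := by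
  induction r with
  | zero => simp [fanNum]
  | succ r ih => rw [Finset.sum_range_succ]; simp [fanNum, ih, fanDen_one]

theorem fanDen_const (a : R) (r : ℕ) : fanDen (fun _ => a) r = a ^ r := by
  simpa [fanDen_one] using fanDen_smul a (fun _ => 1) r

theorem fanNum_const (a : R) (c : ℕ → R) (r : ℕ) :
    fanNum (fun _ => a) c r = a ^ r * ∑ i ∈ Finset.range (r + 1), c i := by
  simpa [fanNum_one] using fanNum_smul a (fun _ => 1) c r

theorem fanDen_ne_zero [IsDomain R] {h : ℕ → R} {r : ℕ} (hh : ∀ i, 1 ≤ i → i ≤ r → h i ≠ 0) :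
    fanDen h r ≠ 0 := by
  induction r with
  | zero => simp [fanDen]
  | succ r ih =>
    exact mul_ne_zero (hh _ (by omega) le_rfl) (ih fun i h1 h2 => hh i h1 (by omega))

theorem fanDen_eq_zero {h : ℕ → R} {r i : ℕ} (h1 : 1 ≤ i) (h2 : i ≤ r) (hi : h i = 0) :
    fanDen h r = 0 := by
  induction r with
  | zero => omega
  | succ r ih =>
    rcases Nat.lt_or_ge r i with h3 | h3
    · obtain rfl : i = r + 1 := by omega
      simp [fanDen, hi]
    · simp [fanDen, ih h3]

/-- Where the denominator of a fan has a simple zero, the numerator does not vanish, provided the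
two triangle areas next to the vanishing height are generic. -/
theorem fanNum_ne_zero_of_eq_zero [IsDomain R] {h c : ℕ → R} {r i : ℕ} (h1 : 1 ≤ i) (h2 : i ≤ r)
    (hi : h i = 0) (hj : ∀ j ≤ r + 1, j ≠ i → h j ≠ 0)
    (hc : c (i - 1) * h (i + 1) + c i * h (i - 1) ≠ 0) : fanNum h c r ≠ 0 := by
  induction r with
  | zero => omega
  | succ r ih =>
    rcases Nat.lt_or_ge r i with h3 | h3
    · obtain rfl : i = r + 1 := by omega
      rcases r with _ | r
      · simp only [fanNum, fanDen] at *
        convert hc using 1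
        simp; ring
      · have e : fanNum h c (r + 1 + 1) =
            h 0 * fanDen h r * (c (r + 1) * h (r + 3) + c (r + 2) * h (r + 1)) := by
          simp only [fanNum, fanDen, hi]; ring
        rw [e]
        refine mul_ne_zero (mul_ne_zero (hj _ (by omega) (by omega))
          (fanDen_ne_zero fun j _ _ => hj j (by omega) (by omega))) (by simpa using hc)
    · simp only [fanNum, fanDen_eq_zero h1 h3 hi, mul_zero, add_zero]
      exact mul_ne_zero (hj _ le_rfl (by omega)) (ih h3 fun j h4 h5 => hj j (by omega) h5)

open Polynomial

theorem natDegree_fanDen_le {h : ℕ → R[X]} {d : ℕ} (hd : ∀ i, (h i).natDegree ≤ d) (r : ℕ) :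
    (fanDen h r).natDegree ≤ r * d := by
  induction r with
  | zero => simp [fanDen]
  | succ r ih =>
    refine natDegree_mul_le.trans ?_
    have := hd (r + 1)
    rw [add_mul]; omega

theorem coeff_fanDen {h : ℕ → R[X]} {d : ℕ} (hd : ∀ i, (h i).natDegree ≤ d) (r : ℕ) :
    (fanDen h r).coeff (r * d) = fanDen (fun i => (h i).coeff d) r := by
  induction r with
  | zero => simp [fanDen]
  | succ r ih =>
    rw [fanDen, show (r + 1) * d = d + r * d by ring,
      coeff_mul_add_eq_of_natDegree_le (hd _) (natDegree_fanDen_le hd r), ih, fanDen]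

theorem natDegree_fanNum_le {h : ℕ → R[X]} {d : ℕ} (hd : ∀ i, (h i).natDegree ≤ d) (c : ℕ → R)
    (r : ℕ) : (fanNum h (fun i => C (c i)) r).natDegree ≤ r * d := by
  induction r with
  | zero => simp [fanNum]
  | succ r ih =>
    have e : C (c (r + 1)) * h 0 * fanDen h r = C (c (r + 1)) * (h 0 * fanDen h r) := by ring
    have h1 := hd (r + 2)
    have h2 := hd 0
    have h3 := natDegree_fanDen_le hd r
    rw [fanNum, e]
    refine natDegree_add_le_of_degree_le (natDegree_mul_le.trans ?_)
      ((natDegree_C_mul_le _ _).trans (natDegree_mul_le.trans ?_)) <;>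
    · rw [add_mul]; omega

theorem coeff_fanNum {h : ℕ → R[X]} {d : ℕ} (hd : ∀ i, (h i).natDegree ≤ d) (c : ℕ → R)
    (r : ℕ) : (fanNum h (fun i => C (c i)) r).coeff (r * d) =
      fanNum (fun i => (h i).coeff d) c r := by
  induction r with
  | zero => simp [fanNum]
  | succ r ih =>
    have e : C (c (r + 1)) * h 0 * fanDen h r = C (c (r + 1)) * (h 0 * fanDen h r) := by ring
    rw [fanNum, e, show (r + 1) * d = d + r * d by ring, coeff_add, coeff_C_mul,
      coeff_mul_add_eq_of_natDegree_le (hd _) (natDegree_fanNum_le hd c r),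
      coeff_mul_add_eq_of_natDegree_le (hd _) (natDegree_fanDen_le hd r), ih, coeff_fanDen hd,
      fanNum]
    ring

/-- Two fan equations `z = F(x)` and `x = E(z)` with rational functions `F` and `E` of degrees `ℓ`
and `k` have a common real solution if `ℓ * k` is even: clearing denominators in `x = E(F(x))` gives
a polynomial of odd degree `ℓ * k + 1`, and genericity excludes that its root is a pole. -/
theorem exists_fan_solution {ℓ k : ℕ} (heven : Even (ℓ * k)) (s c τ e : ℕ → ℝ)
    (h1 : ∀ i, 1 ≤ i → i ≤ ℓ → fanNum (fun j => s j - s i) c ℓ ≠ 0)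
    (h2 : ∀ j, 1 ≤ j → j ≤ k → fanNum (fun i => τ i - τ j) e k ≠ 0)
    (h3 : ∀ i, 1 ≤ i → i ≤ ℓ → ∑ j ∈ Finset.range (k + 1), e j + s i ≠ 0)
    (h4 : ∀ j, 1 ≤ j → j ≤ k → ∑ i ∈ Finset.range (ℓ + 1), c i + τ j ≠ 0) :
    ∃ x z : ℝ, (∀ i, 1 ≤ i → i ≤ ℓ → x + s i ≠ 0) ∧ (∀ j, 1 ≤ j → j ≤ k → z + τ j ≠ 0) ∧
      z * fanDen (fun i => x + s i) ℓ = fanNum (fun i => x + s i) c ℓ ∧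
      x * fanDen (fun j => z + τ j) k = fanNum (fun j => z + τ j) e k := by
  set h : ℕ → ℝ[X] := fun i => X + C (s i) with hh
  have hd : ∀ i, (h i).natDegree ≤ 1 := fun i => (natDegree_X_add_C _).le
  have hlc : ∀ i, (h i).coeff 1 = 1 := fun i => by simp [hh, coeff_X]
  set P : ℝ[X] := fanNum h (fun i => C (c i)) ℓ with hP
  set Q : ℝ[X] := fanDen h ℓ with hQ
  have hPd : P.natDegree ≤ ℓ := by simpa using natDegree_fanNum_le hd c ℓ
  have hQd : Q.natDegree ≤ ℓ := by simpa using natDegree_fanDen_le hd ℓ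
  have hPc : P.coeff ℓ = ∑ i ∈ Finset.range (ℓ + 1), c i := by
    have := coeff_fanNum hd c ℓ
    simpa [hlc, fanNum_one] using this
  have hQc : Q.coeff ℓ = 1 := by
    have := coeff_fanDen hd ℓ
    simpa [hlc, fanDen_one] using this
  set g : ℕ → ℝ[X] := fun j => P + C (τ j) * Q with hg
  have hgd : ∀ j, (g j).natDegree ≤ ℓ := fun j =>
    natDegree_add_le_of_degree_le hPd ((natDegree_C_mul_le _ _).trans hQd)
  have hgc : ∀ j, (g j).coeff ℓ = ∑ i ∈ Finset.range (ℓ + 1), c i + τ j := fun j => by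
    simp [hg, hPc, hQc]
  set N : ℝ[X] := X * fanDen g k - fanNum g (fun j => C (e j)) k with hN
  have hDd := natDegree_fanDen_le hgd k
  have hDc : (fanDen g k).coeff (k * ℓ) ≠ 0 := by
    rw [coeff_fanDen hgd]
    exact fanDen_ne_zero fun j hj hj' => by rw [hgc]; exact h4 j hj hj'
  have hNdeg : N.natDegree = k * ℓ + 1 := by
    refine natDegree_eq_of_le_of_coeff_ne_zero ?_ ?_
    · refine (natDegree_sub_le _ _).trans (max_le (natDegree_mul_le.trans ?_)
        ((natDegree_fanNum_le hgd e k).trans (Nat.le_succ _)))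
      rw [natDegree_X]; omega
    · rw [hN, coeff_sub, coeff_X_mul, coeff_eq_zero_of_natDegree_lt
        (lt_of_le_of_lt (natDegree_fanNum_le hgd e k) (Nat.lt_succ_self _)), sub_zero]
      exact hDc
  obtain ⟨x, hx⟩ := exists_root_of_odd_natDegree (f := N) (by
    rw [hNdeg, mul_comm]; exact heven.add_one)
  set p := fanNum (fun i => x + s i) c ℓ with hp
  set q := fanDen (fun i => x + s i) ℓ with hq
  have hPx : P.eval x = p := by
    have := map_fanNum (evalRingHom x) h (fun i => C (c i)) ℓ
    simpa [hh] using this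
  have hQx : Q.eval x = q := by
    have := map_fanDen (evalRingHom x) h ℓ
    simpa [hh] using this
  have hNx : x * fanDen (fun j => p + τ j * q) k = fanNum (fun j => p + τ j * q) e k := by
    have a1 := map_fanNum (evalRingHom x) g (fun i => C (e i)) k
    have a2 := map_fanDen (evalRingHom x) g k
    simp only [hg, coe_evalRingHom, eval_add, eval_mul, eval_C, hPx, hQx] at a1 a2
    rw [hN, eval_sub, eval_mul, eval_X] at hx
    rw [← a1, ← a2]
    exact sub_eq_zero.1 hx
  have hxs : ∀ i, 1 ≤ i → i ≤ ℓ → x + s i ≠ 0 := by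
    intro i hi hi' h0
    have hq0 : q = 0 := fanDen_eq_zero hi hi' h0
    have hxi : x = - s i := by linarith
    have hp0 : p ≠ 0 := by
      have := h1 i hi hi'
      convert this using 3
      rw [hxi]; ring
    simp only [hq0, mul_zero, add_zero, fanDen_const, fanNum_const] at hNx
    have : p ^ k * (∑ j ∈ Finset.range (k + 1), e j + s i) = 0 := by
      rw [hxi] at hNx; linear_combination - hNx
    rcases mul_eq_zero.1 this with h | h
    · exact hp0 (eq_zero_of_pow_eq_zero h)
    · exact h3 i hi hi' h
  have hq0 : q ≠ 0 := fanDen_ne_zero hxs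
  have hgq : (fun j => p + τ j * q) = fun j => q * (p / q + τ j) := by
    funext j; field_simp
  rw [hgq, fanDen_smul, fanNum_smul] at hNx
  have hqk : q ^ k ≠ 0 := pow_ne_zero _ hq0
  have hNx' : x * fanDen (fun j => p / q + τ j) k = fanNum (fun j => p / q + τ j) e k :=
    mul_left_cancel₀ hqk (by linear_combination hNx)
  refine ⟨x, p / q, hxs, ?_, div_mul_cancel₀ p hq0, hNx'⟩
  intro j hj hj' h0
  rw [fanDen_eq_zero hj hj' h0, mul_zero] at hNx'
  refine h2 j hj hj' ?_
  rw [hNx']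
  congr 1
  funext i
  linarith

/-- The closed form of the rational function of a fan. -/
theorem fanNum_div_fanDen {K : Type*} [Field K] {h c : ℕ → K} {r : ℕ} (hr : 1 ≤ r)
    (hh : ∀ i, 1 ≤ i → i ≤ r → h i ≠ 0) :
    fanNum h c r = fanDen h r * (h 0 * h (r + 1) * ∑ i ∈ Finset.Ico 1 r, c i / (h i * h (i + 1)) +
      c 0 * h (r + 1) / h 1 + c r * h 0 / h r) := by
  induction r, hr using Nat.le_induction with
  | base =>
    have := hh 1 le_rfl le_rfl
    simp only [fanNum, fanDen, Finset.Ico_self, Finset.sum_empty]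
    field_simp
    ring
  | succ r hr ih =>
    have h1 := hh 1 le_rfl (by omega)
    have h2 := hh r hr (by omega)
    have h3 := hh (r + 1) (by omega) le_rfl
    rw [fanNum, ih fun i h1 h2 => hh i h1 (by omega), fanDen, Finset.sum_Ico_succ_top hr]
    field_simp
    ring

/-- Reading a fan backwards. -/
theorem fanDen_reverse (h : ℕ → R) (r : ℕ) :
    fanDen (fun i => h (r + 1 - i)) r = fanDen h r := by
  have e : ∀ (h : ℕ → R) (r : ℕ), fanDen h r = ∏ i ∈ Finset.range r, h (i + 1) := by
    intro h r
    induction r with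
    | zero => simp [fanDen]
    | succ r ih => rw [fanDen, ih, Finset.prod_range_succ, mul_comm]
  rw [e, e, ← Finset.prod_range_reflect]
  refine Finset.prod_congr rfl fun i hi => ?_
  rw [Finset.mem_range] at hi
  congr 1
  omega

theorem fanNum_reverse {K : Type*} [Field K] {h c : ℕ → K} {r : ℕ} (hr : 1 ≤ r)
    (hh : ∀ i, 1 ≤ i → i ≤ r → h i ≠ 0) :
    fanNum (fun i => h (r + 1 - i)) (fun i => - c (r - i)) r = - fanNum h c r := by
  rw [fanNum_div_fanDen hr hh, fanNum_div_fanDen hr fun i h1 h2 => hh _ (by omega) (by omega),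
    fanDen_reverse]
  have e : ∑ i ∈ Finset.Ico 1 r, - c (r - i) / (h (r + 1 - i) * h (r + 1 - (i + 1))) =
      - ∑ i ∈ Finset.Ico 1 r, c i / (h i * h (i + 1)) := by
    rw [← Finset.sum_neg_distrib]
    refine Finset.sum_nbij' (fun i => r - i) (fun i => r - i) ?_ ?_ ?_ ?_ ?_
    · intro i hi; simp only [Finset.mem_Ico] at *; omega
    · intro i hi; simp only [Finset.mem_Ico] at *; omega
    · intro i hi; simp only [Finset.mem_Ico] at *; omega
    · intro i hi; simp only [Finset.mem_Ico] at *; omega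
    · intro i hi
      simp only [Finset.mem_Ico] at *
      rw [show r + 1 - (i + 1) = r - i by omega, show r + 1 - i = r - i + 1 by omega, neg_div,
        mul_comm (h (r - i + 1))]
  rw [e]
  simp only [Nat.sub_self, Nat.add_sub_cancel, Nat.add_sub_cancel_left, Nat.sub_zero]
  ring

end Fan

/-! ### Placing two fans with prescribed areas -/

/-- Twice the signed area of the triangle `abc`. -/
def dblArea (a b c : ℂ) : ℝ := (b.re - a.re) * (c.im - a.im) - (b.im - a.im) * (c.re - a.re)

theorem dblArea_swap (a b c : ℂ) : dblArea b a c = - dblArea a b c := by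
  unfold dblArea; ring

/-- The Plücker relation for the vectors from `o` to `w`, `a`, `y` and `z`. -/
theorem dblArea_pluecker (o w a y z : ℂ) : dblArea o w a * dblArea o y z =
    dblArea o w y * dblArea o a z - dblArea o w z * dblArea o a y := by
  unfold dblArea; ring

/-- A triangle seen from two apices: the areas differ by the step of the heights over `ow`. -/
theorem dblArea_sub_dblArea (o w y z : ℂ) :
    dblArea w y z = dblArea o y z - (dblArea o w z - dblArea o w y) := by
  unfold dblArea; ring

/-- A fan with apex `o` between the rays to `a` and `b` can be filled with a path whose points have
prescribed heights `h` over the line `ow` and form triangles of prescribed areas `c` with `o`, if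
its end points satisfy the fan equation. -/
theorem exists_fan_path_of_left_ne {o w a b : ℂ} {h c : ℕ → ℝ} {r : ℕ}
    (h0 : h 0 ≠ 0) (hh : ∀ i, 1 ≤ i → i ≤ r → h i ≠ 0) (ha : dblArea o w a = h 0)
    (hb : dblArea o w b = h (r + 1)) (hab : dblArea o a b * fanDen h r = fanNum h c r) :
    ∃ p : ℕ → ℂ, p 0 = a ∧ p (r + 1) = b ∧ (∀ i ≤ r, dblArea o (p i) (p (i + 1)) = c i) ∧
      ∀ i ≤ r + 1, dblArea o w (p i) = h i := by
  set A : ℕ → ℝ := fun i => fanNum h c (i - 1) / fanDen h (i - 1) with hA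
  set p : ℕ → ℂ := fun i => if i = 0 then a else if i ≤ r then
    o + ((h i / h 0 : ℝ) : ℂ) * (a - o) - ((A i / h 0 : ℝ) : ℂ) * (w - o) else b with hp
  have hden : ∀ i ≤ r, fanDen h i ≠ 0 := fun i hi =>
    fanDen_ne_zero fun j h1 h2 => hh j h1 (h2.trans hi)
  have key : ∀ i, 1 ≤ i → i ≤ r + 1 → dblArea o w (p i) = h i ∧ dblArea o a (p i) = A i := by
    intro i h1 h2
    rcases Nat.lt_or_ge r i with h3 | h3
    · obtain rfl : i = r + 1 := by omega
      have e : p (r + 1) = b := by simp [hp]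
      rw [e]
      refine ⟨hb, ?_⟩
      simp only [hA, Nat.add_sub_cancel]
      rw [eq_div_iff (hden r le_rfl), hab]
    · have e : p i = o + ((h i / h 0 : ℝ) : ℂ) * (a - o) - ((A i / h 0 : ℝ) : ℂ) * (w - o) := by
        simp only [hp]; rw [if_neg (by omega), if_pos h3]
      have e1 : dblArea o w (p i) = h i / h 0 * dblArea o w a := by
        rw [e]; unfold dblArea
        simp only [Complex.add_re, Complex.sub_re, Complex.re_ofReal_mul, Complex.add_im,
          Complex.sub_im, Complex.im_ofReal_mul]
        ring
      have e2 : dblArea o a (p i) = A i / h 0 * dblArea o w a := by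
        rw [e]; unfold dblArea
        simp only [Complex.add_re, Complex.sub_re, Complex.re_ofReal_mul, Complex.add_im,
          Complex.sub_im, Complex.im_ofReal_mul]
        ring
      rw [e1, e2, ha]
      constructor <;> field_simp
  have hp0 : p 0 = a := by simp [hp]
  refine ⟨p, hp0, by simp [hp], ?_, ?_⟩
  · intro i hi
    rcases i with _ | i
    · rw [hp0, (key 1 le_rfl (by omega)).2]
      simp [hA, fanNum, fanDen]
    · have k1 := key (i + 1) (by omega) (by omega)
      have k2 := key (i + 1 + 1) (by omega) (by omega)
      have := dblArea_pluecker o w a (p (i + 1)) (p (i + 1 + 1))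
      rw [k1.1, k1.2, k2.1, k2.2, ha] at this
      refine mul_left_cancel₀ h0 (this.trans ?_)
      have d1 := hden i (by omega)
      have d2 := hh (i + 1) (by omega) hi
      simp only [hA, Nat.add_sub_cancel, fanNum, fanDen]
      field_simp
      ring
  · intro i hi
    rcases i with _ | i
    · rw [hp0, ha]
    · exact (key _ (by omega) hi).1

theorem exists_fan_path {o w a b : ℂ} {h c : ℕ → ℝ} {r : ℕ} (hr : 1 ≤ r)
    (h0 : h 0 ≠ 0 ∨ h (r + 1) ≠ 0) (hh : ∀ i, 1 ≤ i → i ≤ r → h i ≠ 0)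
    (ha : dblArea o w a = h 0) (hb : dblArea o w b = h (r + 1))
    (hab : dblArea o a b * fanDen h r = fanNum h c r) :
    ∃ p : ℕ → ℂ, p 0 = a ∧ p (r + 1) = b ∧ (∀ i ≤ r, dblArea o (p i) (p (i + 1)) = c i) ∧
      ∀ i ≤ r + 1, dblArea o w (p i) = h i := by
  rcases h0 with h0 | h0
  · exact exists_fan_path_of_left_ne h0 hh ha hb hab
  · obtain ⟨p, p1, p2, p3, p4⟩ := exists_fan_path_of_left_ne (o := o) (w := w) (a := b) (b := a)
      (h := fun i => h (r + 1 - i)) (c := fun i => - c (r - i)) (r := r) (by simpa using h0)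
      (fun i h1 h2 => hh _ (by omega) (by omega)) (by simpa using hb) (by simpa using ha) (by
        rw [fanDen_reverse, fanNum_reverse hr hh, ← hab]
        unfold dblArea; ring)
    refine ⟨fun i => p (r + 1 - i), by simpa using p2, by simpa using p1, ?_, ?_⟩
    · intro i hi
      have := p3 (r - i) (by omega)
      rw [show r - (r - i) = i by omega] at this
      simp only
      rw [show r + 1 - i = r - i + 1 by omega, show r + 1 - (i + 1) = r - i by omega]
      have e : dblArea o (p (r - i + 1)) (p (r - i)) = - dblArea o (p (r - i)) (p (r - i + 1)) := by
        unfold dblArea; ring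
      rw [e, this, neg_neg]
    · intro i hi
      have := p4 (r + 1 - i) (by omega)
      simpa [show r + 1 - (r + 1 - i) = i by omega] using this

/-- A nonzero real polynomial of degree at most two does not vanish at small positive numbers. -/
theorem eventually_quadratic_ne_zero {a b c : ℝ} (h : a ≠ 0 ∨ b ≠ 0 ∨ c ≠ 0) :
    ∀ᶠ t : ℝ in 𝓝[>] 0, a + b * t + c * t ^ 2 ≠ 0 := by
  have hcont : ∀ a b c : ℝ, Tendsto (fun t : ℝ => a + b * t + c * t ^ 2) (𝓝[>] 0) (𝓝 a) := by
    intro a b c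
    have : Continuous fun t : ℝ => a + b * t + c * t ^ 2 := by fun_prop
    simpa using (this.tendsto 0).mono_left nhdsWithin_le_nhds
  by_cases ha : a = 0
  · subst ha
    by_cases hb : b = 0
    · subst hb
      filter_upwards [self_mem_nhdsWithin] with t ht
      have ht : 0 < t := ht
      have hc : c ≠ 0 := by simpa using h
      simpa using ⟨hc, ht.ne'⟩
    · filter_upwards [self_mem_nhdsWithin, (hcont b c 0).eventually_ne hb] with t ht h1
      have ht : 0 < t := ht
      have : (0 : ℝ) + b * t + c * t ^ 2 = t * (b + c * t + 0 * t ^ 2) := by ring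
      rw [this]
      exact mul_ne_zero ht.ne' h1
  · exact (hcont a b c).eventually_ne ha

theorem eventually_forall_le {n : ℕ} {P : ℕ → ℝ → Prop}
    (h : ∀ i ≤ n, ∀ᶠ t in 𝓝[>] (0 : ℝ), P i t) : ∀ᶠ t in 𝓝[>] (0 : ℝ), ∀ i ≤ n, P i t :=
  (eventually_all_finite (Set.finite_Iic n)).2 h

/-- Generic heights and areas of a fan are arbitrarily close to given ones. Here the heights
increase by multiples of `v`, and the areas by consecutive multiples, of the small parameter. -/
theorem eventually_fanNum_ne_zero (s c : ℕ → ℝ) (r : ℕ) {v : ℝ} (hv : v ≠ 0) (w : ℝ) :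
    ∀ᶠ t in 𝓝[>] (0 : ℝ), s (r + 1) + t * (v * ↑(r + 1)) ≠ s 0 ∧ ∀ i ≤ r, 1 ≤ i →
      fanNum (fun j => (s j + t * (v * j)) - (s i + t * (v * i))) (fun j => c j + t * (j + w)) r ≠
        0 := by
  have e1 : ∀ᶠ t in 𝓝[>] (0 : ℝ), ∀ i ≤ r + 1, ∀ j ≤ r + 1, j ≠ i →
      (s j + t * (v * j)) - (s i + t * (v * i)) ≠ 0 := by
    refine eventually_forall_le fun i hi => eventually_forall_le fun j hj => ?_
    by_cases hji : j = i
    · simp [hji]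
    · have hji' : (j : ℝ) - i ≠ 0 := sub_ne_zero.2 (by exact_mod_cast hji)
      filter_upwards [eventually_quadratic_ne_zero (a := s j - s i) (b := v * (j - i)) (c := 0)
        (Or.inr (Or.inl (mul_ne_zero hv hji')))] with t ht _
      convert ht using 1
      ring
  have e2 : ∀ᶠ t in 𝓝[>] (0 : ℝ), ∀ i ≤ r, 1 ≤ i →
      (c (i - 1) + t * ((i - 1 : ℕ) + w)) * ((s (i + 1) + t * (v * (i + 1 : ℕ))) -
        (s i + t * (v * i))) +
      (c i + t * (i + w)) * ((s (i - 1) + t * (v * (i - 1 : ℕ))) - (s i + t * (v * i))) ≠ 0 := by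
    refine eventually_forall_le fun i _ => ?_
    rcases i with _ | i
    · simp
    · filter_upwards [eventually_quadratic_ne_zero (a := c i * (s (i + 2) - s (i + 1)) +
        c (i + 1) * (s i - s (i + 1))) (b := c i * v + (i + w) * (s (i + 2) - s (i + 1)) -
          c (i + 1) * v + (i + 1 + w) * (s i - s (i + 1))) (c := -v)
        (Or.inr (Or.inr (neg_ne_zero.2 hv)))] with t ht _
      convert ht using 1
      simp only [Nat.add_sub_cancel]
      push_cast
      ring
  filter_upwards [e1, e2] with t h1 h2
  refine ⟨?_, fun i hi hi' => ?_⟩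
  · have := h1 0 (by omega) (r + 1) le_rfl (by omega)
    simpa [sub_eq_zero] using this
  · exact fanNum_ne_zero_of_eq_zero hi' hi (sub_self _) (fun j hj hji => h1 i (by omega) j hj hji)
      (h2 i hi hi')

/-- Two fans, one over the path `p` with apices `q 0` and `q (k + 1)`, the other over the path `q`
with apices `p 0` and `p (ℓ + 1)`, can be placed such that the triangles, except for the last one,
have areas arbitrarily close to given real numbers, if `ℓ * k` is even. -/
theorem exists_approx_double_fan {ℓ k : ℕ} (hℓ : 1 ≤ ℓ) (hk : 1 ≤ k) (heven : Even (ℓ * k))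
    (c d e f : ℕ → ℝ) {ε : ℝ} (hε : 0 < ε) :
    ∃ p q : ℕ → ℂ, (∀ i ≤ ℓ, |dblArea (q 0) (p i) (p (i + 1)) - c i| < ε) ∧
      (∀ i ≤ ℓ, |dblArea (q (k + 1)) (p i) (p (i + 1)) - d i| < ε) ∧
      (∀ j ≤ k, |dblArea (p 0) (q j) (q (j + 1)) - e j| < ε) ∧
      (∀ j < k, |dblArea (p (ℓ + 1)) (q j) (q (j + 1)) - f j| < ε) := by
  -- The sum of the steps of the heights of both fans is zero, which determines the last height.
  set s : ℕ → ℝ := fun i => ∑ j ∈ Finset.range i, (c j - d j) with hs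
  set τ : ℕ → ℝ := fun j => if j = k + 1 then - s (ℓ + 1) else
    ∑ i ∈ Finset.range j, (e i - f i) with hτ
  -- The heights of the first fan grow by `n` and those of the second one by `-m` times the small
  -- parameter `t` per step, so that the perturbations of both total height differences cancel.
  set m : ℝ := (ℓ : ℝ) + 1 with hm
  set n : ℝ := (k : ℝ) + 1 with hn
  have hm0 : 0 < m := by positivity
  have hn0 : 0 < n := by positivity
  have ev1 := eventually_fanNum_ne_zero s c ℓ hn0.ne' n
  have ev2 := eventually_fanNum_ne_zero τ e k (neg_ne_zero.2 hm0.ne') 1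
  have ev3 : ∀ᶠ t in 𝓝[>] (0 : ℝ), ∀ i ≤ ℓ,
      ∑ j ∈ Finset.range (k + 1), (e j + t * (j + 1)) + (s i + t * (n * i)) ≠ 0 := by
    refine eventually_forall_le fun i _ => ?_
    have hpos : 0 < ∑ j ∈ Finset.range (k + 1), ((j : ℝ) + 1) + n * i := by
      have : 0 < ∑ j ∈ Finset.range (k + 1), ((j : ℝ) + 1) :=
        Finset.sum_pos (fun j _ => by positivity) (by simp)
      positivity
    filter_upwards [eventually_quadratic_ne_zero (a := ∑ j ∈ Finset.range (k + 1), e j + s i)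
      (c := 0) (Or.inr (Or.inl hpos.ne'))] with t ht
    convert ht using 1
    rw [Finset.sum_add_distrib, ← Finset.mul_sum]
    ring
  have ev4 : ∀ᶠ t in 𝓝[>] (0 : ℝ), ∀ j ≤ k,
      ∑ i ∈ Finset.range (ℓ + 1), (c i + t * (i + n)) + (τ j + t * (-m * j)) ≠ 0 := by
    refine eventually_forall_le fun j hj => ?_
    have hpos : 0 < ∑ i ∈ Finset.range (ℓ + 1), ((i : ℝ) + n) + -m * j := by
      have h1 : ∑ i ∈ Finset.range (ℓ + 1), n ≤ ∑ i ∈ Finset.range (ℓ + 1), ((i : ℝ) + n) :=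
        Finset.sum_le_sum fun i _ => by
          have : (0 : ℝ) ≤ i := by positivity
          linarith
      rw [Finset.sum_const, Finset.card_range, nsmul_eq_mul] at h1
      have h2 : (j : ℝ) < n := by
        have : (j : ℝ) ≤ k := by exact_mod_cast hj
        rw [hn]; linarith
      have h3 := mul_lt_mul_of_pos_left h2 hm0
      push_cast at h1
      rw [← hm] at h1
      linarith
    filter_upwards [eventually_quadratic_ne_zero (a := ∑ i ∈ Finset.range (ℓ + 1), c i + τ j)
      (c := 0) (Or.inr (Or.inl hpos.ne'))] with t ht
    convert ht using 1
    rw [Finset.sum_add_distrib, ← Finset.mul_sum]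
    ring
  have ev5 : ∀ᶠ t in 𝓝[>] (0 : ℝ), t * (ℓ + k + 3) < ε := by
    have : Tendsto (fun t : ℝ => t * (ℓ + k + 3)) (𝓝[>] 0) (𝓝 0) := by
      have : Continuous fun t : ℝ => t * (ℓ + k + 3) := by fun_prop
      simpa using (this.tendsto 0).mono_left nhdsWithin_le_nhds
    exact this.eventually_lt_const hε
  obtain ⟨t, ⟨ht1, ht1'⟩, ⟨-, ht2'⟩, ht3, ht4, ht5, ht6⟩ :=
    (ev1.and (ev2.and (ev3.and (ev4.and (ev5.and self_mem_nhdsWithin))))).exists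
  have ht6 : 0 < t := ht6
  obtain ⟨x, z, hx, hz, hxz, hzx⟩ := exists_fan_solution heven (fun i => s i + t * (n * i))
    (fun i => c i + t * (i + n)) (fun j => τ j + t * (-m * j)) (fun j => e j + t * (j + 1))
    (fun i h1 h2 => ht1' i h2 h1) (fun j h1 h2 => ht2' j h2 h1) (fun i h1 h2 => ht3 i h2)
    (fun j h1 h2 => ht4 j h2)
  have hs0 : s 0 = 0 := by simp [hs]
  have hτ0 : τ 0 = 0 := by simp [hτ]
  -- The path `p` leads from `B` to `u` and `q` from `0` to `1`. Each fan has the ends of the other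
  -- path as its apices, so that these four points have the areas required by both fan equations.
  set S : ℝ := s (ℓ + 1) + t * (n * ↑(ℓ + 1)) with hS
  have hτn : τ (k + 1) + t * (-m * ↑(k + 1)) = - S := by
    simp only [hτ, if_true, hS, hm, hn]
    push_cast
    ring
  have hS0 : S ≠ 0 := by rwa [hs0] at ht1
  set B : ℂ := ⟨z / S, x⟩ with hB
  set u : ℂ := ⟨z / S, x + S⟩ with hu
  obtain ⟨p, p1, p2, p3, p4⟩ := exists_fan_path (o := 0) (w := 1) (a := B) (b := u)
    (h := fun i => x + (s i + t * (n * i))) (c := fun i => c i + t * (i + n)) (r := ℓ) hℓ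
    (by
      by_contra! hc
      simp only [hs0, Nat.cast_zero, mul_zero, add_zero] at hc
      rw [hc.1, zero_add] at hc
      exact hS0 hc.2) hx
    (by simp [dblArea, hB, hs0]) (by simp [dblArea, hu, hS]) (by
      rw [← hxz]
      congr 1
      simp only [dblArea, hB, hu, Complex.zero_re, Complex.zero_im, sub_zero]
      field_simp
      ring)
  obtain ⟨q, q1, q2, q3, q4⟩ := exists_fan_path (o := B) (w := u) (a := 0) (b := 1)
    (h := fun j => z + (τ j + t * (-m * j))) (c := fun j => e j + t * (j + 1)) (r := k) hk
    (by
      by_contra! hc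
      simp only [hτ0, Nat.cast_zero, mul_zero, add_zero] at hc
      rw [hτn, hc.1, zero_add] at hc
      exact hS0 (neg_eq_zero.1 hc.2)) hz
    (by
      simp only [dblArea, hB, hu, hτ0, Complex.zero_re, Complex.zero_im, Nat.cast_zero]
      field_simp
      ring)
    (by
      rw [hτn]
      simp only [dblArea, hB, hu, Complex.one_re, Complex.one_im]
      field_simp
      ring) (by
      rw [← hzx]
      congr 1
      simp only [dblArea, hB, Complex.zero_re, Complex.zero_im, Complex.one_re, Complex.one_im]
      ring)
  have hℓ0 : (0 : ℝ) ≤ ℓ := by positivity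
  have hk0 : (0 : ℝ) ≤ k := by positivity
  have small : ∀ a b : ℝ, 0 ≤ b → b ≤ ℓ + k + 3 → |a + t * b - a| < ε := by
    intro a b hb hb'
    rw [add_sub_cancel_left, abs_of_nonneg (by positivity)]
    exact (mul_le_mul_of_nonneg_left hb' ht6.le).trans_lt ht5
  refine ⟨p, q, ?_, ?_, ?_, ?_⟩
  · intro i hi
    rw [q1, p3 i hi]
    have : (i : ℝ) ≤ ℓ := by exact_mod_cast hi
    exact small _ _ (by positivity) (by linarith)
  · intro i hi
    rw [q2, dblArea_sub_dblArea 0, p3 i hi, p4 i (by omega), p4 (i + 1) (by omega)]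
    have h1 : (i : ℝ) ≤ ℓ := by exact_mod_cast hi
    have h2 : s (i + 1) = s i + (c i - d i) := Finset.sum_range_succ _ _
    convert small (d i) i (by positivity) (by linarith) using 2
    rw [h2]
    push_cast
    ring
  · intro j hj
    rw [p1, q3 j hj]
    have : (j : ℝ) ≤ k := by exact_mod_cast hj
    exact small _ _ (by positivity) (by linarith)
  · intro j hj
    rw [p2, dblArea_sub_dblArea B, q3 j (by omega), q4 j (by omega), q4 (j + 1) (by omega)]
    have h1 : (j : ℝ) ≤ k := by exact_mod_cast hj.le
    have h2 : τ (j + 1) = τ j + (e j - f j) := by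
      simp only [hτ]
      rw [if_neg (by omega), if_neg (by omega), Finset.sum_range_succ]
    convert small (f j) (j + 1 + m) (by positivity) (by linarith) using 2
    rw [h2]
    push_cast
    ring

/-! ### Alternating fans -/

theorem le_of_forall_step_le {h : ℕ → ℝ} {a b : ℕ} (hab : a ≤ b)
    (hs : ∀ i, a ≤ i → i < b → h i ≤ h (i + 1)) : h a ≤ h b := by
  induction b, hab using Nat.le_induction with
  | base => rfl
  | succ b hb ih => exact (ih fun i h1 h2 => hs i h1 (by omega)).trans (hs b hb (by omega))

/-- For an increasing sequence of nonzero numbers whose ends have the same sign, the sequence of the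
inverses is decreasing. -/
theorem inv_step_pos_of_increasing {h : ℕ → ℝ} {m : ℕ} (hs : ∀ i < m, h i < h (i + 1))
    (hpos : 0 < h 0 * h m) : ∀ i < m, 0 < (h (i + 1) - h i) / (h i * h (i + 1)) := by
  intro i hi
  have h1 : h 0 ≤ h i := le_of_forall_step_le (Nat.zero_le _) fun j _ hj => (hs j (by omega)).le
  have h2 : h (i + 1) ≤ h m := le_of_forall_step_le hi fun j _ hj => (hs j hj).le
  have h3 := hs i hi
  refine div_pos (sub_pos.2 h3) ?_
  rcases pos_and_pos_or_neg_and_neg_of_mul_pos hpos with ⟨h4, h5⟩ | ⟨h4, h5⟩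
  · exact mul_pos (by linarith) (by linarith)
  · exact mul_pos_of_neg_of_neg (by linarith) (by linarith)

theorem cross_of_inv_step_neg {a b : ℝ} (hab : a < b) (hneg : (b - a) / (a * b) < 0) :
    a < 0 ∧ 0 < b := by
  have : a * b < 0 := by
    by_contra! hc
    exact absurd hneg (not_lt.2 (div_nonneg (by linarith) hc))
  rcases mul_neg_iff.1 this with h | h
  · linarith [h.1, h.2]
  · exact h

/-- An increasing sequence changes its sign at most once. -/
theorem inv_step_neg_unique_of_increasing {h : ℕ → ℝ} {m : ℕ} (hs : ∀ i < m, h i < h (i + 1))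
    {i j : ℕ} (hi : i < m) (hj : j < m) (hin : (h (i + 1) - h i) / (h i * h (i + 1)) < 0)
    (hjn : (h (j + 1) - h j) / (h j * h (j + 1)) < 0) : i = j := by
  obtain ⟨a1, a2⟩ := cross_of_inv_step_neg (hs i hi) hin
  obtain ⟨b1, b2⟩ := cross_of_inv_step_neg (hs j hj) hjn
  by_contra hne
  rcases Nat.lt_or_gt_of_ne hne with hij | hij
  · have : h (i + 1) ≤ h j := le_of_forall_step_le hij fun t _ ht => (hs t (by omega)).le
    linarith
  · have : h (j + 1) ≤ h i := le_of_forall_step_le hij fun t _ ht => (hs t (by omega)).le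
    linarith

/-- For a sequence with a single decreasing step that starts positive and ends negative, the
sequence of inverses is decreasing. -/
theorem inv_step_pos_of_single_descent {h : ℕ → ℝ} {m J : ℕ} (hJ : J < m)
    (hs : ∀ i < m, i ≠ J → h i < h (i + 1)) (h0 : 0 < h 0) (hm : h m < 0) :
    ∀ i < m, 0 < (h (i + 1) - h i) / (h i * h (i + 1)) := by
  have h1 : ∀ i ≤ J, 0 < h i := fun i hi => h0.trans_le
    (le_of_forall_step_le (Nat.zero_le _) fun j _ hj => (hs j (by omega) (by omega)).le)
  have h2 : ∀ i, J < i → i ≤ m → h i < 0 := fun i hi hi' => lt_of_le_of_lt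
    (le_of_forall_step_le hi' fun j hj hj' => (hs j hj' (by omega)).le) hm
  intro i hi
  rcases lt_trichotomy i J with h3 | h3 | h3
  · exact div_pos (sub_pos.2 (hs i hi h3.ne)) (mul_pos (h1 _ h3.le) (h1 _ h3))
  · have h4 := h1 i h3.le
    have h5 := h2 (i + 1) (by omega) hi
    exact div_pos_of_neg_of_neg (by linarith) (mul_neg_of_pos_of_neg h4 h5)
  · exact div_pos (sub_pos.2 (hs i hi h3.ne'))
      (mul_pos_of_neg_of_neg (h2 _ h3 hi.le) (h2 _ (by omega) hi))

theorem inv_step_neg_unique_of_single_descent {h : ℕ → ℝ} {m J : ℕ}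
    (hs : ∀ i < m, i ≠ J → h i < h (i + 1)) (hJs : h (J + 1) < h J) (hpos : 0 < h 0 * h m)
    {i j : ℕ} (hi : i < m) (hj : j < m) (hin : (h (i + 1) - h i) / (h i * h (i + 1)) < 0)
    (hjn : (h (j + 1) - h j) / (h j * h (j + 1)) < 0) : i = j := by
  have mono : ∀ a b, a ≤ b → b ≤ m → (b ≤ J ∨ J < a) → h a ≤ h b := fun a b hab hb hJ =>
    le_of_forall_step_le hab fun t h1 h2 => (hs t (by omega) (by omega)).le
  have hend : ¬ (h 0 < 0 ∧ 0 < h m) := fun hc => by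
    have := mul_neg_of_neg_of_pos hc.1 hc.2
    linarith
  have hJn : (h (J + 1) - h J) / (h J * h (J + 1)) < 0 → 0 < h J * h (J + 1) := by
    intro hc
    by_contra! hc'
    exact absurd hc (not_lt.2 (div_nonneg_of_nonpos (by linarith) hc'))
  -- The crossing steps before and after the descent, and the descent, exclude each other.
  have main : ∀ i j, i < j → i < m → j < m → (h (i + 1) - h i) / (h i * h (i + 1)) < 0 →
      (h (j + 1) - h j) / (h j * h (j + 1)) < 0 → False := by
    intro i j hij hi hj hin hjn
    by_cases hiJ : i = J
    · subst hiJ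
      obtain ⟨b1, b2⟩ := cross_of_inv_step_neg (hs j hj (by omega)) hjn
      have h1 := mono (i + 1) j hij hj.le (by omega)
      have h2 := mono (j + 1) m hj le_rfl (by omega)
      have h3 := mono 0 i (by omega) (by omega) (by omega)
      have h4 := hJn hin
      have h5 : h i < 0 := by
        by_contra! hc
        exact absurd h4 (not_lt.2 (mul_nonpos_of_nonneg_of_nonpos hc (by linarith)))
      exact hend ⟨by linarith, by linarith⟩
    · obtain ⟨a1, a2⟩ := cross_of_inv_step_neg (hs i hi hiJ) hin
      by_cases hjJ : j = J
      · subst hjJ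
        have h1 := mono (i + 1) j hij hj.le (by omega)
        have h2 := mono (j + 1) m hj le_rfl (by omega)
        have h3 := mono 0 i (by omega) (by omega) (by omega)
        have h4 := pos_of_mul_pos_right (hJn hjn) (by linarith)
        exact hend ⟨by linarith, by linarith⟩
      · obtain ⟨b1, b2⟩ := cross_of_inv_step_neg (hs j hj hjJ) hjn
        by_cases hc : J ≤ i ∨ j < J
        · have := mono (i + 1) j hij hj.le (by omega)
          linarith
        · have h2 := mono (j + 1) m hj le_rfl (by omega)
          have h3 := mono 0 i (by omega) (by omega) (by omega)
          exact hend ⟨by linarith, by linarith⟩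
  rcases lt_trichotomy i j with hij | hij | hij
  · exact (main i j hij hi hj hin hjn).elim
  · exact hij
  · exact (main j i hij hj hi hjn hin).elim

/-- The telescoping form of the fan equation. -/
theorem dblArea_fan_eq_sum {o w : ℂ} {p : ℕ → ℂ} {m : ℕ}
    (hne : ∀ i ≤ m, dblArea o w (p i) ≠ 0) :
    dblArea o (p 0) (p m) = dblArea o w (p 0) * dblArea o w (p m) *
      ∑ i ∈ Finset.range m, dblArea o (p i) (p (i + 1)) /
        (dblArea o w (p i) * dblArea o w (p (i + 1))) := by
  induction m with
  | zero => simp [dblArea]; ring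
  | succ m ih =>
    rw [Finset.sum_range_succ]
    have h1 := ih fun i hi => hne i (by omega)
    have h2 := dblArea_pluecker o w (p 0) (p m) (p (m + 1))
    have h3 := hne m (by omega)
    have h4 := hne (m + 1) le_rfl
    have h5 : dblArea o (p 0) (p (m + 1)) = (dblArea o w (p 0) * dblArea o (p m) (p (m + 1)) +
        dblArea o w (p (m + 1)) * dblArea o (p 0) (p m)) / dblArea o w (p m) := by
      rw [eq_div_iff h3]; linarith
    rw [h5, h1]
    field_simp
    ring

theorem sum_inv_step {h : ℕ → ℝ} {m : ℕ} (hne : ∀ i ≤ m, h i ≠ 0) :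
    h 0 * h m * ∑ i ∈ Finset.range m, (h (i + 1) - h i) / (h i * h (i + 1)) = h m - h 0 := by
  induction m with
  | zero => simp
  | succ m ih =>
    have h1 := ih fun i hi => hne i (by omega)
    have h3 := hne m (by omega)
    have h4 := hne (m + 1) le_rfl
    rw [Finset.sum_range_succ]
    have h5 : h 0 * ∑ i ∈ Finset.range m, (h (i + 1) - h i) / (h i * h (i + 1)) =
        (h m - h 0) / h m := by rw [eq_div_iff h3]; linarith
    rw [mul_add, mul_assoc, mul_left_comm, h5]
    field_simp
    ring

/-- In a fan in which the triangles at the apex `o` are degenerate at every second step and the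
triangles at the other apex are degenerate at the other steps, the signs of the inverse steps
control the position of the area `z = [o, p 0, p m]` relative to `0` and the difference `T` of the
heights. -/
theorem alternating_fan_sign {o w : ℂ} {p : ℕ → ℂ} {m κ : ℕ} (hm : 2 ≤ m) (hκ : κ < 2)
    {h : ℕ → ℝ} (hh : ∀ i, h i = dblArea o w (p i)) (hne : ∀ i ≤ m, h i ≠ 0)
    (hstep : ∀ i < m, h (i + 1) ≠ h i)
    (hc : ∀ i < m, dblArea o (p i) (p (i + 1)) = if i % 2 = κ then h (i + 1) - h i else 0) :
    ((∀ i < m, 0 < (h (i + 1) - h i) / (h i * h (i + 1))) →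
      0 < dblArea o (p 0) (p m) * (h 0 * h m) ∧
      0 < (h m - h 0 - dblArea o (p 0) (p m)) * (h 0 * h m)) ∧
    ((∀ i < m, ∀ j < m, (h (i + 1) - h i) / (h i * h (i + 1)) < 0 →
      (h (j + 1) - h j) / (h j * h (j + 1)) < 0 → i = j) →
      0 < dblArea o (p 0) (p m) * (h 0 * h m) ∨
      0 < (h m - h 0 - dblArea o (p 0) (p m)) * (h 0 * h m)) := by
  set D : ℕ → ℝ := fun i => (h (i + 1) - h i) / (h i * h (i + 1)) with hD
  have hsq : 0 < (h 0 * h m) ^ 2 := by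
    have := mul_ne_zero (hne 0 (by omega)) (hne m le_rfl)
    positivity
  have hz : dblArea o (p 0) (p m) =
      h 0 * h m * ∑ i ∈ Finset.range m, if i % 2 = κ then D i else 0 := by
    rw [dblArea_fan_eq_sum (w := w) fun i hi => by rw [← hh]; exact hne i hi, ← hh, ← hh]
    congr 1
    refine Finset.sum_congr rfl fun i hi => ?_
    rw [hc i (Finset.mem_range.1 hi), ← hh, ← hh]
    split_ifs <;> simp [hD]
  have hz' : h m - h 0 - dblArea o (p 0) (p m) =
      h 0 * h m * ∑ i ∈ Finset.range m, if i % 2 = κ then 0 else D i := by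
    rw [← sum_inv_step hne, hz, ← mul_sub, ← Finset.sum_sub_distrib]
    congr 1
    refine Finset.sum_congr rfl fun i hi => ?_
    split_ifs <;> simp [hD]
  have p1 : (∀ i < m, i % 2 = κ → 0 < D i) → 0 < dblArea o (p 0) (p m) * (h 0 * h m) := by
    intro hp
    have : 0 < ∑ i ∈ Finset.range m, if i % 2 = κ then D i else 0 := by
      refine Finset.sum_pos' (fun i hi => ?_) ⟨κ, by simp; omega, ?_⟩
      · split_ifs with h1
        · exact (hp i (Finset.mem_range.1 hi) h1).le
        · rfl
      · rw [if_pos (by omega)]; exact hp κ (by omega) (by omega)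
    rw [hz]
    calc 0 < (h 0 * h m) ^ 2 * _ := mul_pos hsq this
      _ = _ := by ring
  have p2 : (∀ i < m, i % 2 ≠ κ → 0 < D i) →
      0 < (h m - h 0 - dblArea o (p 0) (p m)) * (h 0 * h m) := by
    intro hp
    have : 0 < ∑ i ∈ Finset.range m, if i % 2 = κ then 0 else D i := by
      refine Finset.sum_pos' (fun i hi => ?_) ⟨1 - κ, by simp; omega, ?_⟩
      · split_ifs with h1
        · rfl
        · exact (hp i (Finset.mem_range.1 hi) h1).le
      · rw [if_neg (by omega)]; exact hp _ (by omega) (by omega)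
    rw [hz']
    calc 0 < (h 0 * h m) ^ 2 * _ := mul_pos hsq this
      _ = _ := by ring
  refine ⟨fun hp => ⟨p1 fun i hi _ => hp i hi, p2 fun i hi _ => hp i hi⟩, fun hu => ?_⟩
  have hD0 : ∀ i < m, D i ≠ 0 := fun i hi => div_ne_zero (sub_ne_zero.2 (hstep i hi))
    (mul_ne_zero (hne i hi.le) (hne _ hi))
  by_cases hn : ∃ i < m, i % 2 = κ ∧ D i < 0
  · obtain ⟨i, hi, hiκ, hin⟩ := hn
    refine Or.inr (p2 fun j hj hjκ => ?_)
    refine lt_of_le_of_ne (not_lt.1 fun hjn => ?_) (hD0 j hj).symm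
    exact hjκ (hu i hi j hj hin hjn ▸ hiκ)
  · push Not at hn
    exact Or.inl (p1 fun i hi hiκ => lt_of_le_of_ne (hn i hi hiκ) (hD0 i hi).symm)

theorem eq_of_dblArea_eq_zero {o w y z : ℂ} (h1 : dblArea o w y = 0) (h2 : dblArea o y z = 0)
    (h3 : dblArea o w z ≠ 0) : y = o := by
  have e1 : (y.re - o.re) * dblArea o w z =
      (w.re - o.re) * dblArea o y z + (z.re - o.re) * dblArea o w y := by
    unfold dblArea; ring
  have e2 : (y.im - o.im) * dblArea o w z =
      (w.im - o.im) * dblArea o y z + (z.im - o.im) * dblArea o w y := by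
    unfold dblArea; ring
  rw [h1, h2, mul_zero, mul_zero, add_zero] at e1 e2
  exact Complex.ext (sub_eq_zero.1 ((mul_eq_zero.1 e1).resolve_right h3))
    (sub_eq_zero.1 ((mul_eq_zero.1 e2).resolve_right h3))

theorem alternating_fan_height_ne_zero {o w : ℂ} {p : ℕ → ℂ} {m κ : ℕ} {h : ℕ → ℝ}
    (hh : ∀ i, h i = dblArea o w (p i)) (hκ : κ < 2) (hstep : ∀ i < m, h (i + 1) ≠ h i)
    (hc : ∀ i < m, dblArea o (p i) (p (i + 1)) = if i % 2 = κ then h (i + 1) - h i else 0)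
    {i : ℕ} (h1 : 1 ≤ i) (h2 : i < m) : h i ≠ 0 := by
  intro h0
  obtain ⟨i, rfl⟩ : ∃ j, i = j + 1 := ⟨i - 1, by omega⟩
  have e := dblArea_pluecker o w (p (i + 1)) (p i) (p (i + 1 + 1))
  have e' : dblArea o (p (i + 1)) (p i) = - dblArea o (p i) (p (i + 1)) := by
    unfold dblArea; ring
  rw [e', ← hh, ← hh, ← hh, h0, hc i (by omega), hc (i + 1) h2] at e
  have s1 := hstep i (by omega)
  have s2 := hstep (i + 1) h2
  rw [h0] at s1 s2 e
  by_cases hi : i % 2 = κ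
  · rw [if_pos hi, if_neg (by omega)] at e
    simp only [zero_mul, mul_zero, zero_sub, neg_neg] at e
    rcases mul_eq_zero.1 (neg_eq_zero.1 (show -(h (i + 1 + 1) * h i) = 0 from e.symm)) with h | h
    · exact s2 h
    · exact s1 h.symm
  · rw [if_neg hi, if_pos (by omega)] at e
    simp only [zero_mul, sub_zero, mul_zero, neg_zero] at e
    rcases mul_eq_zero.1 e.symm with h | h
    · exact s1 h.symm
    · exact s2 h

/-- The area assignment that alternates between zero and nonzero areas is not realizable by two
fans over paths of even lengths in which all nonzero areas are positive but one.

The heights `h` of the first path over the line through `q 0` and `q n` increase, those of the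
second path, `g`, have a single descent. If `h 0` and `h m` have the same sign, then
`alternating_fan_sign` for the first fan shows that `g 0` and `g n` have opposite signs, and for the
second one that `h 0` and `h m` have opposite signs. If `h 0` and `h m` have opposite signs, the
same argument shows that they have the same sign. -/
theorem not_exists_alternating_double_fan {p q : ℕ → ℂ} {m n κ J : ℕ} (hm : Even m) (hn : Even n)
    (hm2 : 2 ≤ m) (hn2 : 2 ≤ n) (hκ : κ < 2) {w w' : ℕ → ℝ} (hw : ∀ i < m, 0 < w i)
    (hw' : ∀ j < n, j ≠ J → 0 < w' j)
    (h1 : ∀ i < m, dblArea (q 0) (p i) (p (i + 1)) = if i % 2 = κ then w i else 0)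
    (h2 : ∀ i < m, dblArea (q n) (p i) (p (i + 1)) = if i % 2 = κ then 0 else -w i)
    (h3 : ∀ j < n, dblArea (p 0) (q j) (q (j + 1)) = if j % 2 = κ then 0 else w' j)
    (h4 : ∀ j < n, dblArea (p m) (q j) (q (j + 1)) = if j % 2 = κ then -w' j else 0) : False := by
  set h : ℕ → ℝ := fun i => dblArea (q 0) (q n) (p i) with hh
  set g : ℕ → ℝ := fun j => dblArea (p 0) (p m) (q j) with hg
  have hstep : ∀ i < m, h (i + 1) - h i = w i := by
    intro i hi
    have := dblArea_sub_dblArea (q 0) (q n) (p i) (p (i + 1))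
    rw [h1 i hi, h2 i hi] at this
    simp only [hh]
    split_ifs at this <;> linarith
  have gstep : ∀ j < n, g (j + 1) - g j = w' j := by
    intro i hi
    have := dblArea_sub_dblArea (p 0) (p m) (q i) (q (i + 1))
    rw [h3 i hi, h4 i hi] at this
    simp only [hg]
    split_ifs at this <;> linarith
  have hlt : ∀ i < m, h i < h (i + 1) := fun i hi => by linarith [hstep i hi, hw i hi]
  have glt : ∀ j < n, j ≠ J → g j < g (j + 1) := fun i hi hJ => by
    linarith [gstep i hi, hw' i hi hJ]
  have hS : h 0 < h m :=
    (hlt 0 (by omega)).trans_le (le_of_forall_step_le (by omega) fun i _ hi => (hlt i hi).le)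
  have hsum : g n - g 0 = - (h m - h 0) := by
    simp only [hh, hg]; unfold dblArea; ring
  have hJ : J < n ∧ g (J + 1) < g J := by
    by_contra! hc
    have : g 0 ≤ g n := le_of_forall_step_le (by omega) fun j _ hj => by
      by_cases hjJ : j = J
      · subst hjJ; exact hc hj
      · exact (glt j hj hjJ).le
    linarith
  have hstep' : ∀ i < m, h (i + 1) ≠ h i := fun i hi => (hlt i hi).ne'
  have gstep' : ∀ j < n, g (j + 1) ≠ g j := fun j hj => by
    by_cases hjJ : j = J
    · subst hjJ; exact hJ.2.ne
    · exact (glt j hj hjJ).ne'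
  have hw0 : ∀ j < n, w' j ≠ 0 := fun j hj => by
    rw [← gstep j hj]; exact sub_ne_zero.2 (gstep' j hj)
  have h1' : ∀ i < m, dblArea (q 0) (p i) (p (i + 1)) =
      if i % 2 = κ then h (i + 1) - h i else 0 := fun i hi => by rw [h1 i hi, hstep i hi]
  have h3' : ∀ j < n, dblArea (p 0) (q j) (q (j + 1)) =
      if j % 2 = 1 - κ then g (j + 1) - g j else 0 := fun j hj => by
    rw [h3 j hj, gstep j hj]
    split_ifs <;> first | rfl | omega
  have hnn : (n - 1) + 1 = n := by omega
  have hmm : (m - 1) + 1 = m := by omega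
  rw [Nat.even_iff] at hm hn
  -- The first and the last height vanish only if an edge of a nondegenerate triangle has length 0.
  have hP : ∀ a b : ℂ, dblArea a a b = 0 := fun a b => by unfold dblArea; ring
  have hP' : ∀ a b : ℂ, dblArea a b a = 0 := fun a b => by unfold dblArea; ring
  have hflip : ∀ y : ℂ, dblArea (q n) (q 0) y = - dblArea (q 0) (q n) y := fun y => by
    unfold dblArea; ring
  have hzero : h 0 ≠ 0 := by
    intro h0
    have k1 : dblArea (q 0) (q n) (p 0) = 0 := h0
    have k2 : dblArea (q 0) (q n) (p 1) ≠ 0 := fun hc => hstep' 0 (by omega) (hc.trans h0.symm)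
    have c1 := h1 0 (by omega)
    have c2 := h2 0 (by omega)
    rcases Nat.eq_zero_or_pos κ with hk | hk
    · rw [if_pos (by omega)] at c2
      have e := eq_of_dblArea_eq_zero (w := q 0) (by rw [hflip, k1, neg_zero]) c2
        (by rw [hflip]; exact neg_ne_zero.2 k2)
      have c3 := h3 (n - 1) (by omega)
      rw [e, hnn, hP', if_neg (by omega)] at c3
      exact hw0 _ (by omega) c3.symm
    · rw [if_neg (by omega)] at c1
      have e := eq_of_dblArea_eq_zero k1 c1 k2
      have c3 := h3 0 (by omega)
      rw [e, hP, if_neg (by omega)] at c3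
      exact hw0 _ (by omega) c3.symm
  have hlast : h m ≠ 0 := by
    intro h0
    have k1 : dblArea (q 0) (q n) (p m) = 0 := h0
    have k2 : dblArea (q 0) (q n) (p (m - 1)) ≠ 0 := fun hc =>
      hstep' (m - 1) (by omega) (by rw [hmm]; exact h0.trans hc.symm)
    have c1 := h1 (m - 1) (by omega)
    have c2 := h2 (m - 1) (by omega)
    rw [hmm] at c1 c2
    have hrev : ∀ a b c : ℂ, dblArea a c b = - dblArea a b c := fun a b c => by
      unfold dblArea; ring
    rcases Nat.eq_zero_or_pos κ with hk | hk
    · rw [if_neg (by omega)] at c1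
      have e := eq_of_dblArea_eq_zero k1 (by rw [hrev, c1, neg_zero]) k2
      have c3 := h4 0 (by omega)
      rw [e, hP, if_pos (by omega)] at c3
      exact hw0 0 (by omega) (by linarith)
    · rw [if_pos (by omega)] at c2
      have e := eq_of_dblArea_eq_zero (w := q 0) (by rw [hflip, k1, neg_zero])
        (by rw [hrev, c2, neg_zero]) (by rw [hflip]; exact neg_ne_zero.2 k2)
      have c3 := h4 (n - 1) (by omega)
      rw [e, hnn, hP', if_pos (by omega)] at c3
      exact hw0 (n - 1) (by omega) (by linarith)
  have hne : ∀ i ≤ m, h i ≠ 0 := by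
    intro i hi
    rcases Nat.eq_zero_or_pos i with h0 | h0
    · rwa [h0]
    · rcases Nat.lt_or_ge i m with h5 | h5
      · exact alternating_fan_height_ne_zero (fun i => rfl) hκ hstep' h1' h0 h5
      · rwa [show i = m by omega]
  have gne : g 0 ≠ 0 → g n ≠ 0 → ∀ i ≤ n, g i ≠ 0 := by
    intro g0 gn i hi
    rcases Nat.eq_zero_or_pos i with h0 | h0
    · rwa [h0]
    · rcases Nat.lt_or_ge i n with h5 | h5
      · exact alternating_fan_height_ne_zero (fun i => rfl) (by omega) gstep' h3' h0 h5
      · rwa [show i = n by omega]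
  obtain ⟨f1, f2⟩ := alternating_fan_sign hm2 hκ (fun i => rfl) hne hstep' h1'
  have hz : dblArea (q 0) (p 0) (p m) = g 0 := by
    simp only [hg]; unfold dblArea; ring
  have hx : dblArea (p 0) (q 0) (q n) = h 0 := by
    simp only [hh]; unfold dblArea; ring
  rw [hz] at f1 f2
  have hgn : g n = g 0 - (h m - h 0) := by linarith
  rcases lt_or_gt_of_ne (mul_ne_zero hzero hlast) with hneg | hpos
  · have f3 := f2 fun i hi j hj => inv_step_neg_unique_of_increasing hlt hi hj
    have hgg : 0 < g 0 * g n := by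
      rcases f3 with f3 | f3
      · have := neg_of_mul_pos_left f3 hneg.le
        exact mul_pos_of_neg_of_neg this (by linarith)
      · have := neg_of_mul_pos_left f3 hneg.le
        exact mul_pos (by linarith) (by linarith)
    obtain ⟨-, f5⟩ := alternating_fan_sign hn2 (by omega) (fun i => rfl)
      (gne (left_ne_zero_of_mul hgg.ne') (right_ne_zero_of_mul hgg.ne')) gstep' h3'
    have f6 := f5 fun i hi j hj => inv_step_neg_unique_of_single_descent glt hJ.2 hgg hi hj
    rw [hx, hsum] at f6
    have hx1 : h 0 < 0 := by
      by_contra! hc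
      exact absurd hneg (not_lt.2 (mul_nonneg hc (by linarith)))
    have hx2 : 0 < h m := pos_of_mul_neg_right hneg hx1.le
    rcases f6 with f6 | f6
    · linarith [pos_of_mul_pos_left f6 hgg.le]
    · linarith [pos_of_mul_pos_left f6 hgg.le]
  · have f3 := f1 (inv_step_pos_of_increasing hlt hpos)
    have g0 : 0 < g 0 := pos_of_mul_pos_left f3.1 hpos.le
    have g1 : g n < 0 := by linarith [pos_of_mul_pos_left f3.2 hpos.le]
    obtain ⟨f4, -⟩ := alternating_fan_sign hn2 (by omega) (fun i => rfl)
      (gne g0.ne' g1.ne) gstep' h3'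
    have f6 := f4 (inv_step_pos_of_single_descent hJ.1 glt g0 g1)
    rw [hx, hsum] at f6
    have hgg := mul_neg_of_pos_of_neg g0 g1
    have a1 := neg_of_mul_pos_left f6.1 hgg.le
    have a2 := neg_of_mul_pos_left f6.2 hgg.le
    have := mul_neg_of_neg_of_pos a1 (show 0 < h m by linarith)
    linarith

/-! ### Plane triangulations -/

section FaceStep

variable {V : Type*} {G : SimpleGraph V}

instance SimpleGraph.Dart.instFinite [Finite V] : Finite G.Dart :=
  Finite.of_injective _ SimpleGraph.Dart.toProd_injective

theorem SimpleGraph.Dart.eq_of_fst_snd {d e : G.Dart} (h1 : d.fst = e.fst) (h2 : d.snd = e.snd) :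
    d = e :=
  SimpleGraph.Dart.ext _ _ (Prod.ext h1 h2)

theorem faceStep_apply (rot : Equiv.Perm G.Dart) (d : G.Dart) :
    faceStep rot d = rot⁻¹ d.symm := rfl

end FaceStep

namespace PlaneGraph

variable {V : Type*} [Finite V] {G : SimpleGraph V} (P : PlaneGraph G)

theorem faceStep_fst (d : G.Dart) : (faceStep P.rot d).fst = d.snd := by
  have := P.rot_fst (P.rot⁻¹ d.symm)
  rw [← Equiv.Perm.mul_apply, mul_inv_cancel, Equiv.Perm.one_apply] at this
  rw [faceStep_apply, ← this]
  rfl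

/-- The third vertex of the face to the left of a dart, if that face is a triangle. -/
def apex (d : G.Dart) : V := (faceStep P.rot d).snd

/-- All faces are triangles. -/
def IsTriangulation : Prop :=
  ∀ d, faceStep P.rot (faceStep P.rot (faceStep P.rot d)) = d

theorem leftFace_faceStep (d : G.Dart) : P.leftFace (faceStep P.rot d) = P.leftFace d :=
  Quotient.sound (s := Equiv.Perm.SameCycle.setoid (faceStep P.rot))
    (Equiv.Perm.sameCycle_apply_left.2 (Equiv.Perm.SameCycle.refl _ _))

theorem exists_leftFace_eq (f : P.Face) : ∃ d, P.leftFace d = f := by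
  induction f using Quotient.inductionOn with
  | h d => exact ⟨d, rfl⟩

theorem faceStep_ne (d : G.Dart) : faceStep P.rot d ≠ d := fun h => by
  have := P.faceStep_fst d
  rw [h] at this
  exact d.fst_ne_snd this

theorem faceStep_faceStep_ne {d : G.Dart} (hd : ∃ e : G.Dart, e.fst = d.snd ∧ e ≠ d.symm) :
    faceStep P.rot (faceStep P.rot d) ≠ d := by
  intro h
  have h1 := P.faceStep_fst d
  have h2 := P.faceStep_fst (faceStep P.rot d)
  rw [h] at h2
  have h3 : faceStep P.rot d = d.symm := SimpleGraph.Dart.eq_of_fst_snd h1 h2.symm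
  rw [faceStep_apply, Equiv.Perm.inv_eq_iff_eq] at h3
  obtain ⟨e, he, hne⟩ := hd
  have h4 := P.rot_sameCycle d.symm e he.symm
  exact hne (h4.eq_of_left h3.symm).symm

/-- A simple plane graph without vertices of degree at most one and with at least `3 |V| - 6` edges
is a triangulation. -/
theorem isTriangulation_of_card (hdeg : ∀ d : G.Dart, ∃ e : G.Dart, e.fst = d.fst ∧ e ≠ d)
    (hE : 3 * Nat.card V ≤ Nat.card G.edgeSet + 6) : P.IsTriangulation := by
  classical
  have : Fintype V := Fintype.ofFinite V
  have : Fintype P.Face := Fintype.ofFinite _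
  by_contra hT
  unfold IsTriangulation at hT
  push Not at hT
  obtain ⟨d₀, hd₀⟩ := hT
  have hcard : Fintype.card G.Dart = 2 * Nat.card G.edgeSet := by
    rw [SimpleGraph.dart_card_eq_twice_card_edges, Nat.card_eq_fintype_card,
      SimpleGraph.edgeFinset_card]
  have hne2 : ∀ d, faceStep P.rot (faceStep P.rot d) ≠ d := fun d =>
    P.faceStep_faceStep_ne (hdeg d.symm)
  have hsub : ∀ d, ({d, faceStep P.rot d, faceStep P.rot (faceStep P.rot d)} : Finset G.Dart) ⊆
      Finset.univ.filter fun e => P.leftFace e = P.leftFace d := by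
    intro d e he
    simp only [Finset.mem_insert, Finset.mem_singleton] at he
    rw [Finset.mem_filter]
    refine ⟨Finset.mem_univ _, ?_⟩
    rcases he with rfl | rfl | rfl <;> simp only [leftFace_faceStep]
  have hthree : ∀ d,
      ({d, faceStep P.rot d, faceStep P.rot (faceStep P.rot d)} : Finset G.Dart).card = 3 :=
    fun d => Finset.card_eq_three.2 ⟨_, _, _, (P.faceStep_ne d).symm, (hne2 d).symm,
      (P.faceStep_ne _).symm, rfl⟩
  have h3 : ∀ f : P.Face, 3 ≤ (Finset.univ.filter fun e => P.leftFace e = f).card := by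
    intro f
    obtain ⟨d, rfl⟩ := P.exists_leftFace_eq f
    rw [← hthree d]
    exact Finset.card_le_card (hsub d)
  have h4 : 3 < (Finset.univ.filter fun e => P.leftFace e = P.leftFace d₀).card := by
    rw [← hthree d₀]
    refine Finset.card_lt_card ((Finset.ssubset_iff_of_subset (hsub d₀)).2
      ⟨faceStep P.rot (faceStep P.rot (faceStep P.rot d₀)), ?_, ?_⟩)
    · rw [Finset.mem_filter]
      exact ⟨Finset.mem_univ _, by simp only [leftFace_faceStep]⟩
    · simp only [Finset.mem_insert, Finset.mem_singleton, not_or]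
      exact ⟨hd₀, fun h => hne2 d₀ ((faceStep P.rot).injective h), P.faceStep_ne _⟩
  have hsum : Fintype.card G.Dart =
      ∑ f : P.Face, (Finset.univ.filter fun e => P.leftFace e = f).card := by
    rw [← Finset.card_univ]
    exact Finset.card_eq_sum_card_fiberwise fun _ _ => Finset.mem_coe.2 (Finset.mem_univ _)
  have hlt : ∑ f : P.Face, 3 < ∑ f : P.Face,
      (Finset.univ.filter fun e => P.leftFace e = f).card :=
    Finset.sum_lt_sum (fun f _ => h3 f) ⟨_, Finset.mem_univ _, h4⟩
  rw [← hsum, hcard, Finset.sum_const, Finset.card_univ, smul_eq_mul,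
    ← Nat.card_eq_fintype_card] at hlt
  have h5 := P.euler
  change _ + Nat.card P.Face = _ at h5
  omega

section Triangulation

variable {P}

variable (P) in
theorem faceStep₂_fst (d : G.Dart) :
    (faceStep P.rot (faceStep P.rot d)).fst = P.apex d := P.faceStep_fst _

theorem IsTriangulation.faceStep₂_snd (hT : P.IsTriangulation) (d : G.Dart) :
    (faceStep P.rot (faceStep P.rot d)).snd = d.fst := by
  rw [← P.faceStep_fst, hT]

theorem IsTriangulation.apex_faceStep (hT : P.IsTriangulation) (d : G.Dart) :
    P.apex (faceStep P.rot d) = d.fst :=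
  hT.faceStep₂_snd d

theorem IsTriangulation.rot_eq (hT : P.IsTriangulation) (d : G.Dart) :
    P.rot d = (faceStep P.rot (faceStep P.rot d)).symm := by
  have h := hT d
  rw [faceStep_apply, Equiv.Perm.inv_eq_iff_eq] at h
  exact h.symm

theorem IsTriangulation.rot_snd (hT : P.IsTriangulation) (d : G.Dart) :
    (P.rot d).snd = P.apex d := by
  rw [hT.rot_eq]
  exact P.faceStep_fst _

theorem IsTriangulation.leftFace_eq_iff (hT : P.IsTriangulation) {d e : G.Dart} :
    P.leftFace e = P.leftFace d ↔ e = d ∨ e = faceStep P.rot d ∨ e = faceStep P.rot (faceStep P.rot d) := by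
  constructor
  · intro h
    have h1 : (faceStep P.rot).SameCycle d e :=
      (Quotient.exact (s := Equiv.Perm.SameCycle.setoid (faceStep P.rot)) h).symm
    obtain ⟨n, rfl⟩ := h1.exists_nat_pow_eq
    clear h h1
    induction n with
    | zero => exact Or.inl rfl
    | succ n ih =>
      rw [pow_succ', Equiv.Perm.mul_apply]
      rcases ih with h | h | h <;> rw [h]
      · exact Or.inr (Or.inl rfl)
      · exact Or.inr (Or.inr rfl)
      · exact Or.inl (hT d)
  · rintro (rfl | rfl | rfl) <;> simp only [leftFace_faceStep]

theorem IsTriangulation.apex_ne_fst (hT : P.IsTriangulation) (d : G.Dart) : P.apex d ≠ d.fst := by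
  rw [← P.faceStep₂_fst, ← hT.faceStep₂_snd d]
  exact (faceStep P.rot (faceStep P.rot d)).fst_ne_snd

theorem apex_ne_snd (d : G.Dart) : P.apex d ≠ d.snd := by
  rw [← P.faceStep_fst d]
  exact (faceStep P.rot d).fst_ne_snd.symm

/-- The two sides of an edge are different faces. -/
theorem IsTriangulation.leftFace_symm_ne (hT : P.IsTriangulation) (d : G.Dart) :
    P.leftFace d.symm ≠ P.leftFace d := by
  intro h
  rcases hT.leftFace_eq_iff.1 h with h | h | h
  · exact d.symm_ne h
  · have := congrArg SimpleGraph.Dart.toProd h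
    exact hT.apex_ne_fst d (congrArg Prod.snd this).symm
  · have h1 : d.symm.fst = P.apex d := by rw [h]; exact P.faceStep₂_fst d
    exact apex_ne_snd d h1.symm

/-- Each vertex is the tail of only one dart of a face. -/
theorem IsTriangulation.eq_of_leftFace_eq (hT : P.IsTriangulation) {d e : G.Dart}
    (h : P.leftFace e = P.leftFace d)
    (h1 : e.fst = d.fst) : e = d := by
  rcases hT.leftFace_eq_iff.1 h with h | h | h
  · exact h
  · rw [h, P.faceStep_fst] at h1
    exact absurd h1 d.fst_ne_snd.symm
  · rw [h, P.faceStep₂_fst] at h1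
    exact absurd h1 (hT.apex_ne_fst d)

theorem IsTriangulation.sum_leftFace_eq (hT : P.IsTriangulation) [Fintype G.Dart]
    [DecidableEq P.Face] (g : G.Dart → ℝ) (d : G.Dart) : ∑ e with P.leftFace e = P.leftFace d, g e =
      g d + g (faceStep P.rot d) + g (faceStep P.rot (faceStep P.rot d)) := by
  classical
  have h2 : faceStep P.rot (faceStep P.rot d) ≠ d := fun h => by
    have := hT.apex_ne_fst d
    rw [← P.faceStep₂_fst, h] at this
    exact this rfl
  have : (Finset.univ.filter fun e => P.leftFace e = P.leftFace d) =
      {d, faceStep P.rot d, faceStep P.rot (faceStep P.rot d)} := by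
    ext e
    simp only [Finset.mem_filter, Finset.mem_univ, true_and, Finset.mem_insert,
      Finset.mem_singleton]
    exact hT.leftFace_eq_iff
  rw [this, Finset.sum_insert (by
      simp only [Finset.mem_insert, Finset.mem_singleton, not_or]
      exact ⟨(P.faceStep_ne d).symm, h2.symm⟩),
    Finset.sum_insert (by simpa using (P.faceStep_ne _).symm), Finset.sum_singleton, add_assoc]

/-- The shoelace formula for a triangular face. -/
theorem IsTriangulation.faceArea_leftFace (hT : P.IsTriangulation) (D : V → ℂ) (d : G.Dart) :
    P.faceArea D (P.leftFace d) = dblArea (D d.fst) (D d.snd) (D (P.apex d)) / 2 := by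
  classical
  have : Fintype V := Fintype.ofFinite V
  unfold faceArea
  congr 1
  rw [finsum_eq_sum_of_fintype]
  have h := hT.sum_leftFace_eq
    (fun e => (D e.fst).re * (D e.snd).im - (D e.snd).re * (D e.fst).im) d
  rw [Finset.sum_subtype (p := fun e => P.leftFace e = P.leftFace d) _ (by simp)] at h
  rw [h, P.faceStep₂_fst, hT.faceStep₂_snd, P.faceStep_fst]
  change _ + ((D d.snd).re * (D (P.apex d)).im - (D (P.apex d)).re * (D d.snd).im) + _ = _
  unfold dblArea
  ring

/-- A function on the darts that changes its sign under reversal has sum `0` over all faces. -/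
theorem sum_faces_eq_zero [Fintype G.Dart] [Fintype P.Face] [DecidableEq P.Face] {g : G.Dart → ℝ}
    (hg : ∀ d, g d.symm = - g d) : ∑ f : P.Face, ∑ e with P.leftFace e = f, g e = 0 := by
  rw [Finset.sum_fiberwise]
  have h : ∑ d : G.Dart, g d.symm = ∑ d, g d :=
    Equiv.sum_comp (Function.Involutive.toPerm _ SimpleGraph.Dart.symm_involutive) g
  simp only [hg, Finset.sum_neg_distrib] at h
  linarith

/-- The outer face is traversed clockwise, so its signed area cancels those of the inner faces. -/
theorem sum_faceArea_eq_zero [Fintype P.Face] (D : V → ℂ) : ∑ f : P.Face, P.faceArea D f = 0 := by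
  classical
  have : Fintype V := Fintype.ofFinite V
  have h := sum_faces_eq_zero (P := P)
    (g := fun e => (D e.fst).re * (D e.snd).im - (D e.snd).re * (D e.fst).im)
    (fun d => by
      change (D d.snd).re * (D d.fst).im - (D d.fst).re * (D d.snd).im = _
      ring)
  have e : ∀ f, P.faceArea D f = (∑ e with P.leftFace e = f,
      ((D e.fst).re * (D e.snd).im - (D e.snd).re * (D e.fst).im)) / 2 := by
    intro f
    unfold faceArea
    congr 1
    rw [finsum_eq_sum_of_fintype, Finset.sum_subtype (p := fun e => P.leftFace e = f) _
      (fun e => by simp) (fun e => (D e.fst).re * (D e.snd).im - (D e.snd).re * (D e.fst).im)]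
  simp only [e]
  rw [← Finset.sum_div, h, zero_div]

end Triangulation

end PlaneGraph

/-! ### Counting triangles by ray crossings -/

/-- The signed number of crossings of the segment from `a` to `b` with the horizontal ray from `z`
to the right, for `z` in general position. -/
noncomputable def rayCross (z a b : ℂ) : ℝ :=
  if a.im < z.im ∧ z.im < b.im ∧ 0 < dblArea a b z then 1
  else if b.im < z.im ∧ z.im < a.im ∧ dblArea a b z < 0 then -1 else 0

theorem rayCross_swap (z a b : ℂ) : rayCross z b a = - rayCross z a b := by
  unfold rayCross
  rw [dblArea_swap a b z]
  have h1 : ¬ (a.im < z.im ∧ z.im < a.im) := fun h => lt_asymm h.1 h.2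
  by_cases h2 : a.im < z.im ∧ z.im < b.im ∧ 0 < dblArea a b z
  · have h3 : ¬ (b.im < z.im ∧ z.im < a.im ∧ 0 < -dblArea a b z) := fun h => by
      linarith [h.1, h2.2.1]
    have h4 : a.im < z.im ∧ z.im < b.im ∧ -dblArea a b z < 0 := ⟨h2.1, h2.2.1, by linarith [h2.2.2]⟩
    rw [if_neg h3, if_pos h4, if_pos h2]
  · have h4 : ¬ (a.im < z.im ∧ z.im < b.im ∧ -dblArea a b z < 0) := fun h =>
      h2 ⟨h.1, h.2.1, by linarith [h.2.2]⟩
    rw [if_neg h4, if_neg h2]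
    by_cases h5 : b.im < z.im ∧ z.im < a.im ∧ dblArea a b z < 0
    · rw [if_pos h5, if_pos ⟨h5.1, h5.2.1, by linarith [h5.2.2]⟩, neg_neg]
    · rw [if_neg h5, if_neg fun h => h5 ⟨h.1, h.2.1, by linarith [h.2.2]⟩, neg_zero]

/-- The boundary of a counterclockwise triangle crosses the ray from `z` once in total if `z` is in
the triangle and zero times otherwise. -/
theorem rayCross_triangle {z a b c : ℂ} (hpos : 0 < dblArea a b c)
    (ha : z.im ≠ a.im) (hb : z.im ≠ b.im) (hc : z.im ≠ c.im) (hab : dblArea a b z ≠ 0)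
    (hbc : dblArea b c z ≠ 0) (hca : dblArea c a z ≠ 0) :
    rayCross z a b + rayCross z b c + rayCross z c a =
      if 0 < dblArea a b z ∧ 0 < dblArea b c z ∧ 0 < dblArea c a z then 1 else 0 := by
  have e1 : dblArea a b z + dblArea b c z + dblArea c a z = dblArea a b c := by
    unfold dblArea; ring
  have e2 : (a.im - z.im) * dblArea b c z + (b.im - z.im) * dblArea c a z +
      (c.im - z.im) * dblArea a b z = 0 := by
    unfold dblArea; ring
  unfold rayCross
  generalize dblArea a b z = x at *
  generalize dblArea b c z = y at *
  generalize dblArea c a z = w at *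
  rw [← e1] at hpos
  clear e1
  -- A sign pattern either gives the claim directly or contradicts `e2` or the sign of the area.
  rcases lt_or_gt_of_ne ha with ha | ha <;> rcases lt_or_gt_of_ne hb with hb | hb <;>
  rcases lt_or_gt_of_ne hc with hc | hc <;> rcases lt_or_gt_of_ne hab with hab | hab <;>
  rcases lt_or_gt_of_ne hbc with hbc | hbc <;> rcases lt_or_gt_of_ne hca with hca | hca <;>
  first
  | (simp only [ha, hb, hc, hab, hbc, hca, ha.not_gt, hb.not_gt, hc.not_gt, hab.not_gt,
      hbc.not_gt, hca.not_gt, and_true, and_false, if_true, if_false]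
     norm_num
     done)
  | (exfalso; linarith)
  | (exfalso
     first
     | nlinarith [mul_pos (sub_pos.2 ha) hbc, mul_pos (sub_pos.2 hb) hca,
        mul_pos (sub_pos.2 hc) hab]
     | nlinarith [mul_pos_of_neg_of_neg (sub_neg.2 ha) hbc, mul_pos (sub_pos.2 hb) hca,
        mul_pos (sub_pos.2 hc) hab]
     | nlinarith [mul_pos (sub_pos.2 ha) (neg_pos.2 hbc), mul_pos (sub_pos.2 hb) (neg_pos.2 hca),
        mul_pos (sub_pos.2 hc) (neg_pos.2 hab)]
     | nlinarith [mul_pos (sub_pos.2 ha) (neg_pos.2 hbc), mul_pos (sub_pos.2 hb) (hca),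
        mul_pos (sub_pos.2 hc) (neg_pos.2 hab)]
     | nlinarith [mul_pos (sub_pos.2 ha) (hbc), mul_pos (sub_pos.2 hb) (neg_pos.2 hca),
        mul_pos (sub_pos.2 hc) (neg_pos.2 hab)]
     | nlinarith [mul_pos (sub_pos.2 ha) (neg_pos.2 hbc), mul_pos (sub_pos.2 hb) (neg_pos.2 hca),
        mul_pos (sub_pos.2 hc) (hab)]
     | nlinarith [mul_pos (sub_pos.2 ha) (hbc), mul_pos (sub_pos.2 hb) (hca),
        mul_pos (sub_pos.2 hc) (neg_pos.2 hab)]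
     | nlinarith [mul_pos (sub_pos.2 ha) (hbc), mul_pos (sub_pos.2 hb) (neg_pos.2 hca),
        mul_pos (sub_pos.2 hc) (hab)])

theorem rayCross_triangle_neg {z a b c : ℂ} (hneg : dblArea a b c < 0)
    (ha : z.im ≠ a.im) (hb : z.im ≠ b.im) (hc : z.im ≠ c.im) (hab : dblArea a b z ≠ 0)
    (hbc : dblArea b c z ≠ 0) (hca : dblArea c a z ≠ 0) :
    rayCross z a b + rayCross z b c + rayCross z c a =
      if dblArea a b z < 0 ∧ dblArea b c z < 0 ∧ dblArea c a z < 0 then -1 else 0 := by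
  have h := rayCross_triangle (z := z) (a := b) (b := a) (c := c)
    (by rw [dblArea_swap]; linarith) hb ha hc (by rwa [dblArea_swap, neg_ne_zero])
    (by rwa [dblArea_swap, neg_ne_zero]) (by rwa [dblArea_swap, neg_ne_zero])
  rw [rayCross_swap z a b, rayCross_swap z c a, rayCross_swap z b c, dblArea_swap a b,
    dblArea_swap c a, dblArea_swap b c] at h
  simp only [Left.neg_pos_iff] at h
  have e : (dblArea a b z < 0 ∧ dblArea c a z < 0 ∧ dblArea b c z < 0) ↔
      (dblArea a b z < 0 ∧ dblArea b c z < 0 ∧ dblArea c a z < 0) := by tauto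
  simp only [e] at h
  split_ifs with h1
  · rw [if_pos h1] at h; linarith
  · rw [if_neg h1] at h; linarith

/-! ### Points in general position -/

theorem dblArea_lineMap (a b p z : ℂ) (t : ℝ) :
    dblArea a b (p + (t : ℂ) * (z - p)) = (1 - t) * dblArea a b p + t * dblArea a b z := by
  unfold dblArea
  simp only [Complex.add_re, Complex.re_ofReal_mul, Complex.sub_re, Complex.add_im,
    Complex.im_ofReal_mul, Complex.sub_im]
  ring

theorem continuous_dblArea (a b : ℂ) : Continuous fun z => dblArea a b z := by
  unfold dblArea; fun_prop

section General

variable {V : Type*} {G : SimpleGraph V}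

/-- `z` is on none of the lines that span edges and at the height of no vertex. -/
def InGeneralPosition (G : SimpleGraph V) (D : V → ℂ) (z : ℂ) : Prop :=
  (∀ x, z.im ≠ (D x).im) ∧ ∀ d : G.Dart, dblArea (D d.fst) (D d.snd) z ≠ 0

/-- The points in general position are dense. They are found on a parabola, on which every line is
the zero set of a nonzero quadratic polynomial. -/
theorem exists_inGeneralPosition_mem [Finite V] {D : V → ℂ} (hD : ∀ d : G.Dart, D d.fst ≠ D d.snd)
    {U : Set ℂ} (hU : IsOpen U) {z₀ : ℂ} (hz₀ : z₀ ∈ U) : ∃ z ∈ U, InGeneralPosition G D z := by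
  set γ : ℝ → ℂ := fun t => z₀ + ⟨t, t ^ 2⟩ with hγ
  have hc : Continuous γ := by
    have : γ = fun t : ℝ => z₀ + ((t : ℂ) + ((t ^ 2 : ℝ) : ℂ) * Complex.I) := by
      funext t
      simp only [hγ]
      congr 1
      apply Complex.ext <;> simp [sq]
    rw [this]
    fun_prop
  have h0 : γ 0 = z₀ := by
    apply Complex.ext <;> simp [hγ]
  have e1 : ∀ᶠ t in 𝓝[>] (0 : ℝ), γ t ∈ U :=
    nhdsWithin_le_nhds (hc.continuousAt.eventually_mem (by rw [h0]; exact hU.mem_nhds hz₀))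
  have e2 : ∀ᶠ t in 𝓝[>] (0 : ℝ), ∀ x, (γ t).im ≠ (D x).im := by
    refine eventually_all.2 fun x => ?_
    filter_upwards [eventually_quadratic_ne_zero (a := z₀.im - (D x).im) (b := 0) (c := 1)
      (by simp)] with t ht h
    apply ht
    simp only [hγ, Complex.add_im] at h
    linarith
  have e3 : ∀ᶠ t in 𝓝[>] (0 : ℝ), ∀ d : G.Dart, dblArea (D d.fst) (D d.snd) (γ t) ≠ 0 := by
    refine eventually_all.2 fun d => ?_
    have hne : dblArea (D d.fst) (D d.snd) z₀ ≠ 0 ∨ -((D d.snd).im - (D d.fst).im) ≠ 0 ∨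
        (D d.snd).re - (D d.fst).re ≠ 0 := by
      by_contra! hcon
      refine hD d (Complex.ext ?_ ?_) <;> linarith [hcon.2.1, hcon.2.2]
    filter_upwards [eventually_quadratic_ne_zero hne] with t ht h
    apply ht
    rw [← h]
    simp only [hγ, dblArea, Complex.add_im, Complex.add_re]
    ring
  obtain ⟨t, ht1, ht2, ht3⟩ := (e1.and (e2.and e3)).exists
  exact ⟨γ t, ht1, ht2, ht3⟩

end General

/-! ### The inner triangles of a positive drawing do not overlap -/

namespace PlaneGraph

variable {V : Type*} [Finite V] {G : SimpleGraph V} {P : PlaneGraph G} {D : V → ℂ}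

/-- The dart `d` has an inner face on its left. -/
def IsInner (P : PlaneGraph G) (d : G.Dart) : Prop := P.leftFace d ≠ P.outerFace

/-- Twice the signed area of the triangle to the left of a dart. -/
def triArea (P : PlaneGraph G) (D : V → ℂ) (d : G.Dart) : ℝ :=
  dblArea (D d.fst) (D d.snd) (D (P.apex d))

/-- In the vertex placement `D` of a triangulation all inner triangles are counterclockwise. -/
structure IsPositive (P : PlaneGraph G) (D : V → ℂ) : Prop where
  triangulation : P.IsTriangulation
  triArea_pos : ∀ d, P.IsInner d → 0 < P.triArea D d
  exists_dart : ∀ x, ∃ d e : G.Dart, d.fst = x ∧ e.fst = x ∧ d ≠ e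

/-- Positive if `z` is to the left of the line spanned by the dart `d`. -/
def side (D : V → ℂ) (d : G.Dart) (z : ℂ) : ℝ := dblArea (D d.fst) (D d.snd) z

/-- The open triangle to the left of a dart. -/
def openTri (P : PlaneGraph G) (D : V → ℂ) (d : G.Dart) : Set ℂ :=
  {z | 0 < side D d z ∧ 0 < side D (faceStep P.rot d) z ∧
    0 < side D (faceStep P.rot (faceStep P.rot d)) z}

/-- The closed triangle to the left of a dart. -/
def closedTri (P : PlaneGraph G) (D : V → ℂ) (d : G.Dart) : Set ℂ :=
  {z | 0 ≤ side D d z ∧ 0 ≤ side D (faceStep P.rot d) z ∧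
    0 ≤ side D (faceStep P.rot (faceStep P.rot d)) z}

omit [Finite V] in
theorem side_symm (d : G.Dart) (z : ℂ) : side D d.symm z = - side D d z := dblArea_swap _ _ _

omit [Finite V] in
theorem side_fst (d : G.Dart) : side D d (D d.fst) = 0 := by unfold side dblArea; ring

omit [Finite V] in
theorem side_snd (d : G.Dart) : side D d (D d.snd) = 0 := by unfold side dblArea; ring

theorem isOpen_openTri (d : G.Dart) : IsOpen (P.openTri D d) :=
  (isOpen_lt continuous_const (continuous_dblArea _ _)).inter
    ((isOpen_lt continuous_const (continuous_dblArea _ _)).inter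
      (isOpen_lt continuous_const (continuous_dblArea _ _)))

namespace IsPositive

variable (hP : P.IsPositive D)
include hP

omit hP in
theorem side_next_eq (d : G.Dart) (z : ℂ) :
    side D (faceStep P.rot d) z = dblArea (D d.snd) (D (P.apex d)) z := by
  unfold side; rw [P.faceStep_fst]; rfl

theorem side_next₂_eq (d : G.Dart) (z : ℂ) :
    side D (faceStep P.rot (faceStep P.rot d)) z = dblArea (D (P.apex d)) (D d.fst) z := by
  unfold side; rw [P.faceStep₂_fst, hP.triangulation.faceStep₂_snd]

theorem isInner_or (d : G.Dart) : P.IsInner d ∨ P.IsInner d.symm := by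
  by_contra! h
  unfold IsInner at h
  push Not at h
  exact hP.triangulation.leftFace_symm_ne d (h.2.trans h.1.symm)

theorem triArea_neg {d : G.Dart} (hd : ¬ P.IsInner d) : P.triArea D d < 0 := by
  classical
  have : Fintype V := Fintype.ofFinite V
  have : Fintype P.Face := Fintype.ofFinite _
  have h := P.sum_faceArea_eq_zero D
  unfold IsInner at hd
  push Not at hd
  have ha : ∀ e, P.faceArea D (P.leftFace e) = P.triArea D e / 2 :=
    hP.triangulation.faceArea_leftFace D
  rw [← Finset.add_sum_erase _ _ (Finset.mem_univ (P.leftFace d)), ha] at h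
  have hpos : 0 < ∑ f ∈ Finset.univ.erase (P.leftFace d), P.faceArea D f := by
    refine Finset.sum_pos (fun f hf => ?_) ⟨P.leftFace d.symm, Finset.mem_erase.2
      ⟨hP.triangulation.leftFace_symm_ne d, Finset.mem_univ _⟩⟩
    obtain ⟨e, rfl⟩ := P.exists_leftFace_eq f
    rw [ha]
    exact half_pos (hP.triArea_pos e fun he => (Finset.ne_of_mem_erase hf) (he.trans hd.symm))
  linarith

theorem triArea_ne_zero (d : G.Dart) : P.triArea D d ≠ 0 := by
  by_cases h : P.IsInner d
  · exact (hP.triArea_pos d h).ne'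
  · exact (hP.triArea_neg h).ne

theorem ne_of_dart (d : G.Dart) : D d.fst ≠ D d.snd := by
  intro h
  refine hP.triArea_ne_zero d ?_
  unfold triArea dblArea
  rw [h]; ring

theorem exists_generic {U : Set ℂ} (hU : IsOpen U) {z₀ : ℂ} (hz₀ : z₀ ∈ U) :
    ∃ z ∈ U, InGeneralPosition G D z :=
  exists_inGeneralPosition_mem hP.ne_of_dart hU hz₀

theorem openTri_faceStep (d : G.Dart) : P.openTri D (faceStep P.rot d) = P.openTri D d := by
  ext z
  simp only [openTri, Set.mem_ofPred_eq, hP.triangulation d]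
  tauto

theorem openTri_eq_of_leftFace_eq {d e : G.Dart} (h : P.leftFace e = P.leftFace d) :
    P.openTri D e = P.openTri D d := by
  rcases hP.triangulation.leftFace_eq_iff.1 h with rfl | rfl | rfl <;>
    simp only [hP.openTri_faceStep]

theorem rayCross_inner_face {z : ℂ} (hz : InGeneralPosition G D z) {d : G.Dart}
    (hd : P.IsInner d) :
    0 ≤ rayCross z (D d.fst) (D d.snd) + rayCross z (D d.snd) (D (P.apex d)) +
      rayCross z (D (P.apex d)) (D d.fst) ∧
    (z ∈ P.openTri D d → rayCross z (D d.fst) (D d.snd) + rayCross z (D d.snd) (D (P.apex d)) +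
      rayCross z (D (P.apex d)) (D d.fst) = 1) := by
  have h2 := hz.2 (faceStep P.rot d)
  have h3 := hz.2 (faceStep P.rot (faceStep P.rot d))
  change side D _ z ≠ 0 at h2 h3
  rw [side_next_eq] at h2
  rw [hP.side_next₂_eq] at h3
  rw [rayCross_triangle (hP.triArea_pos d hd) (hz.1 _) (hz.1 _) (hz.1 _) (hz.2 d) h2 h3]
  refine ⟨by split_ifs <;> norm_num, fun h => if_pos ⟨h.1, ?_, ?_⟩⟩
  · have := h.2.1
    rwa [side_next_eq] at this
  · have := h.2.2
    rwa [hP.side_next₂_eq] at this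

theorem rayCross_outer_face {z : ℂ} (hz : InGeneralPosition G D z) {d : G.Dart}
    (hd : ¬ P.IsInner d) :
    -1 ≤ rayCross z (D d.fst) (D d.snd) + rayCross z (D d.snd) (D (P.apex d)) +
      rayCross z (D (P.apex d)) (D d.fst) ∧
    (rayCross z (D d.fst) (D d.snd) + rayCross z (D d.snd) (D (P.apex d)) +
      rayCross z (D (P.apex d)) (D d.fst) < 0 → side D d z < 0) := by
  have h2 := hz.2 (faceStep P.rot d)
  have h3 := hz.2 (faceStep P.rot (faceStep P.rot d))
  change side D _ z ≠ 0 at h2 h3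
  rw [side_next_eq] at h2
  rw [hP.side_next₂_eq] at h3
  rw [rayCross_triangle_neg (hP.triArea_neg hd) (hz.1 _) (hz.1 _) (hz.1 _) (hz.2 d) h2 h3]
  refine ⟨by split_ifs <;> norm_num, fun h => ?_⟩
  split_ifs at h with h1
  · exact h1.1
  · exact absurd h (lt_irrefl _)

/-- A point in general position in an inner triangle is in no other inner triangle, and it is on
the inner side of the outer triangle: the crossing numbers of all faces add up to zero, and only the
outer face has a negative crossing number. -/
theorem unique_of_generic {z : ℂ} (hz : InGeneralPosition G D z) {d : G.Dart} (hd : P.IsInner d)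
    (hzd : z ∈ P.openTri D d) :
    (∀ e, P.IsInner e → z ∈ P.openTri D e → P.leftFace e = P.leftFace d) ∧
    ∀ o, ¬ P.IsInner o → side D o z < 0 := by
  classical
  have : Fintype V := Fintype.ofFinite V
  have : Fintype P.Face := Fintype.ofFinite _
  set W : P.Face → ℝ := fun f => ∑ e with P.leftFace e = f, rayCross z (D e.fst) (D e.snd) with hW
  have hsum : ∑ f, W f = 0 :=
    sum_faces_eq_zero (g := fun e => rayCross z (D e.fst) (D e.snd)) fun d => rayCross_swap _ _ _
  have hWd : ∀ e, W (P.leftFace e) = rayCross z (D e.fst) (D e.snd) +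
      rayCross z (D e.snd) (D (P.apex e)) + rayCross z (D (P.apex e)) (D e.fst) := by
    intro e
    simp only [hW]
    rw [hP.triangulation.sum_leftFace_eq, P.faceStep₂_fst, hP.triangulation.faceStep₂_snd,
      P.faceStep_fst]
    rfl
  obtain ⟨o, ho⟩ := P.exists_leftFace_eq P.outerFace
  have hinner : ∀ f, f ≠ P.outerFace → 0 ≤ W f := by
    intro f hf
    obtain ⟨e, rfl⟩ := P.exists_leftFace_eq f
    rw [hWd]
    exact (hP.rayCross_inner_face hz hf).1
  have hone : ∀ e, P.IsInner e → z ∈ P.openTri D e → W (P.leftFace e) = 1 := by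
    intro e he hze
    rw [hWd]
    exact (hP.rayCross_inner_face hz he).2 hze
  have hWo : ∀ o, ¬ P.IsInner o → -1 ≤ W P.outerFace ∧ (W P.outerFace < 0 → side D o z < 0) := by
    intro o ho
    have := hP.rayCross_outer_face hz ho
    unfold IsInner at ho
    push Not at ho
    rwa [← hWd, ho] at this
  have hge : -1 ≤ W P.outerFace := (hWo o fun h => h ho).1
  rw [← Finset.add_sum_erase _ _ (Finset.mem_univ P.outerFace)] at hsum
  have hnn : ∀ f ∈ Finset.univ.erase P.outerFace, 0 ≤ W f := fun f hf =>
    hinner f (Finset.ne_of_mem_erase hf)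
  have hmem : ∀ e, P.IsInner e → P.leftFace e ∈ Finset.univ.erase P.outerFace := fun e he =>
    Finset.mem_erase.2 ⟨he, Finset.mem_univ _⟩
  constructor
  · intro e he hze
    by_contra hne
    have h2 := Finset.sum_le_sum_of_subset_of_nonneg
      (s := {P.leftFace d, P.leftFace e}) (t := Finset.univ.erase P.outerFace) (f := W) (by
        intro f hf
        rcases Finset.mem_insert.1 hf with rfl | hf
        · exact hmem d hd
        · rw [Finset.mem_singleton.1 hf]; exact hmem e he) fun f hf _ => hnn f hf
    rw [Finset.sum_pair (Ne.symm hne), hone d hd hzd, hone e he hze] at h2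
    linarith
  · intro o ho
    have h2 := Finset.single_le_sum hnn (hmem d hd)
    rw [hone d hd hzd] at h2
    exact (hWo o ho).2 (by linarith)

theorem leftFace_eq_of_mem {z : ℂ} {d e : G.Dart} (hd : P.IsInner d) (he : P.IsInner e)
    (hzd : z ∈ P.openTri D d) (hze : z ∈ P.openTri D e) : P.leftFace e = P.leftFace d := by
  obtain ⟨y, hy, hyg⟩ := hP.exists_generic ((isOpen_openTri d).inter (isOpen_openTri e))
    (show z ∈ P.openTri D d ∩ P.openTri D e from ⟨hzd, hze⟩)
  exact (hP.unique_of_generic hyg hd hy.1).1 e he hy.2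

theorem side_outer_nonpos_of_mem {z : ℂ} {d o : G.Dart} (hd : P.IsInner d) (ho : ¬ P.IsInner o)
    (hzd : z ∈ P.openTri D d) : side D o z ≤ 0 := by
  by_contra! hcon
  obtain ⟨y, hy, hyg⟩ := hP.exists_generic ((isOpen_openTri d).inter
    (isOpen_lt continuous_const (continuous_dblArea (D o.fst) (D o.snd))))
    (show z ∈ P.openTri D d ∩ {y | 0 < dblArea (D o.fst) (D o.snd) y} from ⟨hzd, hcon⟩)
  exact absurd ((hP.unique_of_generic hyg hd hy.1).2 o ho) (not_lt.2 (le_of_lt hy.2))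

end IsPositive

end PlaneGraph

/-! ### Positive drawings are planar -/

theorem eventually_lineMap_mem {U : Set ℂ} (hU : IsOpen U) {p : ℂ} (hp : p ∈ U) (z : ℂ) :
    ∀ᶠ t : ℝ in 𝓝[>] 0, p + (t : ℂ) * (z - p) ∈ U := by
  have hc : Continuous fun t : ℝ => p + (t : ℂ) * (z - p) := by fun_prop
  exact nhdsWithin_le_nhds (hc.continuousAt.eventually_mem (hU.mem_nhds (by simpa using hp)))

theorem eventually_Ioo : ∀ᶠ t : ℝ in 𝓝[>] 0, 0 < t ∧ t < 1 :=
  Ioo_mem_nhdsGT one_pos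

/-- The point that divides the segment of the dart `d` in the ratio `s : 1 - s`. -/
def edgePoint {V : Type*} {G : SimpleGraph V} (D : V → ℂ) (d : G.Dart) (s : ℝ) : ℂ :=
  D d.fst + (s : ℂ) * (D d.snd - D d.fst)

theorem edgePoint_symm {V : Type*} {G : SimpleGraph V} (D : V → ℂ) (d : G.Dart) (s : ℝ) :
    edgePoint D d.symm s = edgePoint D d (1 - s) := by
  unfold edgePoint
  change D d.snd + (s : ℂ) * (D d.fst - D d.snd) = _
  push_cast
  ring

theorem mem_segment_cases {V : Type*} {G : SimpleGraph V} {D : V → ℂ} {d : G.Dart} {p : ℂ}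
    (hp : p ∈ segment ℝ (D d.fst) (D d.snd)) :
    p = D d.fst ∨ p = D d.snd ∨ ∃ s : ℝ, 0 < s ∧ s < 1 ∧ p = edgePoint D d s := by
  rw [segment_eq_image'] at hp
  obtain ⟨s, ⟨h0, h1⟩, rfl⟩ := hp
  rcases h0.eq_or_lt with rfl | h0
  · exact Or.inl (by simp)
  · rcases h1.eq_or_lt with rfl | h1
    · exact Or.inr (Or.inl (by simp))
    · exact Or.inr (Or.inr ⟨s, h0, h1, by simp [edgePoint]⟩)

theorem edgePoint_mem_segment {V : Type*} {G : SimpleGraph V} {D : V → ℂ} {d : G.Dart} {s : ℝ}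
    (h0 : 0 ≤ s) (h1 : s ≤ 1) : edgePoint D d s ∈ segment ℝ (D d.fst) (D d.snd) := by
  rw [segment_eq_image']
  exact ⟨s, ⟨h0, h1⟩, by simp [edgePoint]⟩

namespace PlaneGraph

variable {V : Type*} [Finite V] {G : SimpleGraph V} {P : PlaneGraph G} {D : V → ℂ}

theorem lineMap_mem_openTri {d : G.Dart} {p z : ℂ} (hp : p ∈ P.closedTri D d)
    (hz : z ∈ P.openTri D d) {t : ℝ} (h0 : 0 < t) (h1 : t < 1) :
    p + (t : ℂ) * (z - p) ∈ P.openTri D d := by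
  have key : ∀ e : G.Dart, 0 ≤ side D e p → 0 < side D e z →
      0 < side D e (p + (t : ℂ) * (z - p)) := by
    intro e h2 h3
    unfold side at *
    rw [dblArea_lineMap]
    have := mul_nonneg (sub_nonneg.2 h1.le) h2
    have := mul_pos h0 h3
    linarith
  exact ⟨key _ hp.1 hz.1, key _ hp.2.1 hz.2.1, key _ hp.2.2 hz.2.2⟩

/-- All darts at `x` have inner faces on their left. -/
def IsInnerVertex (P : PlaneGraph G) (x : V) : Prop := ∀ d : G.Dart, d.fst = x → P.IsInner d

theorem exists_outer_of_not_isInnerVertex {x : V} (hx : ¬ P.IsInnerVertex x) :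
    ∃ o : G.Dart, o.fst = x ∧ P.leftFace o = P.outerFace := by
  unfold IsInnerVertex IsInner at hx
  push Not at hx
  exact hx

namespace IsPositive

variable (hP : P.IsPositive D)
include hP

theorem side_rot (d : G.Dart) (z : ℂ) :
    side D (faceStep P.rot (faceStep P.rot d)) z = - side D (P.rot d) z := by
  rw [hP.triangulation.rot_eq, side_symm, neg_neg]

theorem side_edgePoint (d : G.Dart) (s : ℝ) : side D d (edgePoint D d s) = 0 ∧
    side D (faceStep P.rot d) (edgePoint D d s) = (1 - s) * P.triArea D d ∧
    side D (faceStep P.rot (faceStep P.rot d)) (edgePoint D d s) = s * P.triArea D d := by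
  rw [side_next_eq, hP.side_next₂_eq]
  unfold side edgePoint triArea
  simp only [dblArea_lineMap]
  unfold dblArea
  refine ⟨?_, ?_, ?_⟩ <;> ring

theorem edgePoint_mem_closedTri {d : G.Dart} (hd : P.IsInner d) {s : ℝ} (h0 : 0 ≤ s)
    (h1 : s ≤ 1) : edgePoint D d s ∈ P.closedTri D d := by
  obtain ⟨e1, e2, e3⟩ := hP.side_edgePoint d s
  have := hP.triArea_pos d hd
  exact ⟨e1.ge, by rw [e2]; exact mul_nonneg (by linarith) this.le,
    by rw [e3]; exact mul_nonneg h0 this.le⟩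

theorem fst_mem_closedTri {d : G.Dart} (hd : P.IsInner d) : D d.fst ∈ P.closedTri D d := by
  simpa [edgePoint] using hP.edgePoint_mem_closedTri hd le_rfl zero_le_one

theorem exists_mem_openTri {d : G.Dart} (hd : P.IsInner d) : ∃ z, z ∈ P.openTri D d := by
  have h := hP.triArea_pos d hd
  refine ⟨((1 / 3 : ℝ) : ℂ) * (D d.fst + D d.snd + D (P.apex d)), ?_, ?_, ?_⟩
  · unfold side
    unfold triArea at h
    simp only [dblArea, Complex.re_ofReal_mul, Complex.im_ofReal_mul, Complex.add_re,
      Complex.add_im] at *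
    linarith
  · rw [side_next_eq]
    unfold triArea at h
    simp only [dblArea, Complex.re_ofReal_mul, Complex.im_ofReal_mul, Complex.add_re,
      Complex.add_im] at *
    linarith
  · rw [hP.side_next₂_eq]
    unfold triArea at h
    simp only [dblArea, Complex.re_ofReal_mul, Complex.im_ofReal_mul, Complex.add_re,
      Complex.add_im] at *
    linarith

theorem exists_isInner_fst (x : V) : ∃ d : G.Dart, d.fst = x ∧ P.IsInner d := by
  obtain ⟨d, e, hd, he, hde⟩ := hP.exists_dart x
  by_cases h1 : P.IsInner d
  · exact ⟨d, hd, h1⟩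
  · by_cases h2 : P.IsInner e
    · exact ⟨e, he, h2⟩
    · unfold IsInner at h1 h2
      push Not at h1 h2
      exact absurd (hP.triangulation.eq_of_leftFace_eq (h1.trans h2.symm) (hd.trans he.symm)) hde

/-- Close to the tail of `d`, the cone between `d` and the next dart lies in the triangle to the
left of `d`. -/
theorem eventually_mem_openTri {d : G.Dart} (hd : P.IsInner d) {z : ℂ} (h1 : 0 < side D d z)
    (h2 : side D (P.rot d) z < 0) :
    ∀ᶠ t : ℝ in 𝓝[>] 0, D d.fst + (t : ℂ) * (z - D d.fst) ∈ P.openTri D d := by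
  have h3 : D d.fst ∈ {y | 0 < side D (faceStep P.rot d) y} := by
    have := (hP.side_edgePoint d 0).2.1
    simp only [edgePoint, Complex.ofReal_zero, zero_mul, add_zero, sub_zero, one_mul] at this
    rw [Set.mem_ofPred_eq, this]
    exact hP.triArea_pos d hd
  filter_upwards [self_mem_nhdsWithin,
    eventually_lineMap_mem (isOpen_lt continuous_const (continuous_dblArea _ _)) h3 z] with t ht h4
  have ht : 0 < t := ht
  have h5 : side D (P.rot d) (D d.fst) = 0 := by
    rw [← P.rot_fst d]; exact side_fst _
  refine ⟨?_, h4, ?_⟩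
  · have h6 := side_fst (D := D) d
    unfold side at h6 h1 ⊢
    rw [dblArea_lineMap, h6, mul_zero, zero_add]
    exact mul_pos ht h1
  · rw [hP.side_rot]
    unfold side at h5 h2 ⊢
    rw [dblArea_lineMap, h5, mul_zero, zero_add]
    have := mul_neg_of_pos_of_neg ht h2
    linarith

/-- The triangles around an inner vertex cover all directions: otherwise all darts at the vertex
would be on one side of a line, and each would be followed by one of larger slope. -/
theorem exists_cone {x : V} (hx : P.IsInnerVertex x) {z : ℂ}
    (hz : ∀ d : G.Dart, d.fst = x → side D d z ≠ 0) :
    ∃ d : G.Dart, d.fst = x ∧ 0 < side D d z ∧ side D (P.rot d) z < 0 := by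
  by_contra! hcon
  obtain ⟨d₀, -, hd₀, -, -⟩ := hP.exists_dart x
  have hrot : ∀ d : G.Dart, d.fst = x → (P.rot d).fst = x := fun d hd => (P.rot_fst d).trans hd
  have hstep : ∀ d : G.Dart, d.fst = x → 0 < side D d z → 0 < side D (P.rot d) z := fun d hd h =>
    lt_of_le_of_ne (hcon d hd h) (hz _ (hrot d hd)).symm
  have hprod : ∀ d : G.Dart, d.fst = x → 0 < side D d z * side D (P.rot d) z := by
    intro d hd
    by_cases h : 0 < side D d z
    · exact mul_pos h (hstep d hd h)
    · refine mul_pos_of_neg_of_neg (lt_of_le_of_ne (not_lt.1 h) (hz d hd)) ?_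
      refine lt_of_le_of_ne (not_lt.1 fun h' => h ?_) (hz _ (hrot d hd))
      obtain ⟨n, hn⟩ := (P.rot_sameCycle (P.rot d) d (P.rot_fst d)).exists_nat_pow_eq
      have : ∀ n : ℕ, ((P.rot ^ n) (P.rot d)).fst = x ∧ 0 < side D ((P.rot ^ n) (P.rot d)) z := by
        intro n
        induction n with
        | zero => exact ⟨hrot d hd, h'⟩
        | succ n ih =>
          rw [pow_succ', Equiv.Perm.mul_apply]
          exact ⟨hrot _ ih.1, hstep _ ih.1 ih.2⟩
      rw [← hn]
      exact (this n).2
  set κ : G.Dart → ℝ := fun d => ((D d.snd - D x).re * (z - D x).re +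
    (D d.snd - D x).im * (z - D x).im) / side D d z with hκ
  obtain ⟨d, hd, hmax⟩ := Set.exists_max_image {d : G.Dart | d.fst = x} κ (Set.toFinite _)
    ⟨d₀, hd₀⟩
  have hd : d.fst = x := hd
  have hle := hmax (P.rot d) (hrot d hd)
  have hA := hP.triArea_pos d (hx d hd)
  have hp := hprod d hd
  have h1 := hz d hd
  have h2 := hz _ (hrot d hd)
  have hz2 : 0 < (z - D x).re ^ 2 + (z - D x).im ^ 2 := by
    by_contra! hc
    have hre : (z - D x).re = 0 := by
      nlinarith [sq_nonneg (z - D x).re, sq_nonneg (z - D x).im]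
    have him : (z - D x).im = 0 := by
      nlinarith [sq_nonneg (z - D x).re, sq_nonneg (z - D x).im]
    apply h1
    unfold side dblArea
    rw [hd, ← Complex.sub_re z, ← Complex.sub_im z, hre, him]
    ring
  have key : κ (P.rot d) - κ d = P.triArea D d * ((z - D x).re ^ 2 + (z - D x).im ^ 2) /
      (side D d z * side D (P.rot d) z) := by
    simp only [hκ]
    rw [div_sub_div _ _ h2 h1, mul_comm (side D d z) (side D (P.rot d) z)]
    congr 1
    unfold triArea side dblArea
    rw [hd, hrot d hd, hP.triangulation.rot_snd]
    simp only [Complex.sub_re, Complex.sub_im]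
    ring
  have : 0 < κ (P.rot d) - κ d := by
    rw [key]; exact div_pos (mul_pos hA hz2) hp
  linarith

/-- The only inner triangles that contain the position of an inner vertex are those incident to
this vertex. -/
theorem exists_fst_eq_of_mem_closedTri {x : V} (hx : P.IsInnerVertex x) {e : G.Dart}
    (he : P.IsInner e) (hxe : D x ∈ P.closedTri D e) :
    ∃ d : G.Dart, d.fst = x ∧ P.leftFace d = P.leftFace e := by
  obtain ⟨z₀, hz₀⟩ := hP.exists_mem_openTri he
  obtain ⟨z, hz, hzg⟩ := hP.exists_generic (isOpen_openTri e) hz₀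
  obtain ⟨d, hd, h1, h2⟩ := hP.exists_cone hx (z := z) fun d _ => hzg.2 d
  have h3 := hP.eventually_mem_openTri (hx d hd) h1 h2
  rw [hd] at h3
  obtain ⟨t, h4, h5, h6⟩ := (h3.and eventually_Ioo).exists
  exact ⟨d, hd, hP.leftFace_eq_of_mem he (hx d hd) (lineMap_mem_openTri hxe hz h5 h6) h4⟩

/-- The only inner triangles that contain an interior point of an inner edge are those incident to
this edge. -/
theorem leftFace_eq_of_edgePoint_mem {d : G.Dart} (hd : P.IsInner d) (hd' : P.IsInner d.symm)
    {s : ℝ} (h0 : 0 < s) (h1 : s < 1) {e : G.Dart} (he : P.IsInner e)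
    (hp : edgePoint D d s ∈ P.closedTri D e) :
    P.leftFace e = P.leftFace d ∨ P.leftFace e = P.leftFace d.symm := by
  obtain ⟨z₀, hz₀⟩ := hP.exists_mem_openTri he
  obtain ⟨z, hz, hzg⟩ := hP.exists_generic (isOpen_openTri e) hz₀
  -- The open half-disc at the edge point on the side of `z` lies in the triangle on that side.
  have key : ∀ (d : G.Dart) (s : ℝ), P.IsInner d → 0 < s → s < 1 →
      edgePoint D d s ∈ P.closedTri D e → 0 < side D d z → P.leftFace e = P.leftFace d := by
    intro d s hd h0 h1 hp hzd
    obtain ⟨e1, e2, e3⟩ := hP.side_edgePoint d s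
    have hA := hP.triArea_pos d hd
    have o1 := eventually_lineMap_mem (U := {y | 0 < side D (faceStep P.rot d) y})
      (isOpen_lt continuous_const (continuous_dblArea _ _)) (p := edgePoint D d s)
      (by rw [Set.mem_ofPred_eq, e2]; exact mul_pos (by linarith) hA) z
    have o2 := eventually_lineMap_mem (U := {y | 0 < side D (faceStep P.rot (faceStep P.rot d)) y})
      (isOpen_lt continuous_const (continuous_dblArea _ _)) (p := edgePoint D d s)
      (by rw [Set.mem_ofPred_eq, e3]; exact mul_pos h0 hA) z
    obtain ⟨t, h2, h3, h4, h5⟩ := (o1.and (o2.and eventually_Ioo)).exists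
    refine hP.leftFace_eq_of_mem hd he ⟨?_, h2, h3⟩ (lineMap_mem_openTri hp hz h4 h5)
    unfold side at e1 hzd ⊢
    rw [dblArea_lineMap, e1, mul_zero, zero_add]
    exact mul_pos h4 hzd
  rcases lt_or_gt_of_ne (hzg.2 d) with h | h
  · right
    refine key d.symm (1 - s) hd' (by linarith) (by linarith) ?_ ?_
    · rw [edgePoint_symm, sub_sub_cancel]; exact hp
    · rw [side_symm]; exact neg_pos.2 h
  · exact Or.inl (key d s hd h0 h1 hp h)

theorem eq_of_position_eq {d e : G.Dart} (h : P.leftFace e = P.leftFace d)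
    (hD : D e.fst = D d.fst) : e = d := by
  rcases hP.triangulation.leftFace_eq_iff.1 h with h | h | h
  · exact h
  · rw [h, P.faceStep_fst] at hD
    exact absurd hD.symm (hP.ne_of_dart d)
  · have := hP.ne_of_dart (faceStep P.rot (faceStep P.rot d))
    rw [hP.triangulation.faceStep₂_snd, ← h] at this
    exact absurd hD this

theorem position_ne_edgePoint {d e : G.Dart} (h : P.leftFace e = P.leftFace d) {s : ℝ}
    (h0 : 0 < s) (h1 : s < 1) : D e.fst ≠ edgePoint D d s := by
  intro hD
  obtain ⟨e1, e2, e3⟩ := hP.side_edgePoint d s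
  have hA := hP.triArea_ne_zero d
  rw [← hD] at e1 e2 e3
  rcases hP.triangulation.leftFace_eq_iff.1 h with rfl | rfl | rfl
  · have h2 := side_snd (D := D) (faceStep P.rot (faceStep P.rot e))
    rw [hP.triangulation.faceStep₂_snd, e3] at h2
    exact mul_ne_zero h0.ne' hA h2
  · rw [side_fst] at e2
    exact mul_ne_zero (by linarith) hA e2.symm
  · rw [side_fst] at e3
    exact mul_ne_zero h0.ne' hA e3.symm

theorem eq_of_edgePoint_eq {d e : G.Dart} (h : P.leftFace e = P.leftFace d) {s r : ℝ}
    (h0 : 0 < s) (h1 : s < 1) (hp : edgePoint D d s = edgePoint D e r) : e = d := by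
  obtain ⟨-, e2, e3⟩ := hP.side_edgePoint d s
  have hA := hP.triArea_ne_zero d
  have h2 := (hP.side_edgePoint e r).1
  rw [hp] at e2 e3
  rcases hP.triangulation.leftFace_eq_iff.1 h with h | rfl | rfl
  · exact h
  · rw [e2] at h2
    exact absurd h2 (mul_ne_zero (by linarith) hA)
  · rw [e3] at h2
    exact absurd h2 (mul_ne_zero h0.ne' hA)

theorem injective : Function.Injective D := by
  have key : ∀ x y, P.IsInnerVertex x → D x = D y → x = y := by
    intro x y hx hxy
    obtain ⟨e, rfl, hei⟩ := hP.exists_isInner_fst y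
    obtain ⟨d, hd, hde⟩ := hP.exists_fst_eq_of_mem_closedTri hx hei
      (by rw [hxy]; exact hP.fst_mem_closedTri hei)
    rw [← hd, hP.eq_of_position_eq hde (by rw [hd, hxy])]
  intro x y hxy
  by_cases hx : P.IsInnerVertex x
  · exact key x y hx hxy
  · by_cases hy : P.IsInnerVertex y
    · exact (key y x hy hxy.symm).symm
    · obtain ⟨o, rfl, ho⟩ := exists_outer_of_not_isInnerVertex hx
      obtain ⟨o', rfl, ho'⟩ := exists_outer_of_not_isInnerVertex hy
      rw [hP.eq_of_position_eq (ho.trans ho'.symm) hxy]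

theorem position_ne_edgePoint' (x : V) (d : G.Dart) {s : ℝ} (h0 : 0 < s) (h1 : s < 1) :
    D x ≠ edgePoint D d s := by
  intro hD
  have hD' : D x = edgePoint D d.symm (1 - s) := by rw [edgePoint_symm, sub_sub_cancel, hD]
  have h2 : (0 : ℝ) < 1 - s := by linarith
  have h3 : 1 - s < 1 := by linarith
  by_cases hx : P.IsInnerVertex x
  · rcases hP.isInner_or d with hd | hd
    · obtain ⟨e, rfl, hed⟩ := hP.exists_fst_eq_of_mem_closedTri hx hd
        (by rw [hD]; exact hP.edgePoint_mem_closedTri hd h0.le h1.le)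
      exact hP.position_ne_edgePoint hed h0 h1 hD
    · obtain ⟨e, rfl, hed⟩ := hP.exists_fst_eq_of_mem_closedTri hx hd
        (by rw [hD']; exact hP.edgePoint_mem_closedTri hd h2.le h3.le)
      exact hP.position_ne_edgePoint hed h2 h3 hD'
  · obtain ⟨o, rfl, ho⟩ := exists_outer_of_not_isInnerVertex hx
    by_cases hd : P.leftFace d = P.outerFace
    · exact hP.position_ne_edgePoint (ho.trans hd.symm) h0 h1 hD
    · by_cases hd' : P.leftFace d.symm = P.outerFace
      · exact hP.position_ne_edgePoint (ho.trans hd'.symm) h2 h3 hD'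
      · obtain ⟨e, he, hei⟩ := hP.exists_isInner_fst o.fst
        have hmem := hP.fst_mem_closedTri hei
        rw [he, hD] at hmem
        rw [← he] at hD hD'
        rcases hP.leftFace_eq_of_edgePoint_mem hd hd' h0 h1 hei hmem with h | h
        · exact hP.position_ne_edgePoint h h0 h1 hD
        · exact hP.position_ne_edgePoint h h2 h3 hD'

theorem edge_eq_of_edgePoint_eq {d e : G.Dart} {s r : ℝ} (hs0 : 0 < s) (hs1 : s < 1)
    (hr0 : 0 < r) (hr1 : r < 1) (hp : edgePoint D d s = edgePoint D e r) : d.edge = e.edge := by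
  have hs2 : (0 : ℝ) < 1 - s := by linarith
  have hs3 : 1 - s < 1 := by linarith
  have flip : ∀ (d : G.Dart) (s : ℝ), edgePoint D d.symm (1 - s) = edgePoint D d s := fun d s => by
    rw [edgePoint_symm, sub_sub_cancel]
  -- If one of the edges is an inner edge, then a triangle at the other one is incident to it.
  have key : ∀ (d e : G.Dart) (s r : ℝ), 0 < s → s < 1 → 0 < r → r < 1 →
      edgePoint D d s = edgePoint D e r → P.IsInner d → P.IsInner d.symm → d.edge = e.edge := by
    intro d e s r hs0 hs1 hr0 hr1 hp hd hd'
    have key' : ∀ (e : G.Dart) (r : ℝ), 0 < r → r < 1 → edgePoint D d s = edgePoint D e r →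
        P.IsInner e → d.edge = e.edge := by
      intro e r hr0 hr1 hp he
      rcases hP.leftFace_eq_of_edgePoint_mem hd hd' hs0 hs1 he
        (by rw [hp]; exact hP.edgePoint_mem_closedTri he hr0.le hr1.le) with h | h
      · rw [hP.eq_of_edgePoint_eq h hs0 hs1 hp]
      · rw [hP.eq_of_edgePoint_eq h (s := 1 - s) (by linarith) (by linarith)
          ((flip d s).trans hp), SimpleGraph.Dart.edge_symm]
    rcases hP.isInner_or e with he | he
    · exact key' e r hr0 hr1 hp he
    · rw [key' e.symm (1 - r) (by linarith) (by linarith) (hp.trans (flip e r).symm) he,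
        SimpleGraph.Dart.edge_symm]
  by_cases hd : P.IsInner d ∧ P.IsInner d.symm
  · exact key d e s r hs0 hs1 hr0 hr1 hp hd.1 hd.2
  by_cases he : P.IsInner e ∧ P.IsInner e.symm
  · exact (key e d r s hr0 hr1 hs0 hs1 hp.symm he.1 he.2).symm
  have outer : ∀ d : G.Dart, ¬ (P.IsInner d ∧ P.IsInner d.symm) →
      P.leftFace d = P.outerFace ∨ P.leftFace d.symm = P.outerFace := by
    intro d hd
    by_contra! h
    exact hd h
  rcases outer d hd with hd | hd <;> rcases outer e he with he | he
  · rw [hP.eq_of_edgePoint_eq (he.trans hd.symm) hs0 hs1 hp]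
  · rw [← hP.eq_of_edgePoint_eq (he.trans hd.symm) hs0 hs1 (hp.trans (flip e r).symm),
      SimpleGraph.Dart.edge_symm]
  · rw [hP.eq_of_edgePoint_eq (he.trans hd.symm) hs2 hs3 ((flip d s).trans hp),
      SimpleGraph.Dart.edge_symm]
  · have := hP.eq_of_edgePoint_eq (he.trans hd.symm) hs2 hs3
      ((flip d s).trans (hp.trans (flip e r).symm))
    rw [← SimpleGraph.Dart.edge_symm e, this, SimpleGraph.Dart.edge_symm]

theorem vertex_edge {x : V} {d : G.Dart} (hx : D x ∈ segment ℝ (D d.fst) (D d.snd)) :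
    x = d.fst ∨ x = d.snd := by
  rcases mem_segment_cases hx with h | h | ⟨s, h0, h1, h⟩
  · exact Or.inl (hP.injective h)
  · exact Or.inr (hP.injective h)
  · exact absurd h (hP.position_ne_edgePoint' x d h0 h1)

theorem isPlanarDrawing : IsPlanarDrawing G D where
  injective := hP.injective
  vertex_edge _ _ := hP.vertex_edge
  edge_edge := by
    have hmem : ∀ (x : V) (e : G.Dart), D x ∈ segment ℝ (D e.fst) (D e.snd) → x ∈ e.edge := by
      intro x e hx
      rcases hP.vertex_edge hx with h | h
      · rw [h]; exact Sym2.mem_mk_left _ _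
      · rw [h]; exact Sym2.mem_mk_right _ _
    rintro d e hde p ⟨hpd, hpe⟩
    rcases mem_segment_cases hpd with h | h | ⟨s, h0, h1, h⟩
    · subst h
      exact ⟨_, ⟨hmem _ _ hpd, hmem _ _ hpe⟩, rfl⟩
    · subst h
      exact ⟨_, ⟨hmem _ _ hpd, hmem _ _ hpe⟩, rfl⟩
    · rcases mem_segment_cases hpe with h' | h' | ⟨r, h0', h1', h'⟩
      · subst h'
        exact ⟨_, ⟨hmem _ _ hpd, hmem _ _ hpe⟩, rfl⟩
      · subst h'
        exact ⟨_, ⟨hmem _ _ hpd, hmem _ _ hpe⟩, rfl⟩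
      · exact absurd (hP.edge_eq_of_edgePoint_eq h0 h1 h0' h1' (h.symm.trans h')) hde

/-- All vertices are on the inner side of the outer edges. -/
theorem side_outer_nonpos {o : G.Dart} (ho : ¬ P.IsInner o) (x : V) : side D o (D x) ≤ 0 := by
  by_contra! hcon
  obtain ⟨e, rfl, hei⟩ := hP.exists_isInner_fst x
  obtain ⟨z, hz⟩ := hP.exists_mem_openTri hei
  obtain ⟨t, h1, h2, h3⟩ := ((eventually_lineMap_mem (U := {y | 0 < side D o y})
    (isOpen_lt continuous_const (continuous_dblArea _ _)) hcon z).and eventually_Ioo).exists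
  exact absurd (hP.side_outer_nonpos_of_mem hei ho
    (lineMap_mem_openTri (hP.fst_mem_closedTri hei) hz h2 h3)) (not_le.2 h1)

end IsPositive

end PlaneGraph

/-! ### Positive drawings have the cyclic orders and the outer face of the plane graph -/

/-- The cross product of two vectors in the plane. -/
def crossC (z w : ℂ) : ℝ := z.re * w.im - z.im * w.re

/-- The cross product of two vectors in terms of their angles with a third one. -/
theorem exists_crossC_eq_sin {z w₁ w₂ : ℂ} (hz : z ≠ 0) (h₁ : w₁ ≠ 0) (h₂ : w₂ ≠ 0) :
    ∃ c : ℝ, 0 < c ∧ crossC w₁ w₂ = c * Real.sin (ccwAngle z w₂ - ccwAngle z w₁) := by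
  have key : ∀ w : ℂ, (w / z).re = ‖w / z‖ * Real.cos (ccwAngle z w) ∧
      (w / z).im = ‖w / z‖ * Real.sin (ccwAngle z w) := by
    intro w
    unfold ccwAngle toIcoMod
    rw [zsmul_eq_mul, Real.cos_sub_int_mul_two_pi, Real.sin_sub_int_mul_two_pi]
    exact ⟨(Complex.norm_mul_cos_arg _).symm, (Complex.norm_mul_sin_arg _).symm⟩
  have e : ∀ q₁ q₂ : ℂ, crossC (z * q₁) (z * q₂) = (z.re ^ 2 + z.im ^ 2) * crossC q₁ q₂ := by
    intro q₁ q₂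
    simp only [crossC, Complex.mul_re, Complex.mul_im]
    ring
  have hz2 : 0 < z.re ^ 2 + z.im ^ 2 := by
    have := Complex.normSq_pos.2 hz
    rw [Complex.normSq_apply] at this
    linarith
  refine ⟨(z.re ^ 2 + z.im ^ 2) * (‖w₁ / z‖ * ‖w₂ / z‖), ?_, ?_⟩
  · have := norm_pos_iff.2 (div_ne_zero h₁ hz)
    have := norm_pos_iff.2 (div_ne_zero h₂ hz)
    positivity
  · have h := e (w₁ / z) (w₂ / z)
    rw [mul_div_cancel₀ _ hz, mul_div_cancel₀ _ hz] at h
    rw [h, Real.sin_sub]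
    unfold crossC
    rw [(key w₁).1, (key w₁).2, (key w₂).1, (key w₂).2]
    ring

theorem ccwAngle_mem (z w : ℂ) : 0 ≤ ccwAngle z w ∧ ccwAngle z w < 2 * Real.pi := by
  have := toIcoMod_mem_Ico Real.two_pi_pos 0 (Complex.arg (w / z))
  rwa [zero_add] at this

theorem ccwAngle_self {z : ℂ} (hz : z ≠ 0) : ccwAngle z z = 0 := by
  unfold ccwAngle
  rw [div_self hz, Complex.arg_one]
  exact toIcoMod_apply_left _ _

theorem exists_crossC_eq_sin_left {z w : ℂ} (hz : z ≠ 0) (hw : w ≠ 0) :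
    ∃ c : ℝ, 0 < c ∧ crossC z w = c * Real.sin (ccwAngle z w) := by
  simpa [ccwAngle_self hz] using exists_crossC_eq_sin hz hz hw

/-- Vectors with angle `0` are positive multiples of each other. -/
theorem exists_eq_mul_of_ccwAngle_eq_zero {z w : ℂ} (hz : z ≠ 0) (hw : w ≠ 0)
    (h : ccwAngle z w = 0) : ∃ r : ℝ, 0 < r ∧ w = (r : ℂ) * z := by
  refine ⟨‖w / z‖, norm_pos_iff.2 (div_ne_zero hw hz), ?_⟩
  have h1 : Real.cos (Complex.arg (w / z)) = 1 ∧ Real.sin (Complex.arg (w / z)) = 0 := by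
    have e : Complex.arg (w / z) = ccwAngle z w +
        (toIcoDiv Real.two_pi_pos 0 (Complex.arg (w / z)) : ℤ) * (2 * Real.pi) := by
      unfold ccwAngle toIcoMod
      rw [zsmul_eq_mul]; ring
    rw [e, h, zero_add]
    exact ⟨Real.cos_int_mul_two_pi _, by
      have := Real.sin_add_int_mul_two_pi 0 (toIcoDiv Real.two_pi_pos 0 (Complex.arg (w / z)))
      simpa using this⟩
  have h2 : w / z = (‖w / z‖ : ℂ) := by
    apply Complex.ext
    · rw [← Complex.norm_mul_cos_arg, h1.1, mul_one, Complex.ofReal_re]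
    · rw [← Complex.norm_mul_sin_arg, h1.2, mul_zero, Complex.ofReal_im]
  rw [← h2, div_mul_cancel₀ _ hz]

theorem ccwAngle_le_of_crossC_pos {z w₁ w₂ : ℂ} (hz : z ≠ 0) (h₁ : w₁ ≠ 0) (h₂ : w₂ ≠ 0)
    (hpos : 0 < crossC z w₁) (hdir : ccwAngle z w₂ ≠ 0)
    (hcone : ¬ (0 < crossC z w₂ ∧ 0 < crossC w₂ w₁)) : ccwAngle z w₁ ≤ ccwAngle z w₂ := by
  by_contra! hlt
  obtain ⟨c₁, hc₁, e₁⟩ := exists_crossC_eq_sin_left hz h₁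
  obtain ⟨c₂, hc₂, e₂⟩ := exists_crossC_eq_sin_left hz h₂
  obtain ⟨c₃, hc₃, e₃⟩ := exists_crossC_eq_sin hz h₂ h₁
  obtain ⟨a1, a2⟩ := ccwAngle_mem z w₁
  obtain ⟨b1, b2⟩ := ccwAngle_mem z w₂
  have hpi : ccwAngle z w₁ < Real.pi := by
    by_contra! hge
    have := Real.sin_nonpos_of_nonpos_of_neg_pi_le (x := ccwAngle z w₁ - 2 * Real.pi)
      (by linarith) (by linarith)
    rw [Real.sin_sub_two_pi] at this
    have := mul_nonpos_of_nonneg_of_nonpos hc₁.le this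
    linarith
  have h0 : 0 < ccwAngle z w₂ := lt_of_le_of_ne b1 hdir.symm
  refine hcone ⟨?_, ?_⟩
  · rw [e₂]
    exact mul_pos hc₂ (Real.sin_pos_of_pos_of_lt_pi h0 (by linarith))
  · rw [e₃]
    exact mul_pos hc₃ (Real.sin_pos_of_pos_of_lt_pi (by linarith) (by linarith))

theorem ccwAngle_le_of_crossC_nonpos {z w₁ w₂ : ℂ} (hz : z ≠ 0) (h₁ : w₁ ≠ 0) (h₂ : w₂ ≠ 0)
    (hdir : ccwAngle z w₂ ≠ 0) (hnp : crossC z w₂ ≤ 0)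
    (hnn : 0 ≤ crossC w₁ w₂) : ccwAngle z w₁ ≤ ccwAngle z w₂ := by
  by_contra! hlt
  obtain ⟨c₂, hc₂, e₂⟩ := exists_crossC_eq_sin_left hz h₂
  obtain ⟨c₃, hc₃, e₃⟩ := exists_crossC_eq_sin hz h₁ h₂
  obtain ⟨a1, a2⟩ := ccwAngle_mem z w₁
  obtain ⟨b1, b2⟩ := ccwAngle_mem z w₂
  have h0 : 0 < ccwAngle z w₂ := lt_of_le_of_ne b1 hdir.symm
  have hpi : Real.pi ≤ ccwAngle z w₂ := by
    by_contra! hge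
    have := mul_pos hc₂ (Real.sin_pos_of_pos_of_lt_pi h0 hge)
    linarith
  have := mul_neg_of_pos_of_neg hc₃ (Real.sin_neg_of_neg_of_neg_pi_lt
    (x := ccwAngle z w₂ - ccwAngle z w₁) (by linarith) (by linarith))
  linarith

namespace PlaneGraph

variable {V : Type*} [Finite V] {G : SimpleGraph V} {P : PlaneGraph G} {D : V → ℂ}

omit [Finite V] in
theorem crossC_dartVec {d e : G.Dart} (h : e.fst = d.fst) :
    crossC (dartVec D d) (dartVec D e) = side D d (D e.snd) := by
  unfold crossC dartVec side dblArea
  rw [h]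
  simp only [Complex.sub_re, Complex.sub_im]

namespace IsPositive

variable (hP : P.IsPositive D)
include hP

theorem dartVec_ne_zero (d : G.Dart) : dartVec D d ≠ 0 :=
  sub_ne_zero.2 (hP.ne_of_dart d).symm

/-- Different darts with the same tail have different directions. -/
theorem ccwAngle_ne_zero {d e : G.Dart} (h : e.fst = d.fst) (hne : e ≠ d) :
    ccwAngle (dartVec D d) (dartVec D e) ≠ 0 := by
  intro h0
  obtain ⟨r, hr, hre⟩ := exists_eq_mul_of_ccwAngle_eq_zero (hP.dartVec_ne_zero d)
    (hP.dartVec_ne_zero e) h0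
  have key : ∀ d e : G.Dart, e.fst = d.fst → e ≠ d → ∀ r : ℝ, 0 < r → r ≤ 1 →
      dartVec D e = (r : ℂ) * dartVec D d → False := by
    intro d e h hne r hr hr1 hre
    have hmem : D e.snd ∈ segment ℝ (D d.fst) (D d.snd) := by
      have : D e.snd = edgePoint D d r := by
        have : D e.snd = D e.fst + dartVec D e := by unfold dartVec; ring
        rw [this, hre, h]; rfl
      rw [this]
      exact edgePoint_mem_segment hr.le hr1
    rcases hP.vertex_edge hmem with h1 | h1
    · exact e.fst_ne_snd (h.trans h1.symm)
    · exact hne (SimpleGraph.Dart.eq_of_fst_snd h h1)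
  rcases le_or_gt r 1 with h1 | h1
  · exact key d e h hne r hr h1 hre
  · refine key e d h.symm hne.symm r⁻¹ (inv_pos.2 hr) (inv_le_one_of_one_le₀ h1.le) ?_
    rw [hre, ← mul_assoc, ← Complex.ofReal_mul, inv_mul_cancel₀ hr.ne', Complex.ofReal_one, one_mul]

/-- No edge leaves the tail of `d` inside the triangle to the left of `d`. -/
theorem not_mem_cone {d e : G.Dart} (hd : P.IsInner d) (h : e.fst = d.fst)
    (h1 : 0 < side D d (D e.snd)) (h2 : side D (P.rot d) (D e.snd) < 0) : False := by
  obtain ⟨t, ht, ht0, ht1⟩ := ((hP.eventually_mem_openTri hd h1 h2).and eventually_Ioo).exists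
  have ht' : edgePoint D e t ∈ P.openTri D d := by
    unfold edgePoint; rw [h]; exact ht
  have key : ∀ (e : G.Dart) (t : ℝ), 0 < t → t < 1 → edgePoint D e t ∈ P.openTri D d →
      P.IsInner e → False := by
    intro e t ht0 ht1 ht hei
    obtain ⟨z, hz⟩ := hP.exists_mem_openTri hei
    obtain ⟨r, h3, h4, h5⟩ :=
      ((eventually_lineMap_mem (isOpen_openTri d) ht z).and eventually_Ioo).exists
    have h6 := hP.leftFace_eq_of_mem hd hei h3
      (lineMap_mem_openTri (hP.edgePoint_mem_closedTri hei ht0.le ht1.le) hz h4 h5)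
    rw [← hP.openTri_eq_of_leftFace_eq h6] at ht
    exact absurd (hP.side_edgePoint e t).1 ht.1.ne'
  rcases hP.isInner_or e with he | he
  · exact key e t ht0 ht1 ht' he
  · refine key e.symm (1 - t) (by linarith) (by linarith) ?_ he
    rw [edgePoint_symm, sub_sub_cancel]; exact ht'

theorem rot_next (d e : G.Dart) (h : e.fst = d.fst) (hne : e ≠ d) :
    ccwAngle (dartVec D d) (dartVec D (P.rot d)) ≤ ccwAngle (dartVec D d) (dartVec D e) := by
  have hd0 := hP.dartVec_ne_zero d
  have hr0 := hP.dartVec_ne_zero (P.rot d)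
  have he0 := hP.dartVec_ne_zero e
  have hr := P.rot_fst d
  have hdir := hP.ccwAngle_ne_zero h hne
  by_cases hd : P.IsInner d
  · have hA : crossC (dartVec D d) (dartVec D (P.rot d)) = P.triArea D d := by
      rw [crossC_dartVec hr, hP.triangulation.rot_snd]; rfl
    refine ccwAngle_le_of_crossC_pos hd0 hr0 he0 (by rw [hA]; exact hP.triArea_pos d hd) hdir ?_
    rintro ⟨h1, h2⟩
    rw [crossC_dartVec h] at h1
    refine hP.not_mem_cone hd h h1 ?_
    rw [← crossC_dartVec (h.trans hr.symm)]
    have : crossC (dartVec D (P.rot d)) (dartVec D e) =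
        - crossC (dartVec D e) (dartVec D (P.rot d)) := by unfold crossC; ring
    linarith
  · refine ccwAngle_le_of_crossC_nonpos hd0 hr0 he0 hdir ?_ ?_
    · rw [crossC_dartVec h]
      exact hP.side_outer_nonpos hd _
    · have h1 := hP.side_outer_nonpos (o := faceStep P.rot (faceStep P.rot d)) (fun hc => hd (by
        unfold IsInner at hc ⊢
        rwa [P.leftFace_faceStep, P.leftFace_faceStep] at hc)) e.snd
      rw [hP.side_rot] at h1
      rw [crossC_dartVec (h.trans hr.symm)]
      linarith

theorem side_nonpos_of_mem_drawingSet {o : G.Dart} (ho : ¬ P.IsInner o) {z : ℂ}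
    (hz : z ∈ drawingSet G D) : side D o z ≤ 0 := by
  rcases hz with ⟨x, rfl⟩ | hz
  · exact hP.side_outer_nonpos ho x
  · obtain ⟨e, he⟩ := Set.mem_iUnion.1 hz
    rcases mem_segment_cases he with rfl | rfl | ⟨s, h0, h1, rfl⟩
    · exact hP.side_outer_nonpos ho _
    · exact hP.side_outer_nonpos ho _
    · have h2 := hP.side_outer_nonpos ho e.fst
      have h3 := hP.side_outer_nonpos ho e.snd
      unfold side edgePoint at *
      rw [dblArea_lineMap]
      have := mul_nonpos_of_nonneg_of_nonpos (sub_nonneg.2 h1.le) h2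
      have := mul_nonpos_of_nonneg_of_nonpos h0.le h3
      linarith

/-- The normal of an outer edge spans an unbounded ray that avoids the drawing. -/
theorem outer_unbounded (d : G.Dart) (hd : P.leftFace d = P.outerFace) :
    ∀ᶠ ε : ℝ in 𝓝[>] 0, ¬ Bornology.IsBounded (connectedComponentIn (drawingSet G D)ᶜ
      (midpoint ℝ (D d.fst) (D d.snd) + (ε : ℂ) * (Complex.I * dartVec D d))) := by
  have ho : ¬ P.IsInner d := fun h => h hd
  filter_upwards [self_mem_nhdsWithin] with ε hε hb
  have hε : 0 < ε := hε
  set n : ℂ := Complex.I * dartVec D d with hn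
  set p : ℂ := midpoint ℝ (D d.fst) (D d.snd) with hp
  have hn0 : n ≠ 0 := mul_ne_zero Complex.I_ne_zero (hP.dartVec_ne_zero d)
  set ray : ℝ → ℂ := fun s => p + ((ε + s : ℝ) : ℂ) * n with hray
  have hpm : p = D d.fst + ((1 / 2 : ℝ) : ℂ) * (D d.snd - D d.fst) := by
    rw [hp, midpoint_eq_smul_add]
    apply Complex.ext <;> simp <;> ring
  have hside : ∀ s : ℝ, side D d (ray s) = (ε + s) * Complex.normSq (dartVec D d) := by
    intro s
    rw [Complex.normSq_apply]
    simp only [hray, hpm, hn]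
    unfold side dblArea dartVec
    simp only [Complex.add_re, Complex.sub_re, Complex.add_im, Complex.sub_im, Complex.mul_re,
      Complex.mul_im, Complex.I_re, Complex.I_im, Complex.ofReal_re, Complex.ofReal_im]
    ring
  have hsub : ray '' Set.Ici 0 ⊆ connectedComponentIn (drawingSet G D)ᶜ (p + (ε : ℂ) * n) := by
    have hc : Continuous ray := by fun_prop
    refine (isPreconnected_Ici.image ray hc.continuousOn).subset_connectedComponentIn
      ⟨0, Set.mem_Ici.2 le_rfl, by simp [hray]⟩ ?_
    rintro _ ⟨s, hs, rfl⟩ hmem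
    have hs : 0 ≤ s := hs
    have h1 := hP.side_nonpos_of_mem_drawingSet ho hmem
    rw [hside] at h1
    have := mul_pos (show 0 < ε + s by linarith) (Complex.normSq_pos.2 (hP.dartVec_ne_zero d))
    linarith
  obtain ⟨R, hR⟩ := (hb.subset hsub).exists_norm_le
  have hnpos := norm_pos_iff.2 hn0
  have hR0 : 0 ≤ R := (norm_nonneg _).trans (hR _ ⟨0, Set.mem_Ici.2 le_rfl, rfl⟩)
  set s : ℝ := (R + ‖p‖ + 1) / ‖n‖ with hs
  have hs0 : 0 ≤ s := by positivity
  have h1 := hR _ ⟨s, hs0, rfl⟩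
  have h2 : ‖((ε + s : ℝ) : ℂ) * n‖ = (ε + s) * ‖n‖ := by
    rw [norm_mul, Complex.norm_real, Real.norm_of_nonneg (by linarith)]
  have h3 : ‖((ε + s : ℝ) : ℂ) * n‖ ≤ ‖ray s‖ + ‖p‖ := by
    have : ((ε + s : ℝ) : ℂ) * n = ray s - p := by simp only [hray]; ring
    rw [this]
    exact norm_sub_le _ _
  have h4 : s * ‖n‖ = R + ‖p‖ + 1 := by rw [hs, div_mul_cancel₀ _ hnpos.ne']
  have h5 := mul_pos hε hnpos
  rw [h2, add_mul] at h3
  linarith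

theorem isEquivalentPlanarDrawing : P.IsEquivalentPlanarDrawing D where
  planar := hP.isPlanarDrawing
  rot_next := hP.rot_next
  outer_unbounded := hP.outer_unbounded

end IsPositive

end PlaneGraph

/-! ### Double paths -/

/-- In a double path with paths of lengths `m` and `n`, the vertices `Sum.inl i`, `i ≤ m`, form
the first path and the vertices `Sum.inr j`, `j ≤ n`, the second one. -/
def ValidCode (m n : ℕ) : ℕ ⊕ ℕ → Prop
  | .inl i => i ≤ m
  | .inr j => j ≤ n

/-- The adjacency relation of a double path: consecutive vertices of a path are adjacent, and the
two end vertices of each path are adjacent to all vertices of the other path. -/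
def AdjCode (m n : ℕ) : ℕ ⊕ ℕ → ℕ ⊕ ℕ → Prop
  | .inl i, .inl i' => i + 1 = i' ∨ i' + 1 = i
  | .inr j, .inr j' => j + 1 = j' ∨ j' + 1 = j
  | .inl i, .inr j => i = 0 ∨ i = m ∨ j = 0 ∨ j = n
  | .inr j, .inl i => i = 0 ∨ i = m ∨ j = 0 ∨ j = n

/-- The counterclockwise triangles of a double path, in one of its two mirror-symmetric embeddings
in the sphere. -/
def FaceCode (m n : ℕ) : ℕ ⊕ ℕ → ℕ ⊕ ℕ → ℕ ⊕ ℕ → Prop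
  | .inl i, .inl i', .inr j => (j = 0 ∧ i' = i + 1) ∨ (j = n ∧ i = i' + 1)
  | .inl i, .inr j, .inl i' => (j = 0 ∧ i = i' + 1) ∨ (j = n ∧ i' = i + 1)
  | .inr j, .inl i, .inl i' => (j = 0 ∧ i' = i + 1) ∨ (j = n ∧ i = i' + 1)
  | .inr j, .inr j', .inl i => (i = 0 ∧ j' = j + 1) ∨ (i = m ∧ j = j' + 1)
  | .inr j, .inl i, .inr j' => (i = 0 ∧ j = j' + 1) ∨ (i = m ∧ j' = j + 1)
  | .inl i, .inr j, .inr j' => (i = 0 ∧ j' = j + 1) ∨ (i = m ∧ j = j' + 1)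
  | .inl _, .inl _, .inl _ => False
  | .inr _, .inr _, .inr _ => False

theorem FaceCode.rotate {m n : ℕ} {a b c : ℕ ⊕ ℕ} (h : FaceCode m n a b c) :
    FaceCode m n b c a := by
  rcases a with a | a <;> rcases b with b | b <;> rcases c with c | c <;> exact h

theorem FaceCode.unique {m n : ℕ} (hm : 2 ≤ m) (hn : 2 ≤ n) {a b c c' : ℕ ⊕ ℕ}
    (ha : ValidCode m n a) (hb : ValidCode m n b) (hc : ValidCode m n c) (hc' : ValidCode m n c')
    (h : FaceCode m n a b c) (h' : FaceCode m n a b c') : c = c' := by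
  rcases a with a | a <;> rcases b with b | b <;> rcases c with c | c <;> rcases c' with c' | c' <;>
    simp only [FaceCode, ValidCode, Sum.inl.injEq, Sum.inr.injEq, reduceCtorEq] at * <;> omega

theorem FaceCode.of_triangle {m n : ℕ} (hm : 2 ≤ m) (hn : 2 ≤ n) {a b c : ℕ ⊕ ℕ}
    (ha : ValidCode m n a) (hb : ValidCode m n b) (hc : ValidCode m n c) (hab : AdjCode m n a b)
    (hbc : AdjCode m n b c) (hca : AdjCode m n c a) : FaceCode m n a b c ∨ FaceCode m n b a c := by
  rcases a with a | a <;> rcases b with b | b <;> rcases c with c | c <;>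
    simp only [FaceCode, ValidCode, AdjCode] at * <;> omega

/-- The counterclockwise triangles of a double path: `triCode m n s t i` is the triangle over the
`i`-th edge of the first (`s = false`) or the second path with the first (`t = false`) or the last
vertex of the other path as its apex. -/
def triCode (m n : ℕ) : Bool → Bool → ℕ → (ℕ ⊕ ℕ) × (ℕ ⊕ ℕ) × (ℕ ⊕ ℕ)
  | false, false, i => (.inr 0, .inl i, .inl (i + 1))
  | false, true, i => (.inr n, .inl (i + 1), .inl i)
  | true, false, j => (.inl 0, .inr j, .inr (j + 1))
  | true, true, j => (.inl m, .inr (j + 1), .inr j)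

/-- The length of one of the two paths. -/
def pathLength (m n : ℕ) : Bool → ℕ
  | false => m
  | true => n

theorem triCode_spec {m n : ℕ} (s t : Bool) {i : ℕ} (hi : i < pathLength m n s) :
    ValidCode m n (triCode m n s t i).1 ∧ ValidCode m n (triCode m n s t i).2.1 ∧
    ValidCode m n (triCode m n s t i).2.2 ∧
    AdjCode m n (triCode m n s t i).1 (triCode m n s t i).2.1 ∧
    FaceCode m n (triCode m n s t i).1 (triCode m n s t i).2.1 (triCode m n s t i).2.2 := by
  cases s <;> cases t <;> simp [triCode, ValidCode, AdjCode, FaceCode, pathLength] at * <;> omega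

theorem FaceCode.exists_triCode {m n : ℕ} {a b c : ℕ ⊕ ℕ} (ha : ValidCode m n a)
    (hb : ValidCode m n b) (hc : ValidCode m n c) (h : FaceCode m n a b c) :
    ∃ s t i, i < pathLength m n s ∧ (triCode m n s t i = (a, b, c) ∨
      triCode m n s t i = (b, c, a) ∨ triCode m n s t i = (c, a, b)) := by
  rcases a with a | a <;> rcases b with b | b <;> rcases c with c | c <;>
    simp only [FaceCode, ValidCode] at *
  · rcases h with ⟨rfl, rfl⟩ | ⟨rfl, rfl⟩
    · exact ⟨false, false, a, hb, by simp [triCode]⟩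
    · exact ⟨false, true, b, ha, by simp [triCode]⟩
  · rcases h with ⟨rfl, rfl⟩ | ⟨rfl, rfl⟩
    · exact ⟨false, false, c, ha, by simp [triCode]⟩
    · exact ⟨false, true, a, hc, by simp [triCode]⟩
  · rcases h with ⟨rfl, rfl⟩ | ⟨rfl, rfl⟩
    · exact ⟨true, false, b, hc, by simp [triCode]⟩
    · exact ⟨true, true, c, hb, by simp [triCode]⟩
  · rcases h with ⟨rfl, rfl⟩ | ⟨rfl, rfl⟩
    · exact ⟨false, false, b, hc, by simp [triCode]⟩
    · exact ⟨false, true, c, hb, by simp [triCode]⟩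
  · rcases h with ⟨rfl, rfl⟩ | ⟨rfl, rfl⟩
    · exact ⟨true, false, c, ha, by simp [triCode]⟩
    · exact ⟨true, true, a, hc, by simp [triCode]⟩
  · rcases h with ⟨rfl, rfl⟩ | ⟨rfl, rfl⟩
    · exact ⟨true, false, a, hb, by simp [triCode]⟩
    · exact ⟨true, true, b, ha, by simp [triCode]⟩

theorem triCode_injective {m n : ℕ} (hm : 0 < m) (hn : 0 < n) {s t s' t' : Bool} {i i' : ℕ}
    {a b c : ℕ ⊕ ℕ} (h : triCode m n s t i = (a, b, c))
    (h' : triCode m n s' t' i' = (a, b, c) ∨ triCode m n s' t' i' = (b, c, a) ∨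
      triCode m n s' t' i' = (c, a, b)) : s = s' ∧ t = t' ∧ i = i' := by
  cases s <;> cases t <;> cases s' <;> cases t' <;>
    simp only [triCode, Prod.mk.injEq] at h h' <;> obtain ⟨rfl, rfl, rfl⟩ := h <;>
    simp only [Sum.inl.injEq, Sum.inr.injEq, reduceCtorEq, false_and, and_false, or_false,
      true_and] at h' ⊢ <;> omega

/-- `G` is a double path with paths of lengths `m` and `n`; `pt` sends the codes to the vertices. -/
structure IsDoublePath {V : Type*} (G : SimpleGraph V) (pt : ℕ ⊕ ℕ → V) (m n : ℕ) : Prop where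
  two_le_left : 2 ≤ m
  two_le_right : 2 ≤ n
  exists_code : ∀ x, ∃ a, ValidCode m n a ∧ pt a = x
  injOn : ∀ a b, ValidCode m n a → ValidCode m n b → pt a = pt b → a = b
  adj_iff : ∀ a b, ValidCode m n a → ValidCode m n b → (G.Adj (pt a) (pt b) ↔ AdjCode m n a b)

/-- Codes of `3 (m + n)` different edges of a double path. -/
def edgeCode (m n : ℕ) : (Fin m ⊕ Fin n) × Fin 3 → (ℕ ⊕ ℕ) × (ℕ ⊕ ℕ)
  | (.inl i, 0) => (.inl i, .inl (i + 1))
  | (.inl i, 1) => (.inl (i + 1), .inr 0)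
  | (.inl i, 2) => (.inl (i + 1), .inr n)
  | (.inr j, 0) => (.inr j, .inr (j + 1))
  | (.inr j, 1) => (.inl 0, .inr j)
  | (.inr j, 2) => if j.val = 0 then (.inl 0, .inr n) else (.inl m, .inr j)

theorem edgeCode_injective {m n : ℕ} (hm : 2 ≤ m) (hn : 2 ≤ n) :
    Function.Injective (edgeCode m n) := by
  rintro ⟨i | i, k⟩ ⟨j | j, k'⟩ h <;> fin_cases k <;> fin_cases k' <;>
    simp only [edgeCode] at h <;>
    (try split_ifs at h) <;>
    simp only [Prod.mk.injEq, Sum.inl.injEq, Sum.inr.injEq, reduceCtorEq, false_and, and_false] at h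
  all_goals first
    | exact h.elim
    | omega
    | (obtain rfl : i = j := Fin.ext (by omega); rfl)

theorem edgeCode_spec {m n : ℕ} (u : (Fin m ⊕ Fin n) × Fin 3) :
    ValidCode m n (edgeCode m n u).1 ∧ ValidCode m n (edgeCode m n u).2 ∧
    AdjCode m n (edgeCode m n u).1 (edgeCode m n u).2 := by
  rcases u with ⟨i | i, k⟩ <;> have hi := i.isLt <;> fin_cases k <;>
    simp only [edgeCode] <;>
    (try split_ifs) <;> simp [ValidCode, AdjCode]

/-- The codes of edges are increasing pairs in the order in which the first path precedes the
second one. -/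
theorem edgeCode_ne_swap {m n : ℕ} (u v : (Fin m ⊕ Fin n) × Fin 3) :
    edgeCode m n u ≠ (edgeCode m n v).swap := by
  have key : ∀ u, Sum.LiftRel (· < ·) (· < ·) (edgeCode m n u).1 (edgeCode m n u).2 ∨
      ((edgeCode m n u).1.isLeft ∧ (edgeCode m n u).2.isRight) := by
    rintro ⟨i | i, k⟩ <;> fin_cases k <;>
      simp only [edgeCode] <;>
      (try split_ifs) <;> simp
  have h1 := key u
  have h2 := key v
  intro h
  rw [h] at h1
  rcases e : edgeCode m n v with ⟨a | a, b | b⟩ <;> rw [e] at h1 h2 <;> simp at h1 h2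
  all_goals omega

namespace IsDoublePath

variable {V : Type*} {G : SimpleGraph V} {pt : ℕ ⊕ ℕ → V} {m n : ℕ} (hG : IsDoublePath G pt m n)
include hG

theorem card_le [Finite V] : 3 * Nat.card V ≤ Nat.card G.edgeSet + 6 := by
  have : Fintype V := Fintype.ofFinite V
  have hV : Nat.card V ≤ m + 1 + (n + 1) := by
    have : Function.Surjective (fun a : Fin (m + 1) ⊕ Fin (n + 1) =>
        pt (a.map Fin.val Fin.val)) := by
      intro x
      obtain ⟨a, ha, rfl⟩ := hG.exists_code x
      rcases a with a | a
      · exact ⟨.inl ⟨a, Nat.lt_succ_of_le ha⟩, rfl⟩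
      · exact ⟨.inr ⟨a, Nat.lt_succ_of_le ha⟩, rfl⟩
    have := Nat.card_le_card_of_surjective _ this
    simpa using this
  have hE : (m + n) * 3 ≤ Nat.card G.edgeSet := by
    set f : (Fin m ⊕ Fin n) × Fin 3 → G.edgeSet := fun u =>
      ⟨s(pt (edgeCode m n u).1, pt (edgeCode m n u).2),
        (hG.adj_iff _ _ (edgeCode_spec u).1 (edgeCode_spec u).2.1).2 (edgeCode_spec u).2.2⟩ with hf
    have hinj : Function.Injective f := by
      intro u v huv
      have h := congrArg Subtype.val huv
      simp only [hf, Sym2.eq_iff] at h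
      obtain ⟨u1, u2, -⟩ := edgeCode_spec u
      obtain ⟨v1, v2, -⟩ := edgeCode_spec v
      rcases h with ⟨h1, h2⟩ | ⟨h1, h2⟩
      · exact edgeCode_injective hG.two_le_left hG.two_le_right
          (Prod.ext (hG.injOn _ _ u1 v1 h1) (hG.injOn _ _ u2 v2 h2))
      · exact absurd (Prod.ext (hG.injOn _ _ u1 v2 h1) (hG.injOn _ _ u2 v1 h2))
          (edgeCode_ne_swap u v)
    have := Nat.card_le_card_of_injective f hinj
    simpa using this
  omega

/-- Every vertex of a double path has at least three neighbours. -/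
theorem exists_three_darts (x : V) : ∃ d₁ d₂ d₃ : G.Dart, d₁.fst = x ∧ d₂.fst = x ∧ d₃.fst = x ∧
    d₁ ≠ d₂ ∧ d₁ ≠ d₃ ∧ d₂ ≠ d₃ := by
  obtain ⟨a, ha, rfl⟩ := hG.exists_code x
  have hm := hG.two_le_left
  have hn := hG.two_le_right
  have key : ∃ b₁ b₂ b₃ : ℕ ⊕ ℕ, ValidCode m n b₁ ∧ ValidCode m n b₂ ∧ ValidCode m n b₃ ∧
      AdjCode m n a b₁ ∧ AdjCode m n a b₂ ∧ AdjCode m n a b₃ ∧ b₁ ≠ b₂ ∧ b₁ ≠ b₃ ∧ b₂ ≠ b₃ := by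
    rcases a with a | a
    · by_cases h : a = 0 ∨ a = m
      · refine ⟨.inr 0, .inr 1, .inr 2, ?_⟩
        simp [ValidCode, AdjCode] at *
        omega
      · refine ⟨.inr 0, .inr n, .inl (a - 1), ?_⟩
        simp [ValidCode, AdjCode] at *
        omega
    · by_cases h : a = 0 ∨ a = n
      · refine ⟨.inl 0, .inl 1, .inl 2, ?_⟩
        simp [ValidCode, AdjCode] at *
        omega
      · refine ⟨.inl 0, .inl m, .inr (a - 1), ?_⟩
        simp [ValidCode, AdjCode] at *
        omega
  obtain ⟨b₁, b₂, b₃, v₁, v₂, v₃, a₁, a₂, a₃, h₁, h₂, h₃⟩ := key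
  have ne : ∀ {b c} (hb : ValidCode m n b) (hc : ValidCode m n c) (_ : b ≠ c)
      (h : G.Adj (pt a) (pt b)) (h' : G.Adj (pt a) (pt c)),
      (⟨(pt a, pt b), h⟩ : G.Dart) ≠ ⟨(pt a, pt c), h'⟩ := by
    intro b c hb hc hbc h h' he
    exact hbc (hG.injOn _ _ hb hc (congrArg (fun d : G.Dart => d.snd) he))
  exact ⟨⟨(pt a, pt b₁), (hG.adj_iff _ _ ha v₁).2 a₁⟩, ⟨(pt a, pt b₂), (hG.adj_iff _ _ ha v₂).2 a₂⟩,
    ⟨(pt a, pt b₃), (hG.adj_iff _ _ ha v₃).2 a₃⟩, rfl, rfl, rfl, ne v₁ v₂ h₁ _ _,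
    ne v₁ v₃ h₂ _ _, ne v₂ v₃ h₃ _ _⟩

theorem exists_two_darts (x : V) : ∃ d e : G.Dart, d.fst = x ∧ e.fst = x ∧ d ≠ e := by
  obtain ⟨d₁, d₂, -, h1, h2, -, h12, -, -⟩ := hG.exists_three_darts x
  exact ⟨d₁, d₂, h1, h2, h12⟩

theorem isTriangulation [Finite V] (P : PlaneGraph G) : P.IsTriangulation := by
  refine P.isTriangulation_of_card (fun d => ?_) hG.card_le
  obtain ⟨e, e', he, he', hne⟩ := hG.exists_two_darts d.fst
  by_cases h : e = d
  · exact ⟨e', he', fun h' => hne (h.trans h'.symm)⟩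
  · exact ⟨e, he, h⟩

end IsDoublePath

/-! ### The two embeddings of a double path -/

namespace PlaneGraph

variable {V : Type*} [Finite V] {G : SimpleGraph V} {P : PlaneGraph G}

/-- The two triangles at an edge are different if the degrees are at least three. -/
theorem IsTriangulation.apex_symm_ne (hT : P.IsTriangulation)
    (hdeg : ∀ x, ∃ d₁ d₂ d₃ : G.Dart, d₁.fst = x ∧ d₂.fst = x ∧ d₃.fst = x ∧
      d₁ ≠ d₂ ∧ d₁ ≠ d₃ ∧ d₂ ≠ d₃) (d : G.Dart) : P.apex d.symm ≠ P.apex d := by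
  intro h
  have h1 : faceStep P.rot d.symm = P.rot d :=
    SimpleGraph.Dart.eq_of_fst_snd ((P.faceStep_fst _).trans (P.rot_fst d).symm)
      (h.trans (hT.rot_snd d).symm)
  have h2 : P.rot (P.rot d) = d := by
    rw [← h1, faceStep_apply, SimpleGraph.Dart.symm_symm, ← Equiv.Perm.mul_apply, mul_inv_cancel,
      Equiv.Perm.one_apply]
  have h3 : ∀ e : G.Dart, e.fst = d.fst → e = d ∨ e = P.rot d := by
    intro e he
    obtain ⟨k, hk⟩ := (P.rot_sameCycle d e he.symm).exists_nat_pow_eq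
    rw [← hk]
    clear hk
    induction k with
    | zero => exact Or.inl rfl
    | succ k ih =>
      rw [pow_succ', Equiv.Perm.mul_apply]
      rcases ih with ih | ih <;> rw [ih]
      · exact Or.inr rfl
      · exact Or.inl h2
  obtain ⟨d₁, d₂, d₃, e₁, e₂, e₃, n₁, n₂, n₃⟩ := hdeg d.fst
  rcases h3 d₁ e₁ with g1 | g1 <;> rcases h3 d₂ e₂ with g2 | g2 <;> rcases h3 d₃ e₃ with g3 | g3
  · exact n₁ (g1.trans g2.symm)
  · exact n₁ (g1.trans g2.symm)
  · exact n₂ (g1.trans g3.symm)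
  · exact n₃ (g2.trans g3.symm)
  · exact n₃ (g2.trans g3.symm)
  · exact n₂ (g1.trans g3.symm)
  · exact n₁ (g1.trans g2.symm)
  · exact n₁ (g1.trans g2.symm)

/-- A property of darts that is invariant under reversal and under walking around a face holds for
all darts or for none. -/
theorem IsTriangulation.forall_of_invariant (hT : P.IsTriangulation) {A : G.Dart → Prop}
    (h1 : ∀ d, A d → A (faceStep P.rot d)) (h2 : ∀ d, A d → A d.symm) {d₀ : G.Dart} (h0 : A d₀)
    (d : G.Dart) : A d := by
  have hrot : ∀ d, A d → A (P.rot d) := by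
    intro d hd
    rw [hT.rot_eq]
    exact h2 _ (h1 _ (h1 _ hd))
  have hvert : ∀ d e : G.Dart, A d → e.fst = d.fst → A e := by
    intro d e hd he
    obtain ⟨k, rfl⟩ := (P.rot_sameCycle d e he.symm).exists_nat_pow_eq
    clear he
    induction k with
    | zero => exact hd
    | succ k ih =>
      rw [pow_succ', Equiv.Perm.mul_apply]
      exact hrot _ ih
  have hwalk : ∀ {x y : V} (_ : G.Walk x y), (∃ d : G.Dart, d.fst = x ∧ A d) →
      ∃ d : G.Dart, d.fst = y ∧ A d := by
    intro x y w
    induction w with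
    | nil => exact id
    | @cons x y z hxy w ih =>
      rintro ⟨d, hd, hA⟩
      refine ih ⟨(⟨(x, y), hxy⟩ : G.Dart).symm, rfl, h2 _ (hvert d _ hA hd.symm)⟩
  obtain ⟨w⟩ := P.connected.preconnected d₀.fst d.fst
  obtain ⟨e, he, hA⟩ := hwalk w ⟨d₀, rfl, h0⟩
  exact hvert e d hA he.symm

/-- If every triangle of `G` is a facial triangle of a given oriented system `F` of triangles, then
the faces of a triangulation with underlying graph `G` are those of `F`, or all faces are reversed.
-/
theorem IsTriangulation.orientation (hT : P.IsTriangulation)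
    (hdeg : ∀ x, ∃ d₁ d₂ d₃ : G.Dart, d₁.fst = x ∧ d₂.fst = x ∧ d₃.fst = x ∧
      d₁ ≠ d₂ ∧ d₁ ≠ d₃ ∧ d₂ ≠ d₃) {F : V → V → V → Prop}
    (hrot : ∀ x y z, F x y z → F y z x) (huniq : ∀ x y z z', F x y z → F x y z' → z = z')
    (htri : ∀ x y z, G.Adj x y → G.Adj y z → G.Adj z x → F x y z ∨ F y x z) :
    (∀ d, F d.fst d.snd (P.apex d)) ∨ ∀ d, F d.snd d.fst (P.apex d) := by
  have hadj : ∀ d : G.Dart, F d.fst d.snd (P.apex d) ∨ F d.snd d.fst (P.apex d) := by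
    intro d
    refine htri _ _ _ d.adj ?_ ?_
    · have := (faceStep P.rot d).adj
      rwa [P.faceStep_fst] at this
    · have := (faceStep P.rot (faceStep P.rot d)).adj
      rwa [P.faceStep₂_fst, hT.faceStep₂_snd] at this
  have hne := hT.apex_symm_ne hdeg
  by_cases h : ∃ d, F d.fst d.snd (P.apex d)
  · obtain ⟨d₀, h0⟩ := h
    refine Or.inl (hT.forall_of_invariant (A := fun d => F d.fst d.snd (P.apex d)) ?_ ?_ h0)
    · intro d hd
      rw [P.faceStep_fst, hT.apex_faceStep]
      exact hrot _ _ _ hd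
    · intro d hd
      rcases hadj d.symm with h | h
      · exact h
      · exact absurd (huniq _ _ _ _ h hd) (hne d)
  · push Not at h
    exact Or.inr fun d => (hadj d).resolve_left (h d)

end PlaneGraph

/-- Reversing the first path of a double path, which exchanges its two embeddings. -/
def reverseCode (m : ℕ) : ℕ ⊕ ℕ → ℕ ⊕ ℕ
  | .inl i => .inl (m - i)
  | .inr j => .inr j

theorem reverseCode_reverseCode {m n : ℕ} {a : ℕ ⊕ ℕ} (ha : ValidCode m n a) :
    reverseCode m (reverseCode m a) = a := by
  rcases a with a | a
  · exact congrArg Sum.inl (Nat.sub_sub_self ha)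
  · rfl

theorem ValidCode.reverseCode {m n : ℕ} {a : ℕ ⊕ ℕ} (ha : ValidCode m n a) :
    ValidCode m n (reverseCode m a) := by
  rcases a with a | a
  · exact Nat.sub_le _ _
  · exact ha

theorem adjCode_reverseCode {m n : ℕ} {a b : ℕ ⊕ ℕ} (ha : ValidCode m n a) (hb : ValidCode m n b) :
    AdjCode m n (reverseCode m a) (reverseCode m b) ↔ AdjCode m n a b := by
  rcases a with a | a <;> rcases b with b | b <;>
    simp only [AdjCode, ValidCode, reverseCode] at * <;> omega

theorem FaceCode.reverseCode {m n : ℕ} {a b c : ℕ ⊕ ℕ} (ha : ValidCode m n a)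
    (hb : ValidCode m n b) (hc : ValidCode m n c) (h : FaceCode m n a b c) :
    FaceCode m n (reverseCode m b) (reverseCode m a) (reverseCode m c) := by
  rcases a with a | a <;> rcases b with b | b <;> rcases c with c | c <;>
    simp only [FaceCode, ValidCode, _root_.reverseCode] at * <;> omega

theorem IsDoublePath.reverse {V : Type*} {G : SimpleGraph V} {pt : ℕ ⊕ ℕ → V} {m n : ℕ}
    (hG : IsDoublePath G pt m n) : IsDoublePath G (fun a => pt (reverseCode m a)) m n where
  two_le_left := hG.two_le_left
  two_le_right := hG.two_le_right
  exists_code x := by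
    obtain ⟨a, ha, rfl⟩ := hG.exists_code x
    exact ⟨reverseCode m a, ha.reverseCode, congrArg pt (reverseCode_reverseCode ha)⟩
  injOn a b ha hb h := by
    rw [← reverseCode_reverseCode ha, ← reverseCode_reverseCode hb,
      hG.injOn _ _ ha.reverseCode hb.reverseCode h]
  adj_iff a b ha hb :=
    (hG.adj_iff _ _ ha.reverseCode hb.reverseCode).trans (adjCode_reverseCode ha hb)

theorem IsDoublePath.swap {V : Type*} {G : SimpleGraph V} {pt : ℕ ⊕ ℕ → V} {m n : ℕ}
    (hG : IsDoublePath G pt m n) : IsDoublePath G (fun a => pt a.swap) n m := by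
  have hv : ∀ a : ℕ ⊕ ℕ, ValidCode n m a → ValidCode m n a.swap := by
    rintro (a | a) ha <;> exact ha
  refine ⟨hG.two_le_right, hG.two_le_left, fun x => ?_, fun a b ha hb h => ?_,
    fun a b ha hb => ?_⟩
  · obtain ⟨a, ha, rfl⟩ := hG.exists_code x
    refine ⟨a.swap, ?_, by simp⟩
    rcases a with a | a <;> exact ha
  · exact Sum.swap_leftInverse.injective (hG.injOn _ _ (hv a ha) (hv b hb) h)
  · rw [hG.adj_iff _ _ (hv a ha) (hv b hb)]
    rcases a with a | a <;> rcases b with b | b <;>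
      simp only [AdjCode, Sum.swap_inl, Sum.swap_inr] <;> omega

/-- The faces of the plane double path `P` are the triangles `triCode`: the face with index
`s t i` is `Φ s t i`, its vertices are given by `triCode m n s t i` in counterclockwise order. -/
structure FaceLabelling {V : Type*} [Finite V] {G : SimpleGraph V} (P : PlaneGraph G)
    (pt : ℕ ⊕ ℕ → V) (m n : ℕ) (Φ : Bool → Bool → ℕ → P.Face) : Prop where
  faceArea_eq : ∀ (D : V → ℂ) (s t : Bool) (i : ℕ), i < pathLength m n s →
    P.faceArea D (Φ s t i) = dblArea (D (pt (triCode m n s t i).1))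
      (D (pt (triCode m n s t i).2.1)) (D (pt (triCode m n s t i).2.2)) / 2
  injective : ∀ (s t : Bool) (i : ℕ) (s' t' : Bool) (i' : ℕ), i < pathLength m n s →
    i' < pathLength m n s' → Φ s t i = Φ s' t' i' → s = s' ∧ t = t' ∧ i = i'
  surjective : ∀ f, ∃ s t i, i < pathLength m n s ∧ Φ s t i = f

namespace IsDoublePath

variable {V : Type*} [Finite V] {G : SimpleGraph V} {pt : ℕ ⊕ ℕ → V} {m n : ℕ}

theorem exists_faceLabelling_of_faceCode (hG : IsDoublePath G pt m n) (P : PlaneGraph G)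
    (hF : ∀ d, ∃ a b c, ValidCode m n a ∧ ValidCode m n b ∧ ValidCode m n c ∧ pt a = d.fst ∧
      pt b = d.snd ∧ pt c = P.apex d ∧ FaceCode m n a b c) :
    ∃ Φ, FaceLabelling P pt m n Φ := by
  have hT := hG.isTriangulation P
  have hm := hG.two_le_left
  have hn := hG.two_le_right
  have key : ∀ s t i, ∃ f : P.Face, i < pathLength m n s → ∃ d, P.leftFace d = f ∧
      d.fst = pt (triCode m n s t i).1 ∧ d.snd = pt (triCode m n s t i).2.1 ∧
      P.apex d = pt (triCode m n s t i).2.2 := by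
    intro s t i
    by_cases hi : i < pathLength m n s
    · obtain ⟨v1, v2, v3, h12, h123⟩ := triCode_spec (m := m) (n := n) s t hi
      set d : G.Dart := ⟨(_, _), (hG.adj_iff _ _ v1 v2).2 h12⟩ with hd
      obtain ⟨a, b, c, ha, hb, hc, h1, h2, h3, habc⟩ := hF d
      obtain rfl := hG.injOn _ _ ha v1 h1
      obtain rfl := hG.injOn _ _ hb v2 h2
      obtain rfl := habc.unique hm hn ha hb hc v3 h123
      exact ⟨_, fun _ => ⟨d, rfl, rfl, rfl, h3.symm⟩⟩
    · exact ⟨P.outerFace, fun h => absurd h hi⟩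
  choose Φ hΦ using key
  refine ⟨Φ, fun D s t i hi => ?_, fun s t i s' t' i' hi hi' h => ?_, fun f => ?_⟩
  · obtain ⟨d, hd, h1, h2, h3⟩ := hΦ s t i hi
    rw [← hd, hT.faceArea_leftFace, h1, h2, h3]
  · obtain ⟨d, hd, h1, h2, h3⟩ := hΦ s t i hi
    obtain ⟨d', hd', h1', h2', h3'⟩ := hΦ s' t' i' hi'
    obtain ⟨v1, v2, v3, -⟩ := triCode_spec (m := m) (n := n) s t hi
    obtain ⟨v1', v2', v3', -⟩ := triCode_spec (m := m) (n := n) s' t' hi'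
    refine triCode_injective (by omega) (by omega) (a := (triCode m n s t i).1)
      (b := (triCode m n s t i).2.1) (c := (triCode m n s t i).2.2) rfl ?_
    have hdd : P.leftFace d' = P.leftFace d := by rw [hd, hd', h]
    have e2 : (faceStep P.rot d).snd = P.apex d := rfl
    rcases hT.leftFace_eq_iff.1 hdd with e | e | e <;> subst e
    · exact Or.inl (Prod.ext (hG.injOn _ _ v1' v1 (h1'.symm.trans h1))
        (Prod.ext (hG.injOn _ _ v2' v2 (h2'.symm.trans h2))
          (hG.injOn _ _ v3' v3 (h3'.symm.trans h3))))
    · rw [P.faceStep_fst] at h1'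
      rw [hT.apex_faceStep] at h3'
      exact Or.inr (Or.inl (Prod.ext (hG.injOn _ _ v1' v2 (h1'.symm.trans h2))
        (Prod.ext (hG.injOn _ _ v2' v3 (h2'.symm.trans h3))
          (hG.injOn _ _ v3' v1 (h3'.symm.trans h1)))))
    · rw [P.faceStep₂_fst] at h1'
      rw [hT.faceStep₂_snd] at h2'
      rw [hT.apex_faceStep, P.faceStep_fst] at h3'
      exact Or.inr (Or.inr (Prod.ext (hG.injOn _ _ v1' v3 (h1'.symm.trans h3))
        (Prod.ext (hG.injOn _ _ v2' v1 (h2'.symm.trans h1))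
          (hG.injOn _ _ v3' v2 (h3'.symm.trans h2)))))
  · obtain ⟨e, rfl⟩ := P.exists_leftFace_eq f
    obtain ⟨a, b, c, ha, hb, hc, h1, h2, h3, habc⟩ := hF e
    obtain ⟨s, t, i, hi, h⟩ := habc.exists_triCode ha hb hc
    refine ⟨s, t, i, hi, ?_⟩
    obtain ⟨d, hd, g1, g2, -⟩ := hΦ s t i hi
    rw [← hd, hT.leftFace_eq_iff]
    rcases h with h | h | h <;> rw [h] at g1 g2
    · exact Or.inl (SimpleGraph.Dart.eq_of_fst_snd (g1.trans h1) (g2.trans h2))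
    · exact Or.inr (Or.inl (SimpleGraph.Dart.eq_of_fst_snd
        ((g1.trans h2).trans (P.faceStep_fst e).symm) (g2.trans h3)))
    · exact Or.inr (Or.inr (SimpleGraph.Dart.eq_of_fst_snd
        ((g1.trans h3).trans (P.faceStep₂_fst e).symm)
        ((g2.trans h1).trans (hT.faceStep₂_snd e).symm)))

/-- In every plane double path the faces are the triangles `triCode`, if the direction of the first
path is chosen suitably. -/
theorem exists_faceLabelling (hG : IsDoublePath G pt m n) (P : PlaneGraph G) :
    ∃ pt' Φ, IsDoublePath G pt' m n ∧ FaceLabelling P pt' m n Φ := by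
  have hT := hG.isTriangulation P
  have hm := hG.two_le_left
  have hn := hG.two_le_right
  rcases hT.orientation hG.exists_three_darts
    (F := fun x y z => ∃ a b c, ValidCode m n a ∧ ValidCode m n b ∧ ValidCode m n c ∧ pt a = x ∧
      pt b = y ∧ pt c = z ∧ FaceCode m n a b c)
    (by
      rintro x y z ⟨a, b, c, ha, hb, hc, h1, h2, h3, h⟩
      exact ⟨b, c, a, hb, hc, ha, h2, h3, h1, h.rotate⟩)
    (by
      rintro x y z z' ⟨a, b, c, ha, hb, hc, rfl, rfl, rfl, h⟩
        ⟨a', b', c', ha', hb', hc', h1, h2, rfl, h'⟩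
      obtain rfl := hG.injOn _ _ ha' ha h1
      obtain rfl := hG.injOn _ _ hb' hb h2
      rw [h.unique hm hn ha hb hc hc' h'])
    (by
      intro x y z hxy hyz hzx
      obtain ⟨a, ha, rfl⟩ := hG.exists_code x
      obtain ⟨b, hb, rfl⟩ := hG.exists_code y
      obtain ⟨c, hc, rfl⟩ := hG.exists_code z
      rw [hG.adj_iff _ _ ha hb] at hxy
      rw [hG.adj_iff _ _ hb hc] at hyz
      rw [hG.adj_iff _ _ hc ha] at hzx
      rcases FaceCode.of_triangle hm hn ha hb hc hxy hyz hzx with h | h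
      · exact Or.inl ⟨a, b, c, ha, hb, hc, rfl, rfl, rfl, h⟩
      · exact Or.inr ⟨b, a, c, hb, ha, hc, rfl, rfl, rfl, h⟩)
    with h | h
  · obtain ⟨Φ, hΦ⟩ := hG.exists_faceLabelling_of_faceCode P h
    exact ⟨pt, Φ, hG, hΦ⟩
  · obtain ⟨Φ, hΦ⟩ := hG.reverse.exists_faceLabelling_of_faceCode P fun d => by
      obtain ⟨a, b, c, ha, hb, hc, h1, h2, h3, h⟩ := h d
      refine ⟨reverseCode m b, reverseCode m a, reverseCode m c, hb.reverseCode, ha.reverseCode,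
        hc.reverseCode, ?_, ?_, ?_, h.reverseCode ha hb hc⟩
      · rw [reverseCode_reverseCode hb, h2]
      · rw [reverseCode_reverseCode ha, h1]
      · rw [reverseCode_reverseCode hc, h3]
    exact ⟨_, Φ, hG.reverse, hΦ⟩

end IsDoublePath

namespace FaceLabelling

variable {V : Type*} [Finite V] {G : SimpleGraph V} {P : PlaneGraph G} {pt : ℕ ⊕ ℕ → V} {m n : ℕ}
  {Φ : Bool → Bool → ℕ → P.Face}

theorem swap (h : FaceLabelling P pt m n Φ) :
    FaceLabelling P (fun a => pt a.swap) n m (fun s => Φ !s) := by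
  have hlen : ∀ s, pathLength n m s = pathLength m n !s := by rintro (_ | _) <;> rfl
  refine ⟨fun D s t i hi => ?_, fun s t i s' t' i' hi hi' he => ?_, fun f => ?_⟩
  · rw [h.faceArea_eq D _ t i (hlen s ▸ hi)]
    cases s <;> cases t <;> rfl
  · have := h.injective _ _ _ _ _ _ (hlen s ▸ hi) (hlen s' ▸ hi') he
    simpa using this
  · obtain ⟨s, t, i, hi, rfl⟩ := h.surjective f
    exact ⟨!s, t, i, by rw [hlen, Bool.not_not]; exact hi, by rw [Bool.not_not]⟩

end FaceLabelling

/-! ### Area-universality from approximate area-universality -/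

namespace PlaneGraph

variable {V : Type*} [Finite V] {G : SimpleGraph V} {P : PlaneGraph G}

/-- After an area-preserving affine map, a drawing with counterclockwise inner triangles lies in a
disc whose size depends only on the area of the outer triangle. -/
theorem IsPositive.exists_normalized {D : V → ℂ} (hP : P.IsPositive D) {o : G.Dart}
    (ho : ¬ P.IsInner o) : ∃ D' : V → ℂ,
      (∀ x y z, dblArea (D' x) (D' y) (D' z) = dblArea (D x) (D y) (D z)) ∧
      ∀ x, ‖D' x‖ ≤ √(- P.triArea D o) := by
  have hA := hP.triArea_neg ho
  have ho₁ : ¬ P.IsInner (faceStep P.rot o) := by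
    rwa [IsInner, P.leftFace_faceStep]
  have ho₂ : ¬ P.IsInner (faceStep P.rot (faceStep P.rot o)) := by
    rwa [IsInner, P.leftFace_faceStep, P.leftFace_faceStep]
  have h0 := hP.side_outer_nonpos ho
  have h1 := hP.side_outer_nonpos ho₁
  have h2 := hP.side_outer_nonpos ho₂
  unfold side at h0 h1 h2
  rw [P.faceStep_fst] at h1
  rw [P.faceStep₂_fst, hP.triangulation.faceStep₂_snd] at h2
  change ∀ x, dblArea _ (D (P.apex o)) _ ≤ 0 at h1
  unfold triArea at *
  generalize D o.fst = a at *
  generalize D o.snd = b at *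
  generalize D (P.apex o) = c at *
  obtain ⟨A, hA'⟩ : ∃ A, A = - dblArea a b c := ⟨_, rfl⟩
  have hApos : 0 < A := by linarith
  rw [← hA']
  have hr : √A * √A = A := Real.mul_self_sqrt hApos.le
  have hrn : 0 ≤ √A := Real.sqrt_nonneg A
  generalize √A = r at *
  refine ⟨fun x => ⟨r * (dblArea a (D x) b / A), r * (dblArea a c (D x) / A)⟩, fun x y z => ?_,
    fun x => ?_⟩
  · have key : dblArea (⟨r * (dblArea a (D x) b / A), r * (dblArea a c (D x) / A)⟩ : ℂ)
        ⟨r * (dblArea a (D y) b / A), r * (dblArea a c (D y) / A)⟩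
        ⟨r * (dblArea a (D z) b / A), r * (dblArea a c (D z) / A)⟩ =
        r * r / A * (((dblArea a (D y) b - dblArea a (D x) b) *
          (dblArea a c (D z) - dblArea a c (D x)) - (dblArea a c (D y) - dblArea a c (D x)) *
          (dblArea a (D z) b - dblArea a (D x) b)) / A) := by
      simp only [dblArea.eq_1 ⟨_, _⟩]
      ring
    rw [key, hr, div_self hApos.ne', one_mul, div_eq_iff hApos.ne', hA']
    unfold dblArea
    ring
  · have e0 : 0 ≤ dblArea a (D x) b := by
      have := h0 x
      have e : dblArea a b (D x) = - dblArea a (D x) b := by unfold dblArea; ring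
      linarith
    have e2 : 0 ≤ dblArea a c (D x) := by
      have := h2 x
      rw [dblArea_swap] at this
      linarith
    have e1 : dblArea a (D x) b + dblArea a c (D x) ≤ A := by
      have := h1 x
      have e : dblArea b c (D x) = dblArea a (D x) b + dblArea a c (D x) + dblArea a b c := by
        unfold dblArea; ring
      linarith
    refine (Complex.norm_le_abs_re_add_abs_im _).trans ?_
    simp only
    rw [abs_of_nonneg (by positivity), abs_of_nonneg (by positivity), ← mul_add, ← add_div]
    exact mul_le_of_le_one_right hrn ((div_le_one hApos).2 e1)

theorem IsTriangulation.continuous_faceArea (hT : P.IsTriangulation) (f : P.Face) :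
    Continuous fun D => P.faceArea D f := by
  obtain ⟨d, rfl⟩ := P.exists_leftFace_eq f
  simp only [hT.faceArea_leftFace, dblArea]
  fun_prop

/-- A triangulation is area-universal if the area assignments that satisfy the necessary condition
`∑ f, P.faceArea D f = 0` can be approximated by arbitrary vertex placements: placements with
positive inner areas are plane drawings, and after normalization they converge. -/
theorem IsTriangulation.areaUniversal (hT : P.IsTriangulation)
    (hdart : ∀ x, ∃ d e : G.Dart, d.fst = x ∧ e.fst = x ∧ d ≠ e) [Fintype P.Face]
    (happrox : ∀ T : P.Face → ℝ, ∑ f, T f = 0 → ∀ η > 0, ∃ D : V → ℂ,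
      ∀ f, |P.faceArea D f - T f| < η) : P.AreaUniversal := by
  classical
  have : Fintype V := Fintype.ofFinite V
  intro a
  obtain ⟨o, ho⟩ := P.exists_leftFace_eq P.outerFace
  have ho' : ¬ P.IsInner o := fun h => h ho
  set b : P.Face → ℝ := fun f => if h : f ≠ P.outerFace then a ⟨f, h⟩ else 0 with hb
  have hb0 : ∀ f, 0 ≤ b f := by
    intro f
    simp only [hb]
    split_ifs
    · exact NNReal.coe_nonneg _
    · exact le_rfl
  set S : ℝ := ∑ f ∈ Finset.univ.erase P.outerFace, (b f + 1) with hS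
  have hS0 : 0 ≤ S := Finset.sum_nonneg fun f _ => by linarith [hb0 f]
  have key : ∀ N : ℕ, ∃ D : V → ℂ, P.IsEquivalentPlanarDrawing D ∧ ‖D‖ ≤ √(2 * (S + 1)) ∧
      ∀ f ≠ P.outerFace, |P.faceArea D f - b f| ≤ 2 / ((N : ℝ) + 1) := by
    intro N
    set δ : ℝ := 1 / ((N : ℝ) + 1) with hδ
    have hδ0 : 0 < δ := by positivity
    have hδ1 : δ ≤ 1 := by
      rw [hδ, div_le_one (by positivity)]
      have : (0 : ℝ) ≤ N := Nat.cast_nonneg N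
      linarith
    set T : P.Face → ℝ := fun f => if f = P.outerFace then
      - ∑ f ∈ Finset.univ.erase P.outerFace, (b f + δ) else b f + δ with hTdef
    have hTo : T P.outerFace = - ∑ f ∈ Finset.univ.erase P.outerFace, (b f + δ) := if_pos rfl
    have hTi : ∀ f ≠ P.outerFace, T f = b f + δ := fun f hf => if_neg hf
    have hsum : ∑ f, T f = 0 := by
      rw [← Finset.add_sum_erase _ _ (Finset.mem_univ P.outerFace), hTo,
        Finset.sum_congr rfl fun f hf => hTi f (Finset.ne_of_mem_erase hf)]
      exact neg_add_cancel _
    obtain ⟨D, hD⟩ := happrox T hsum δ hδ0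
    have hin : ∀ f ≠ P.outerFace, b f < P.faceArea D f ∧ P.faceArea D f < b f + 2 * δ := by
      intro f hf
      have := abs_lt.1 (hD f)
      rw [hTi f hf] at this
      constructor <;> linarith
    have htri : ∀ d, P.triArea D d = 2 * P.faceArea D (P.leftFace d) := by
      intro d
      rw [hT.faceArea_leftFace]
      unfold triArea
      ring
    have hpos : P.IsPositive D := ⟨hT, fun d hd => by
      rw [htri]
      linarith [(hin _ hd).1, hb0 (P.leftFace d)], hdart⟩
    have hout : - P.triArea D o ≤ 2 * (S + 1) := by
      have h1 := (abs_lt.1 (hD P.outerFace)).1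
      have h2 : ∑ f ∈ Finset.univ.erase P.outerFace, (b f + δ) ≤ S :=
        Finset.sum_le_sum fun f _ => by linarith
      rw [hTo] at h1
      rw [htri, ho]
      linarith
    obtain ⟨D', hD', hn⟩ := hpos.exists_normalized ho'
    have hpos' : P.IsPositive D' := ⟨hT, fun d hd => by
      have := hpos.triArea_pos d hd
      unfold triArea at this ⊢
      rwa [hD'], hdart⟩
    have harea : ∀ f, P.faceArea D' f = P.faceArea D f := by
      intro f
      obtain ⟨d, rfl⟩ := P.exists_leftFace_eq f
      rw [hT.faceArea_leftFace, hT.faceArea_leftFace, hD']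
    refine ⟨D', hpos'.isEquivalentPlanarDrawing, ?_, fun f hf => ?_⟩
    · rw [pi_norm_le_iff_of_nonneg (Real.sqrt_nonneg _)]
      exact fun x => (hn x).trans (Real.sqrt_le_sqrt hout)
    · rw [harea, abs_of_pos (by linarith [(hin f hf).1])]
      have : 2 / ((N : ℝ) + 1) = 2 * δ := by rw [hδ]; ring
      linarith [(hin f hf).2]
  choose s hs hbound harea using key
  obtain ⟨D, -, φ, hφ, hlim⟩ := (isCompact_closedBall (0 : V → ℂ) (√(2 * (S + 1)))).tendsto_subseq
    fun N => mem_closedBall_zero_iff.2 (hbound N)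
  refine ⟨D, ⟨s ∘ φ, fun N => hs _, hlim⟩, fun f => ?_⟩
  have h1 : Tendsto (fun N => P.faceArea (s (φ N)) f.1) atTop (𝓝 (P.faceArea D f.1)) :=
    ((hT.continuous_faceArea f.1).tendsto D).comp hlim
  have h0 : Tendsto (fun N : ℕ => 2 / ((N : ℝ) + 1)) atTop (𝓝 0) :=
    tendsto_const_nhds.div_atTop (tendsto_natCast_atTop_atTop.atTop_add tendsto_const_nhds)
  have h2 : Tendsto (fun N => P.faceArea (s (φ N)) f.1) atTop (𝓝 (b f.1)) := by
    rw [tendsto_iff_dist_tendsto_zero]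
    exact squeeze_zero (fun _ => dist_nonneg) (fun N => harea (φ N) f.1 f.2)
      (h0.comp hφ.tendsto_atTop)
  rw [tendsto_nhds_unique h1 h2, hb]
  simp only
  rw [dif_pos f.2]

end PlaneGraph

/-! ### Plane double paths -/

namespace FaceLabelling

variable {V : Type*} [Finite V] {G : SimpleGraph V} {P : PlaneGraph G} {pt : ℕ ⊕ ℕ → V}

theorem exists_approx {l k : ℕ} (hl : 1 ≤ l) (hk : 1 ≤ k) (heven : Even (l * k))
    {Φ : Bool → Bool → ℕ → P.Face} (hG : IsDoublePath G pt (l + 1) (k + 1))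
    (hΦ : FaceLabelling P pt (l + 1) (k + 1) Φ) [Fintype P.Face] (T : P.Face → ℝ)
    (hT : ∑ f, T f = 0) {η : ℝ} (hη : 0 < η) :
    ∃ D : V → ℂ, ∀ f, |P.faceArea D f - T f| < η := by
  classical
  set N : ℝ := (Fintype.card P.Face : ℝ) with hN
  have hN0 : 0 ≤ N := Nat.cast_nonneg _
  set ε : ℝ := η / (N + 1) with hε
  have hε0 : 0 < ε := by positivity
  have hεN : ε * (N + 1) = η := div_mul_cancel₀ _ (by positivity)
  obtain ⟨p, q, h1, h2, h3, h4⟩ := exists_approx_double_fan hl hk heven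
    (fun i => 2 * T (Φ false false i)) (fun i => - (2 * T (Φ false true i)))
    (fun j => 2 * T (Φ true false j)) (fun j => - (2 * T (Φ true true j))) hε0
  choose code hvalid hcode using hG.exists_code
  refine ⟨fun x => Sum.elim p q (code x), ?_⟩
  set D : V → ℂ := fun x => Sum.elim p q (code x) with hD
  have hDpt : ∀ a, ValidCode (l + 1) (k + 1) a → D (pt a) = Sum.elim p q a := fun a ha =>
    congrArg _ (hG.injOn _ _ (hvalid _) ha (hcode _))
  have harea : ∀ (s t : Bool) (i : ℕ), i < pathLength (l + 1) (k + 1) s →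
      P.faceArea D (Φ s t i) =
        dblArea (Sum.elim p q (triCode (l + 1) (k + 1) s t i).1)
          (Sum.elim p q (triCode (l + 1) (k + 1) s t i).2.1)
          (Sum.elim p q (triCode (l + 1) (k + 1) s t i).2.2) / 2 := by
    intro s t i hi
    obtain ⟨v1, v2, v3, -⟩ := triCode_spec (m := l + 1) (n := k + 1) s t hi
    rw [hΦ.faceArea_eq D s t i hi, hDpt _ v1, hDpt _ v2, hDpt _ v3]
  have hrev : ∀ x y z : ℂ, dblArea x z y = - dblArea x y z := by
    intro x y z; unfold dblArea; ring
  have hmost : ∀ f ≠ Φ true true k, |P.faceArea D f - T f| < ε := by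
    intro f hf
    obtain ⟨s, t, i, hi, rfl⟩ := hΦ.surjective f
    rw [harea s t i hi, abs_lt]
    cases s <;> cases t <;>
      simp only [triCode, Sum.elim_inl, Sum.elim_inr, pathLength] at hi ⊢
    · have := abs_lt.1 (h1 i (by omega))
      constructor <;> linarith
    · have := abs_lt.1 (h2 i (by omega))
      rw [hrev (q (k + 1)) (p i)]
      constructor <;> linarith
    · have := abs_lt.1 (h3 i (by omega))
      constructor <;> linarith
    · have hik : i ≠ k := fun h => hf (by rw [h])
      have := abs_lt.1 (h4 i (by omega))
      rw [hrev (p (l + 1)) (q i)]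
      constructor <;> linarith
  intro f
  have hεη : ε ≤ η := by nlinarith
  by_cases hf : f = Φ true true k
  · -- the remaining face: the signed areas of all faces have sum zero
    have hsum : P.faceArea D f - T f =
        - ∑ g ∈ Finset.univ.erase f, (P.faceArea D g - T g) := by
      have := Finset.add_sum_erase Finset.univ (fun g => P.faceArea D g - T g) (Finset.mem_univ f)
      rw [Finset.sum_sub_distrib (s := Finset.univ), P.sum_faceArea_eq_zero D, hT] at this
      linarith
    rw [hsum, abs_neg]
    calc |∑ g ∈ Finset.univ.erase f, (P.faceArea D g - T g)|
        ≤ ∑ g ∈ Finset.univ.erase f, |P.faceArea D g - T g| := Finset.abs_sum_le_sum_abs _ _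
      _ ≤ ∑ g ∈ Finset.univ.erase f, ε := Finset.sum_le_sum fun g hg =>
          (hmost g (hf ▸ Finset.ne_of_mem_erase hg)).le
      _ ≤ ∑ g : P.Face, ε := Finset.sum_le_sum_of_subset_of_nonneg (Finset.erase_subset _ _)
          fun _ _ _ => hε0.le
      _ = N * ε := by rw [Finset.sum_const, Finset.card_univ, nsmul_eq_mul]
      _ < η := by linarith
  · exact (hmost f hf).trans_le hεη

theorem areaUniversal {l k : ℕ} (hl : 1 ≤ l) (hk : 1 ≤ k) (heven : Even (l * k))
    {Φ : Bool → Bool → ℕ → P.Face} (hG : IsDoublePath G pt (l + 1) (k + 1))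
    (hΦ : FaceLabelling P pt (l + 1) (k + 1) Φ) : P.AreaUniversal := by
  have : Fintype P.Face := Fintype.ofFinite _
  exact (hG.isTriangulation P).areaUniversal hG.exists_two_darts fun T hT η hη =>
    hΦ.exists_approx hl hk heven hG T hT hη

/-- If both paths have even length, the faces at the first vertex and at the last vertex of a path
can be coloured alternatingly, in opposite ways, so that the outer face is white; then the
assignment `1` to the white inner faces and `0` to the black ones is not realizable. -/
theorem not_areaUniversal_of_outerFace_eq {m n J : ℕ} {t₀ : Bool} {Φ : Bool → Bool → ℕ → P.Face}
    (hm : Even m) (hn : Even n) (hG : IsDoublePath G pt m n) (hΦ : FaceLabelling P pt m n Φ)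
    (hJ : J < n) (hout : Φ true t₀ J = P.outerFace) : ¬ P.AreaUniversal := by
  classical
  intro hU
  obtain ⟨κ, hκ, hκ₁, hκ₂⟩ : ∃ κ < 2, (t₀ = true → J % 2 = κ) ∧ (t₀ = false → J % 2 ≠ κ) := by
    cases t₀
    · exact ⟨1 - J % 2, by omega, by simp, fun _ => by omega⟩
    · exact ⟨J % 2, by omega, fun _ => rfl, by simp⟩
  obtain ⟨D, -, hD⟩ := hU fun f => if ∃ s t i, i < pathLength m n s ∧ Φ s t i = f.1 ∧
    (i % 2 = κ ↔ s = t) then 1 else 0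
  have harea : ∀ s t i, i < pathLength m n s → (s ≠ true ∨ t ≠ t₀ ∨ i ≠ J) →
      dblArea (D (pt (triCode m n s t i).1)) (D (pt (triCode m n s t i).2.1))
        (D (pt (triCode m n s t i).2.2)) = if (i % 2 = κ ↔ s = t) then 2 else 0 := by
    intro s t i hi hne
    have hin : Φ s t i ≠ P.outerFace := by
      rw [← hout]
      intro h
      obtain ⟨h1, h2, h3⟩ := hΦ.injective _ _ _ _ _ _ hi hJ h
      tauto
    have h := hD ⟨_, hin⟩
    rw [hΦ.faceArea_eq D s t i hi] at h
    have hiff : (∃ s' t' i', i' < pathLength m n s' ∧ Φ s' t' i' = Φ s t i ∧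
        (i' % 2 = κ ↔ s' = t')) ↔ (i % 2 = κ ↔ s = t) := by
      constructor
      · rintro ⟨s', t', i', hi', he, hw⟩
        obtain ⟨rfl, rfl, rfl⟩ := hΦ.injective _ _ _ _ _ _ hi' hi he
        exact hw
      · exact fun hw => ⟨s, t, i, hi, rfl, hw⟩
    simp only [hiff] at h
    split_ifs at h ⊢
    · rw [NNReal.coe_one] at h
      linarith
    · rw [NNReal.coe_zero] at h
      linarith
  have hrev : ∀ x y z : ℂ, dblArea x y z = - dblArea x z y := by
    intro x y z; unfold dblArea; ring
  refine not_exists_alternating_double_fan (p := fun i => D (pt (.inl i)))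
    (q := fun j => D (pt (.inr j))) hm hn hG.two_le_left hG.two_le_right hκ (J := J)
    (w := fun _ => 2)
    (w' := fun j => if j = J then (if t₀ then
        - dblArea (D (pt (.inl m))) (D (pt (.inr J))) (D (pt (.inr (J + 1))))
      else dblArea (D (pt (.inl 0))) (D (pt (.inr J))) (D (pt (.inr (J + 1))))) else 2)
    (fun _ _ => two_pos) (fun j _ hj => by simp [hj]) ?_ ?_ ?_ ?_
  · intro i hi
    have := harea false false i hi (by simp)
    simpa [triCode] using this
  · intro i hi
    have := harea false true i hi (by simp)
    simp only [triCode] at this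
    rw [hrev, this]
    by_cases h : i % 2 = κ <;> simp [h]
  · intro j hj
    by_cases h : j = J ∧ t₀ = false
    · obtain ⟨rfl, rfl⟩ := h
      simp [hκ₂ rfl]
    · have := harea true false j hj (by
        by_contra hc
        push Not at hc
        exact h ⟨hc.2.2, hc.2.1.symm⟩)
      simp only [triCode] at this
      rw [this]
      by_cases h' : j % 2 = κ
      · simp [h']
      · have hjJ : j ≠ J := by
          rintro rfl
          cases t₀
          · exact h ⟨rfl, rfl⟩
          · exact h' (hκ₁ rfl)
        simp [h', hjJ]
  · intro j hj
    by_cases h : j = J ∧ t₀ = true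
    · obtain ⟨rfl, rfl⟩ := h
      simp [hκ₁ rfl]
    · have := harea true true j hj (by
        by_contra hc
        push Not at hc
        exact h ⟨hc.2.2, hc.2.1.symm⟩)
      simp only [triCode] at this
      rw [hrev, this]
      by_cases h' : j % 2 = κ
      · have hjJ : j ≠ J := by
          rintro rfl
          cases t₀
          · exact hκ₂ rfl h'
          · exact h ⟨rfl, rfl⟩
        simp [h', hjJ]
      · simp [h']

theorem not_areaUniversal {m n : ℕ} {Φ : Bool → Bool → ℕ → P.Face} (hm : Even m) (hn : Even n)
    (hG : IsDoublePath G pt m n) (hΦ : FaceLabelling P pt m n Φ) : ¬ P.AreaUniversal := by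
  obtain ⟨s, t, J, hJ, hout⟩ := hΦ.surjective P.outerFace
  cases s
  · exact hΦ.swap.not_areaUniversal_of_outerFace_eq hn hm hG.swap hJ hout
  · exact hΦ.not_areaUniversal_of_outerFace_eq hm hn hG hJ hout

end FaceLabelling

/-! ### Double stacking graphs are double paths -/

/-- The vertices of `DS(l, k)` along the two paths `B, A, (new vertices on Au), u` and
`C, w, (new vertices on vw), v`. Codes beyond the ends of the paths are sent to these ends. -/
def doubleStackingVertex (l k : ℕ) : ℕ ⊕ ℕ → (OctVertex ⊕ Fin (l - 1)) ⊕ Fin (k - 1)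
  | .inl 0 => .inl (.inl .B)
  | .inl 1 => .inl (.inl .A)
  | .inl (i + 2) => if h : i < l - 1 then .inl (.inr ⟨i, h⟩) else .inl (.inl .u)
  | .inr 0 => .inl (.inl .C)
  | .inr 1 => .inl (.inl .w)
  | .inr (j + 2) => if h : k - 2 - j < k - 1 ∧ j < k - 1 then .inr ⟨k - 2 - j, h.1⟩
    else .inl (.inl .v)

/-- The inverse of `doubleStackingVertex`. -/
def doubleStackingCode (l k : ℕ) : (OctVertex ⊕ Fin (l - 1)) ⊕ Fin (k - 1) → ℕ ⊕ ℕ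
  | .inl (.inl .B) => .inl 0
  | .inl (.inl .A) => .inl 1
  | .inl (.inr i) => .inl (i + 2)
  | .inl (.inl .u) => .inl (l + 1)
  | .inl (.inl .C) => .inr 0
  | .inl (.inl .w) => .inr 1
  | .inr j => .inr (k - j)
  | .inl (.inl .v) => .inr (k + 1)

theorem validCode_doubleStackingCode (l k : ℕ) (x : (OctVertex ⊕ Fin (l - 1)) ⊕ Fin (k - 1)) :
    ValidCode (l + 1) (k + 1) (doubleStackingCode l k x) := by
  rcases x with (x | x) | x
  · cases x <;> simp [doubleStackingCode, ValidCode]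
  · have := x.isLt
    simp only [doubleStackingCode, ValidCode]
    omega
  · simp only [doubleStackingCode, ValidCode]
    omega

theorem doubleStackingVertex_code {l k : ℕ} (hl : 1 ≤ l) (hk : 1 ≤ k)
    (x : (OctVertex ⊕ Fin (l - 1)) ⊕ Fin (k - 1)) :
    doubleStackingVertex l k (doubleStackingCode l k x) = x := by
  rcases x with (x | x) | x
  · obtain ⟨l, rfl⟩ := Nat.exists_eq_add_of_le' hl
    obtain ⟨k, rfl⟩ := Nat.exists_eq_add_of_le' hk
    cases x <;> simp [doubleStackingCode, doubleStackingVertex]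
  · simp [doubleStackingCode, doubleStackingVertex]
  · have hx := x.isLt
    obtain ⟨j, hj⟩ : ∃ j, k - x.val = j + 2 := ⟨k - x.val - 2, by omega⟩
    simp only [doubleStackingCode, hj, doubleStackingVertex]
    rw [dif_pos (by omega)]
    exact congrArg Sum.inr (Fin.ext (by simp only; omega))

theorem doubleStackingCode_vertex {l k : ℕ} (hl : 1 ≤ l) (hk : 1 ≤ k) {a : ℕ ⊕ ℕ}
    (ha : ValidCode (l + 1) (k + 1) a) :
    doubleStackingCode l k (doubleStackingVertex l k a) = a := by
  rcases a with (_ | _ | i) | (_ | _ | j) <;>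
    simp only [ValidCode, doubleStackingVertex, doubleStackingCode] at *
  · split_ifs with h
    · rfl
    · exact congrArg Sum.inl (by omega)
  · split_ifs with h
    · exact congrArg Sum.inr (by simp only; omega)
    · exact congrArg Sum.inr (by omega)

theorem doubleStacking_adj_iff {l k : ℕ} (hl : 1 ≤ l) (hk : 1 ≤ k)
    (x y : (OctVertex ⊕ Fin (l - 1)) ⊕ Fin (k - 1)) : (doubleStacking l k).Adj x y ↔
      AdjCode (l + 1) (k + 1) (doubleStackingCode l k x) (doubleStackingCode l k y) := by
  rcases x with (x | x) | x <;> rcases y with (y | y) | y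
  · cases x <;> cases y <;>
      simp [doubleStacking, diamond, diamondAdj, octahedron, OctVertex.opp, doubleStackingCode,
        AdjCode] <;> omega
  · have := y.isLt
    cases x <;>
      simp [doubleStacking, diamond, diamondAdj, octahedron, OctVertex.opp, doubleStackingCode,
        AdjCode] <;> omega
  · have := y.isLt
    cases x <;>
      simp [doubleStacking, diamond, diamondAdj, octahedron, OctVertex.opp, doubleStackingCode,
        AdjCode] <;> omega
  · have := x.isLt
    cases y <;>
      simp [doubleStacking, diamond, diamondAdj, octahedron, OctVertex.opp, doubleStackingCode,
        AdjCode] <;> omega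
  · have := x.isLt
    have := y.isLt
    simp [doubleStacking, diamond, diamondAdj, octahedron, OctVertex.opp, doubleStackingCode,
      AdjCode]
  · have := x.isLt
    have := y.isLt
    simp [doubleStacking, diamond, diamondAdj, octahedron, OctVertex.opp, doubleStackingCode,
      AdjCode]
    omega
  · have := x.isLt
    cases y <;>
      simp [doubleStacking, diamond, diamondAdj, octahedron, OctVertex.opp, doubleStackingCode,
        AdjCode] <;> omega
  · have := x.isLt
    have := y.isLt
    simp [doubleStacking, diamond, diamondAdj, octahedron, OctVertex.opp, doubleStackingCode,
      AdjCode]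
    omega
  · have := x.isLt
    have := y.isLt
    simp [doubleStacking, diamond, diamondAdj, octahedron, OctVertex.opp, doubleStackingCode,
      AdjCode]
    omega

theorem isDoublePath_doubleStacking {l k : ℕ} (hl : 1 ≤ l) (hk : 1 ≤ k) :
    IsDoublePath (doubleStacking l k) (doubleStackingVertex l k) (l + 1) (k + 1) where
  two_le_left := by omega
  two_le_right := by omega
  exists_code x :=
    ⟨_, validCode_doubleStackingCode l k x, doubleStackingVertex_code hl hk x⟩
  injOn a b ha hb h := by
    rw [← doubleStackingCode_vertex hl hk ha, h, doubleStackingCode_vertex hl hk hb]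
  adj_iff a b ha hb := by
    rw [doubleStacking_adj_iff hl hk, doubleStackingCode_vertex hl hk ha,
      doubleStackingCode_vertex hl hk hb]

theorem theorem4 (l k : ℕ) (hl : 1 ≤ l) (hk : 1 ≤ k) (P : PlaneGraph (doubleStacking l k)) :
    P.AreaUniversal ↔ Even (l * k) := by
  obtain ⟨pt, Φ, hG, hΦ⟩ := (isDoublePath_doubleStacking hl hk).exists_faceLabelling P
  refine ⟨fun hU => ?_, fun heven => hΦ.areaUniversal hl hk heven hG⟩
  by_contra hodd
  rw [Nat.not_even_iff_odd, Nat.odd_mul] at hodd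
  exact hΦ.not_areaUniversal hodd.1.add_one hodd.2.add_one hG hU
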